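/- Let $d\ge 1$, let $\gamma_d(dx)=\pi^{-d/2}e^{-|x|^2}dx$ on $\mathbb R^d$ and $\mu(dt)=dt/t$ on $(0,\infty)$. For a measure $m$, a measurable finite exponent $r(\cdot)\ge 1$ and a measurable $g$, put $\|g\|_{r(\cdot),m}=\inf\{\lambda>0:\int |g/\lambda|^{r(\cdot)}\,dm\le 1\}$ (with $\inf\emptyset=\infty$), and let $L^{r(\cdot)}(m)$ be the set of measurable $g$ with $\int|g/\lambda|^{r(\cdot)}dm<\infty$ for some $\lambda>0$. Let $p:\mathbb R^d\to[1,\infty)$ satisfy $p(\cdot)\in\mathcal P^\infty_{\gamma_d}(\mathbb R^d)\cap LH_0(\mathbb R^d)$, i.e. there are $C>0$ and $p_\infty\ge1$ with $|p(x)-p_\infty|\le C/|x|^2$ for all $x\ne0$, and there is $C_1>0$ with $|p(x)-p(y)|\le C_1/\log(e+1/|x-y|)$ for all $x,y$. Let $\mathcal P_{0,\infty}$ be the set of measurable $q:(0,\infty)\to(0,\infty)$ with $1\le \operatorname{ess\,inf} q\le\operatorname{ess\,sup} q<\infty$ such that $q(0)=\lim_{t\to0^+}q(t)$ and $q(\infty)=\lim_{t\to\infty}q(t)$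 exist (and are finite) and, for some constant $A$, $|q(t)-q(0)|\le A/\ln(1/t)$ for $0<t\le 1/2$ and $|q(t)-q(\infty)|\le A/\ln t$ for $t>2$. Let $T_t f(x)=(1-e^{-2t})^{-d/2}\int_{\mathbb R^d} \exp\!\Big(-\frac{e^{-2t}(|x|^2+|y|^2)-2e^{-t}\langle x,y\rangle}{1-e^{-2t}}\Big)f(y)\,\gamma_d(dy)$ be the Ornstein–Uhlenbeck semigroup and $P_tf(x)=\int_0^\infty T_sf(x)\,\frac{t}{2\sqrt\pi}e^{-t^2/4s}s^{-3/2}\,ds$ the Poisson–Hermite semigroup. For $\alpha\ge0$ let $k$ be the smallest integer greater than $\alpha$. For $q\in\mathcal P_{0,\infty}$, $B^\alpha_{p(\cdot),q(\cdot)}(\gamma_d)$ is the set of $f\in L^{p(\cdot)}(\gamma_d)$ with $$\Big\|\,t^{k-\alpha}\big\|\partial_t^kP_tf\big\|_{p(\cdot),\gamma_d}\Big\|_{q(\cdot),\mu}<\infty ,$$ and $B^\alpha_{p(\cdot),\infty}(\gamma_d)$ is the set of $f\in L^{p(\cdot)}(\gamma_d)$ for which there is a constant $A$ with $\|\partial_t^kP_tf\|_{p(\cdot),\gamma_d}\le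 A\,t^{-k+\alpha}$ for all $t>0$. Let $q_1,q_2\in\mathcal P_{0,\infty}$. Then: 1. if $\alpha_1>\alpha_2>0$, then $B^{\alpha_1}_{p(\cdot),q_1(\cdot)}(\gamma_d)\subset B^{\alpha_2}_{p(\cdot),q_2(\cdot)}(\gamma_d)$ (no relation between $q_1$ and $q_2$ is needed); 2. if $\alpha_1=\alpha_2=\alpha\ge0$ and $q_1(t)\le q_2(t)$ for a.e. $t>0$, then $B^{\alpha}_{p(\cdot),q_1(\cdot)}(\gamma_d)\subset B^{\alpha}_{p(\cdot),q_2(\cdot)}(\gamma_d)$; 3. for every $\alpha\ge0$ and $q\in\mathcal P_{0,\infty}$, $B^{\alpha}_{p(\cdot),q(\cdot)}(\gamma_d)\subset B^{\alpha}_{p(\cdot),\infty}(\gamma_d)$. -/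

import Mathlib

open MeasureTheory Set Filter Topology
open scoped ENNReal

noncomputable section

namespace GaussianBesov

/-! ### Variable exponent Lebesgue spaces (finite exponents) -/

/-- The modular `∫ g(x)^{p(x)} m(dx)` of a nonnegative extended-valued function `g`, for a
real-valued exponent `p` (so that the set where the exponent is infinite is empty). -/
def modular {X : Type*} [MeasurableSpace X] (m : Measure X) (p : X → ℝ) (g : X → ℝ≥0∞) : ℝ≥0∞ :=
  ∫⁻ x, g x ^ p x ∂m

/-- The Luxemburg norm `inf {c > 0 : ρ(g / c) ≤ 1}`, with the infimum of the empty set being `∞`. -/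
def luxNorm {X : Type*} [MeasurableSpace X] (m : Measure X) (p : X → ℝ) (g : X → ℝ≥0∞) : ℝ≥0∞ :=
  sInf {c : ℝ≥0∞ | 0 < c ∧ c < ∞ ∧ modular m p (fun x => g x / c) ≤ 1}

/-- The variable Lebesgue space `L^{p(·)}(m)`, as a set of functions. -/
def variableLp {X : Type*} [MeasurableSpace X] (m : Measure X) (p : X → ℝ) : Set (X → ℝ) :=
  {f | AEMeasurable f m ∧
    ∃ c : ℝ≥0∞, 0 < c ∧ c < ∞ ∧ modular m p (fun x => ‖f x‖ₑ / c) < ∞}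

/-! ### The two measures -/

/-- The Gaussian measure `γ_d(dx) = π^{-d/2} e^{-|x|²} dx` on `ℝ^d`. -/
def gaussianMeasure (d : ℕ) : Measure (EuclideanSpace ℝ (Fin d)) :=
  volume.withDensity
    (fun x => ENNReal.ofReal (Real.exp (-‖x‖ ^ 2) / Real.pi ^ ((d : ℝ) / 2)))

/-- The measure `μ(dt) = dt / t` on `(0, ∞)`. -/
def haarPos : Measure ℝ :=
  (volume.restrict (Ioi (0 : ℝ))).withDensity (fun t => ENNReal.ofReal (1 / t))

/-! ### Classes of exponents -/

/-- Local log-Hölder continuity, `p ∈ LH₀(ℝ^d)`. -/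
def LogHolderLocal {d : ℕ} (p : EuclideanSpace ℝ (Fin d) → ℝ) : Prop :=
  ∃ C : ℝ, 0 < C ∧ ∀ x y, |p x - p y| ≤ C / Real.log (Real.exp 1 + 1 / ‖x - y‖)

/-- `p ∈ 𝒫^∞_{γ_d}(ℝ^d)` for a real-valued exponent: `p` is measurable with values in `[1, ∞)`
and `|p(x) - p_∞| ≤ C / |x|²` for `x ≠ 0`, for some `p_∞ ≥ 1` and some `C > 0`. -/
structure GaussianExponent {d : ℕ} (p : EuclideanSpace ℝ (Fin d) → ℝ) : Prop where
  aemeasurable : AEMeasurable p (gaussianMeasure d)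
  one_le : ∀ x, 1 ≤ p x
  decay : ∃ C pinf : ℝ, 0 < C ∧ 1 ≤ pinf ∧ ∀ x, x ≠ 0 → |p x - pinf| ≤ C / ‖x‖ ^ 2

/-- `q ∈ 𝒫_{0,∞}`: a measurable `q : (0, ∞) → (0, ∞)`, essentially bounded, essentially bounded
below by `1`, with a logarithmic rate of convergence to limits at `0` and at `∞`. Only the values
of `q` on `(0, ∞)` are used. -/
structure HalfLineExponent (q : ℝ → ℝ) : Prop where
  aemeasurable : AEMeasurable q haarPos
  pos : ∀ t, 0 < t → 0 < q t
  one_le : ∀ᵐ t ∂haarPos, 1 ≤ q t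
  bounded : ∃ M : ℝ, ∀ᵐ t ∂haarPos, q t ≤ M
  at_zero : ∃ q0 : ℝ, Tendsto q (𝓝[>] 0) (𝓝 q0) ∧
    ∃ A : ℝ, ∀ t, 0 < t → t ≤ 1 / 2 → |q t - q0| ≤ A / Real.log (1 / t)
  at_top : ∃ qinf : ℝ, Tendsto q atTop (𝓝 qinf) ∧
    ∃ A : ℝ, ∀ t, 2 < t → |q t - qinf| ≤ A / Real.log t

/-! ### The semigroups -/

/-- The Ornstein-Uhlenbeck semigroup `T_t f(x)`, by its kernel with respect to `γ_d`. -/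
def ouSemigroup {d : ℕ} (t : ℝ) (f : EuclideanSpace ℝ (Fin d) → ℝ)
    (x : EuclideanSpace ℝ (Fin d)) : ℝ :=
  1 / (1 - Real.exp (-2 * t)) ^ ((d : ℝ) / 2) *
    ∫ y, Real.exp (-((Real.exp (-2 * t) * (‖x‖ ^ 2 + ‖y‖ ^ 2)
        - 2 * Real.exp (-t) * inner ℝ x y) / (1 - Real.exp (-2 * t)))) * f y ∂(gaussianMeasure d)

/-- The density in `s` of the one-sided stable measure `μ_t^{(1/2)}` of order `1/2`. -/
def stableDensity (t s : ℝ) : ℝ :=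
  t / (2 * √Real.pi) * Real.exp (-(t ^ 2) / (4 * s)) * s ^ (-(3 / 2) : ℝ)

/-- The Poisson-Hermite semigroup `P_t f(x) = ∫_0^∞ T_s f(x) μ_t^{(1/2)}(ds)`. -/
def poissonHermite {d : ℕ} (t : ℝ) (f : EuclideanSpace ℝ (Fin d) → ℝ)
    (x : EuclideanSpace ℝ (Fin d)) : ℝ :=
  ∫ s in Ioi (0 : ℝ), ouSemigroup s f x * stableDensity t s

/-- `‖∂^k P_t f / ∂t^k‖_{p(·), γ_d}` as a function of `t`. -/
def derivNorm {d : ℕ} (p : EuclideanSpace ℝ (Fin d) → ℝ) (k : ℕ)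
    (f : EuclideanSpace ℝ (Fin d) → ℝ) (t : ℝ) : ℝ≥0∞ :=
  luxNorm (gaussianMeasure d) p (fun x => ‖iteratedDeriv k (fun s => poissonHermite s f x) t‖ₑ)

/-! ### Variable Gaussian Besov-Lipschitz spaces -/

/-- The smallest integer strictly greater than `α`, for `α ≥ 0`. -/
def besovOrder (α : ℝ) : ℕ := ⌊α⌋₊ + 1

/-- `B^α_{p(·), q(·)}(γ_d)`, for `α ≥ 0`. -/
def besov {d : ℕ} (p : EuclideanSpace ℝ (Fin d) → ℝ) (q : ℝ → ℝ) (α : ℝ) :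
    Set (EuclideanSpace ℝ (Fin d) → ℝ) :=
  {f | f ∈ variableLp (gaussianMeasure d) p ∧
    luxNorm haarPos q (fun t =>
      ENNReal.ofReal (t ^ ((besovOrder α : ℝ) - α)) * derivNorm p (besovOrder α) f t) < ∞}

/-- `B^α_{p(·), ∞}(γ_d)`, for `α ≥ 0`. -/
def besovInfty {d : ℕ} (p : EuclideanSpace ℝ (Fin d) → ℝ) (α : ℝ) :
    Set (EuclideanSpace ℝ (Fin d) → ℝ) :=
  {f | f ∈ variableLp (gaussianMeasure d) p ∧
    ∃ A : ℝ, ∀ t, 0 < t →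
      derivNorm p (besovOrder α) f t ≤ ENNReal.ofReal (A * t ^ (-(besovOrder α : ℝ) + α))}

end GaussianBesov

end

/-!
Write `γ` for the Gaussian measure, `K_t` for the Mehler kernel, so that
`T_t f(x) = ∫ K_t(x, y) f(y) γ(dy)`, and `σ_t` for the stable density that subordinates the
Poisson-Hermite semigroup to `T`. All three inclusions follow from two facts about
`N_k(t) = ‖∂_t^k P_t f‖_{p(·)}`: it is almost decreasing, `N_k(t + s) ≤ C N_k(t)`, and it is at most
`C t^{-k} ‖f‖_{p(·)}`.

Both rest on one uniform bound, `exists_luxNorm_ouAverage_le`: for a probability measure `m` on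
`(0, ∞)`, the operator `F ↦ ∫ ∫ K_s(·, y) F(y) γ(dy) m(ds)` is bounded on `L^{p(·)}(γ)` with a
constant independent of `m`. If `∫ F^p dγ ≤ 1`, put `A = 1 + ∫ K_t(x, y) F(y)^{p(y)} γ(dy)` and
split `F` at the level `L = A^{1/p(x)}`, so that `F ≤ L + F^{p(y)} L^{1 - p(y)}`. The claim
`(∫ K_t(x, y) F(y) γ(dy))^{p(x)} ≤ C A` then follows if
`K_t(x, y) L^{p(x) - p(y)} ≤ C (K_t(x, y) + A)` for all `y`. That is the content of
`exponent_kernel_dichotomy`: either `(p(x) - p(y)) log A` is bounded, or `K_t(x, y)` is at most a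
constant times `A^{1/P}` with `P = sup p`. Points close to each other at the scale of the kernel are
handled by the local log-Hölder condition, distant comparable points by the decay of the kernel or
by the decay of `p` at infinity, and incomparable points by the boundedness of the kernel.
Integrating over `x`, where `K_s` is symmetric of mass one, and using Jensen's inequality for `m`
gives the bound.

The time derivatives of `σ_t` satisfy `|∂_t^k σ_t| ≤ C t^{-k} σ_{t/2}`, which gives
`N_k(t) ≤ C t^{-k} ‖f‖` (`exists_luxNorm_poissonDeriv_le_rpow`). The identity
`σ_t * σ_s = σ_{t+s}` (`conv_stableMeasure`) and the semigroup law of the Mehler kernel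
(`lintegral_mehlerKernel_mul_mehlerKernel`) write `∂_t^k P_{t+s} f` as an average of
`∂_t^k P_t f`, which gives almost monotonicity (`enorm_poissonDeriv_add_le`).

Almost monotonicity means that the norm of `t^{k-α} N_k(t)` over `(t/2, t)` controls its value at
`t`; this is the inclusion in `B^α_{p(·),∞}`. Hence `t^{k-α} N_k(t)` is bounded, and after dividing
by a bound the modular decreases when the exponent increases, which is the second inclusion. For the
first, let `k₁`, `k₂` be the orders belonging to `α₁`, `α₂`, and take `β` with `α₂ < β < k₂` and
`β ≤ α₁`. For small `t`, `N_{k₁}(t) = O(t^{β - k₁})`, and integrating from `t` to `1` lowers the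
order one step at a time down to `N_{k₂}(t) = O(t^{β - k₂})`, which makes `t^{k₂ - α₂} N_{k₂}(t)`
integrable at `0` against `dt / t`; at infinity `N_{k₂}(t) = O(t^{-k₂})` suffices.
-/

namespace GaussianBesov

/-! ### The Luxemburg norm -/

section Luxemburg

variable {X : Type*} [MeasurableSpace X] {m : Measure X} {p : X → ℝ} {g h : X → ℝ≥0∞}

lemma modular_mono (hp : ∀ᵐ x ∂m, 1 ≤ p x) (hgh : ∀ᵐ x ∂m, g x ≤ h x) :
    modular m p g ≤ modular m p h := by
  refine lintegral_mono_ae ?_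
  filter_upwards [hp, hgh] with x hx hx'
  exact ENNReal.rpow_le_rpow hx' (by linarith)

lemma luxNorm_mono (hp : ∀ᵐ x ∂m, 1 ≤ p x) (hgh : ∀ᵐ x ∂m, g x ≤ h x) :
    luxNorm m p g ≤ luxNorm m p h := by
  refine sInf_le_sInf ?_
  rintro c ⟨h0, h1, h2⟩
  refine ⟨h0, h1, le_trans (modular_mono hp ?_) h2⟩
  filter_upwards [hgh] with x hx using ENNReal.div_le_div_right hx c

lemma modular_div_le_one_of_luxNorm_lt (hp : ∀ᵐ x ∂m, 1 ≤ p x) {c : ℝ≥0∞}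
    (hc : luxNorm m p g < c) : modular m p (fun x => g x / c) ≤ 1 := by
  obtain ⟨b, ⟨_, _, hb⟩, hbc⟩ := sInf_lt_iff.1 hc
  refine le_trans (modular_mono hp ?_) hb
  exact ae_of_all _ fun x => ENNReal.div_le_div_left hbc.le _

/-- Since the exponent is at least `1`, dividing by `D ≥ 1` divides the modular by at least `D`. -/
lemma modular_div_le_div (hp : ∀ᵐ x ∂m, 1 ≤ p x) {D : ℝ≥0∞} (hD : 1 ≤ D) :
    modular m p (fun x => g x / D) ≤ modular m p g / D := by
  by_cases hDt : D = ∞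
  · subst hDt
    have : modular m p (fun x => g x / ∞) ≤ ∫⁻ _, 0 ∂m := by
      refine lintegral_mono_ae ?_
      filter_upwards [hp] with x hx
      rw [ENNReal.div_top, ENNReal.zero_rpow_of_pos (by linarith)]
    simpa using this
  rw [ENNReal.div_eq_inv_mul]
  unfold modular
  rw [← lintegral_const_mul' _ _ (by simpa using fun h => by simp [h] at hD)]
  refine lintegral_mono_ae ?_
  filter_upwards [hp] with x hx
  rw [ENNReal.div_eq_inv_mul, ENNReal.mul_rpow_of_nonneg _ _ (by linarith)]
  gcongr
  calc D⁻¹ ^ p x ≤ D⁻¹ ^ (1 : ℝ) :=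
        ENNReal.rpow_le_rpow_of_exponent_ge (ENNReal.inv_le_one.2 hD) hx
    _ = D⁻¹ := by simp

lemma luxNorm_le_of_modular_le (hp : ∀ᵐ x ∂m, 1 ≤ p x) {c D : ℝ≥0∞} (hc : 0 < c) (hct : c < ∞)
    (hD : 1 ≤ D) (hDt : D < ∞) (h : modular m p (fun x => g x / c) ≤ D) :
    luxNorm m p g ≤ D * c := by
  have hD0 : D ≠ 0 := fun h => by simp [h] at hD
  refine sInf_le ⟨ENNReal.mul_pos hD0 hc.ne', ENNReal.mul_lt_top hDt hct, ?_⟩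
  have e : (fun x => g x / (D * c)) = fun x => (g x / c) / D := by
    funext x
    rw [ENNReal.div_eq_inv_mul, ENNReal.div_eq_inv_mul, ENNReal.div_eq_inv_mul,
      ENNReal.mul_inv (Or.inl hD0) (Or.inl hDt.ne), mul_assoc]
  rw [e]
  refine (modular_div_le_div hp hD).trans ?_
  exact ENNReal.div_le_of_le_mul (by simpa using h)

lemma luxNorm_lt_top_of_modular_lt_top (hp : ∀ᵐ x ∂m, 1 ≤ p x) {c : ℝ≥0∞} (hc : 0 < c)
    (hct : c < ∞) (h : modular m p (fun x => g x / c) < ∞) : luxNorm m p g < ∞ :=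
  (luxNorm_le_of_modular_le hp hc hct (le_max_left 1 _) (max_lt ENNReal.one_lt_top h)
    (le_max_right _ _)).trans_lt (ENNReal.mul_lt_top (max_lt ENNReal.one_lt_top h) hct)

/-- Triangle inequality up to the factor `2`. -/
lemma luxNorm_add_le_two_mul (hp : ∀ᵐ x ∂m, 1 ≤ p x) (hpm : AEMeasurable p m)
    (hg : AEMeasurable g m) {c : ℝ≥0∞} (hct : c < ∞)
    (h1 : luxNorm m p g < c) (h2 : luxNorm m p h < c) :
    luxNorm m p (fun x => g x + h x) ≤ 2 * c := by
  have hc : 0 < c := pos_of_gt h1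
  refine sInf_le ⟨ENNReal.mul_pos (by simp) hc.ne', ENNReal.mul_lt_top (by simp) hct, ?_⟩
  have hle : modular m p (fun x => (g x + h x) / (2 * c)) ≤
      ∫⁻ x, 2⁻¹ * (g x / c) ^ p x + 2⁻¹ * (h x / c) ^ p x ∂m := by
    refine lintegral_mono_ae ?_
    filter_upwards [hp] with x hx
    have := ENNReal.rpow_arith_mean_le_arith_mean2_rpow 2⁻¹ 2⁻¹ (g x / c) (h x / c)
      (ENNReal.inv_two_add_inv_two) hx
    refine le_trans (le_of_eq ?_) this
    congr 1
    rw [← mul_add, ← ENNReal.add_div, ENNReal.div_eq_inv_mul, ENNReal.div_eq_inv_mul,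
      ENNReal.mul_inv (by simp) (by simp), mul_assoc]
  refine hle.trans ?_
  rw [lintegral_add_left' (((hg.div_const c).pow hpm).const_mul _),
    lintegral_const_mul' _ _ (by simp), lintegral_const_mul' _ _ (by simp)]
  calc _ ≤ 2⁻¹ * (1 : ℝ≥0∞) + 2⁻¹ * 1 := by
        gcongr
        · exact modular_div_le_one_of_luxNorm_lt hp h1
        · exact modular_div_le_one_of_luxNorm_lt hp h2
    _ = 1 := by simp [ENNReal.inv_two_add_inv_two]

/-- Jensen's inequality for the power function on a probability space. -/
lemma lintegral_rpow_le_of_isProbabilityMeasure {Ω : Type*} [MeasurableSpace Ω] {μ : Measure Ω}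
    [IsProbabilityMeasure μ] {u : Ω → ℝ≥0∞} (hu : AEMeasurable u μ) {r : ℝ} (hr : 1 ≤ r) :
    (∫⁻ ω, u ω ∂μ) ^ r ≤ ∫⁻ ω, u ω ^ r ∂μ := by
  have h := eLpNorm'_le_eLpNorm'_of_exponent_le (p := 1) (q := r) one_pos hr μ
    hu.aestronglyMeasurable
  simp only [eLpNorm', enorm_eq_self, ENNReal.rpow_one, div_one] at h
  calc _ ≤ ((∫⁻ ω, u ω ^ r ∂μ) ^ (1 / r)) ^ r := ENNReal.rpow_le_rpow h (by linarith)
    _ = _ := by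
      rw [← ENNReal.rpow_mul, one_div_mul_cancel (by linarith), ENNReal.rpow_one]

end Luxemburg

/-! ### The Mehler kernel -/

section Mehler

variable {d : ℕ}

lemma lintegral_exp_neg_mul_sq_norm {B : ℝ} (hB : 0 < B) :
    ∫⁻ y : EuclideanSpace ℝ (Fin d), ENNReal.ofReal (Real.exp (-B * ‖y‖ ^ 2)) =
      ENNReal.ofReal ((Real.pi / B) ^ ((d : ℝ) / 2)) := by
  have h := GaussianFourier.integral_rexp_neg_mul_sq_norm (V := EuclideanSpace ℝ (Fin d)) hB
  rw [finrank_euclideanSpace_fin] at h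
  have hi : Integrable (fun y : EuclideanSpace ℝ (Fin d) => Real.exp (-B * ‖y‖ ^ 2)) := by
    by_contra hc
    rw [integral_undef hc] at h
    have : 0 < (Real.pi / B) ^ ((d : ℝ) / 2) := by positivity
    linarith
  rw [← h, ofReal_integral_eq_lintegral_ofReal hi (ae_of_all _ fun _ => (Real.exp_pos _).le)]

/-- The Laplace transform of the Gaussian measure against a quadratic exponential. -/
lemma lintegral_gaussianMeasure_exp {B : ℝ} (hB : 0 < B) (w : EuclideanSpace ℝ (Fin d)) :
    ∫⁻ y, ENNReal.ofReal (Real.exp (-(B - 1) * ‖y‖ ^ 2 + inner ℝ w y)) ∂(gaussianMeasure d) =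
      ENNReal.ofReal ((1 / B) ^ ((d : ℝ) / 2) * Real.exp (‖w‖ ^ 2 / (4 * B))) := by
  have hpi : 0 < Real.pi ^ ((d : ℝ) / 2) := by positivity
  have key : ∀ y : EuclideanSpace ℝ (Fin d),
      ENNReal.ofReal (Real.exp (-‖y‖ ^ 2) / Real.pi ^ ((d : ℝ) / 2)) *
      ENNReal.ofReal (Real.exp (-(B - 1) * ‖y‖ ^ 2 + inner ℝ w y)) =
      ENNReal.ofReal (Real.exp (‖w‖ ^ 2 / (4 * B)) / Real.pi ^ ((d : ℝ) / 2)) *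
        ENNReal.ofReal (Real.exp (-B * ‖y - (1 / (2 * B)) • w‖ ^ 2)) := by
    intro y
    rw [← ENNReal.ofReal_mul (by positivity), ← ENNReal.ofReal_mul (by positivity)]
    congr 1
    rw [div_mul_eq_mul_div, div_mul_eq_mul_div, ← Real.exp_add, ← Real.exp_add]
    congr 2
    rw [norm_sub_sq_real, inner_smul_right, norm_smul, real_inner_comm, Real.norm_eq_abs,
      mul_pow, sq_abs]
    field_simp
    ring
  unfold gaussianMeasure
  rw [lintegral_withDensity_eq_lintegral_mul _ (by fun_prop) (by fun_prop)]
  simp only [Pi.mul_apply]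
  simp_rw [key]
  rw [lintegral_const_mul' _ _ ENNReal.ofReal_ne_top,
    lintegral_sub_right_eq_self (fun y : EuclideanSpace ℝ (Fin d) =>
      ENNReal.ofReal (Real.exp (-B * ‖y‖ ^ 2))),
    lintegral_exp_neg_mul_sq_norm hB, ← ENNReal.ofReal_mul (by positivity)]
  congr 1
  rw [Real.div_rpow Real.pi_pos.le hB.le, Real.div_rpow zero_le_one hB.le, Real.one_rpow]
  field_simp

instance isProbabilityMeasure_gaussianMeasure : IsProbabilityMeasure (gaussianMeasure d) := by
  constructor
  have := lintegral_gaussianMeasure_exp (d := d) one_pos 0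
  simpa using this

/-- The Mehler kernel: the density of the Ornstein-Uhlenbeck semigroup with respect to the
Gaussian measure. -/
noncomputable def mehlerKernel (t : ℝ) (x y : EuclideanSpace ℝ (Fin d)) : ℝ :=
  1 / (1 - Real.exp (-2 * t)) ^ ((d : ℝ) / 2) *
    Real.exp (-((Real.exp (-2 * t) * (‖x‖ ^ 2 + ‖y‖ ^ 2)
        - 2 * Real.exp (-t) * inner ℝ x y) / (1 - Real.exp (-2 * t))))

lemma ouSemigroup_eq_integral_mehlerKernel (t : ℝ) (f : EuclideanSpace ℝ (Fin d) → ℝ)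
    (x : EuclideanSpace ℝ (Fin d)) :
    ouSemigroup t f x = ∫ y, mehlerKernel t x y * f y ∂(gaussianMeasure d) := by
  simp_rw [ouSemigroup, mehlerKernel, mul_assoc, integral_const_mul]

lemma one_sub_exp_pos {t : ℝ} (ht : 0 < t) : 0 < 1 - Real.exp (-2 * t) := by
  have : Real.exp (-2 * t) < 1 := by rw [Real.exp_lt_one_iff]; linarith
  linarith

lemma mehlerKernel_pos {t : ℝ} (ht : 0 < t) (x y : EuclideanSpace ℝ (Fin d)) :
    0 < mehlerKernel t x y := by
  have := one_sub_exp_pos ht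
  unfold mehlerKernel
  positivity

lemma mehlerKernel_comm (t : ℝ) (x y : EuclideanSpace ℝ (Fin d)) :
    mehlerKernel t x y = mehlerKernel t y x := by
  rw [mehlerKernel, mehlerKernel, real_inner_comm, add_comm]

lemma measurable_mehlerKernel :
    Measurable fun z : ℝ × EuclideanSpace ℝ (Fin d) × EuclideanSpace ℝ (Fin d) =>
      mehlerKernel z.1 z.2.1 z.2.2 := by
  unfold mehlerKernel
  fun_prop

lemma exp_neg_two_mul (t : ℝ) : Real.exp (-2 * t) = Real.exp (-t) ^ 2 := by
  rw [← Real.exp_nat_mul]; congr 1; push_cast; ring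

/-- The kernel with the square completed around `e^{-t} y`. -/
lemma mehlerKernel_eq {t : ℝ} (ht : 0 < t) (x y : EuclideanSpace ℝ (Fin d)) :
    mehlerKernel t x y = 1 / (1 - Real.exp (-2 * t)) ^ ((d : ℝ) / 2) *
      Real.exp (‖x‖ ^ 2 - ‖x - Real.exp (-t) • y‖ ^ 2 / (1 - Real.exp (-2 * t))) := by
  have := one_sub_exp_pos ht
  rw [mehlerKernel]
  congr 2
  rw [norm_sub_sq_real, inner_smul_right, norm_smul, Real.norm_eq_abs, mul_pow, sq_abs]
  rw [exp_neg_two_mul] at *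
  generalize Real.exp (-t) = r at *
  field_simp
  ring

/-- Chapman-Kolmogorov for the Mehler kernels. -/
lemma lintegral_mehlerKernel_mul_mehlerKernel {a b : ℝ} (ha : 0 < a) (hb : 0 < b)
    (x y : EuclideanSpace ℝ (Fin d)) :
    ∫⁻ z, ENNReal.ofReal (mehlerKernel b x z) * ENNReal.ofReal (mehlerKernel a z y)
      ∂(gaussianMeasure d) = ENNReal.ofReal (mehlerKernel (a + b) x y) := by
  have hA := one_sub_exp_pos ha
  have hB := one_sub_exp_pos hb
  have hC := one_sub_exp_pos (add_pos ha hb)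
  have e1 : Real.exp (-2 * (a + b)) = Real.exp (-a) ^ 2 * Real.exp (-b) ^ 2 := by
    rw [← exp_neg_two_mul, ← exp_neg_two_mul, ← Real.exp_add]; congr 1; ring
  have e2 : Real.exp (-(a + b)) = Real.exp (-a) * Real.exp (-b) := by
    rw [← Real.exp_add]; congr 1; ring
  unfold mehlerKernel
  rw [e1] at hC
  rw [exp_neg_two_mul] at hA hB
  simp only [e1, e2, exp_neg_two_mul a, exp_neg_two_mul b]
  clear e1 e2
  generalize Real.exp (-a) = ρ at *
  generalize Real.exp (-b) = r at *
  set B : ℝ := (1 - ρ ^ 2 * r ^ 2) / ((1 - r ^ 2) * (1 - ρ ^ 2)) with hBdef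
  have hBpos : 0 < B := by positivity
  set w : EuclideanSpace ℝ (Fin d) := (2 * r / (1 - r ^ 2)) • x + (2 * ρ / (1 - ρ ^ 2)) • y with hw
  have key : ∀ z : EuclideanSpace ℝ (Fin d), ENNReal.ofReal (1 / (1 - r ^ 2) ^ ((d : ℝ) / 2) *
      Real.exp (-((r ^ 2 * (‖x‖ ^ 2 + ‖z‖ ^ 2) - 2 * r * inner ℝ x z) / (1 - r ^ 2)))) *
      ENNReal.ofReal (1 / (1 - ρ ^ 2) ^ ((d : ℝ) / 2) *
      Real.exp (-((ρ ^ 2 * (‖z‖ ^ 2 + ‖y‖ ^ 2) - 2 * ρ * inner ℝ z y) / (1 - ρ ^ 2)))) =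
      ENNReal.ofReal (1 / (1 - r ^ 2) ^ ((d : ℝ) / 2) * (1 / (1 - ρ ^ 2) ^ ((d : ℝ) / 2)) *
        Real.exp (-(r ^ 2 / (1 - r ^ 2) * ‖x‖ ^ 2 + ρ ^ 2 / (1 - ρ ^ 2) * ‖y‖ ^ 2))) *
      ENNReal.ofReal (Real.exp (-(B - 1) * ‖z‖ ^ 2 + inner ℝ w z)) := by
    intro z
    rw [← ENNReal.ofReal_mul (by positivity), ← ENNReal.ofReal_mul (by positivity)]
    congr 1
    rw [mul_mul_mul_comm, ← Real.exp_add, mul_assoc _ (Real.exp _) (Real.exp _), ← Real.exp_add]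
    congr 2
    rw [hw, inner_add_left, inner_smul_left, inner_smul_left, real_inner_comm y z, hBdef]
    simp only [conj_trivial]
    field_simp
    ring
  simp_rw [key]
  rw [lintegral_const_mul' _ _ ENNReal.ofReal_ne_top, lintegral_gaussianMeasure_exp hBpos,
    ← ENNReal.ofReal_mul (by positivity)]
  congr 1
  rw [mul_mul_mul_comm, ← Real.exp_add]
  congr 1
  · rw [hBdef, one_div_div, Real.div_rpow (by positivity) hC.le,
      Real.mul_rpow hB.le hA.le]
    have := Real.rpow_pos_of_pos hA ((d : ℝ) / 2)
    have := Real.rpow_pos_of_pos hB ((d : ℝ) / 2)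
    field_simp
  · congr 1
    rw [hw, norm_add_sq_real, inner_smul_left, inner_smul_right, norm_smul, norm_smul,
      Real.norm_eq_abs, Real.norm_eq_abs, mul_pow, mul_pow, sq_abs, sq_abs, hBdef]
    simp only [conj_trivial]
    have hC' : 1 - r ^ 2 * ρ ^ 2 ≠ 0 := by rw [mul_comm]; exact hC.ne'
    field_simp
    ring

lemma lintegral_mehlerKernel {t : ℝ} (ht : 0 < t) (x : EuclideanSpace ℝ (Fin d)) :
    ∫⁻ y, ENNReal.ofReal (mehlerKernel t x y) ∂(gaussianMeasure d) = 1 := by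
  have hA := one_sub_exp_pos ht
  unfold mehlerKernel
  rw [exp_neg_two_mul] at *
  generalize Real.exp (-t) = r at *
  have key : ∀ y : EuclideanSpace ℝ (Fin d), ENNReal.ofReal (1 / (1 - r ^ 2) ^ ((d : ℝ) / 2) *
      Real.exp (-((r ^ 2 * (‖x‖ ^ 2 + ‖y‖ ^ 2) - 2 * r * inner ℝ x y) / (1 - r ^ 2)))) =
      ENNReal.ofReal (1 / (1 - r ^ 2) ^ ((d : ℝ) / 2) *
        Real.exp (-(r ^ 2 / (1 - r ^ 2) * ‖x‖ ^ 2))) *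
      ENNReal.ofReal (Real.exp (-(1 / (1 - r ^ 2) - 1) * ‖y‖ ^ 2 +
        inner ℝ ((2 * r / (1 - r ^ 2)) • x) y)) := by
    intro y
    rw [← ENNReal.ofReal_mul (by positivity),
      mul_assoc _ (Real.exp _) (Real.exp _), ← Real.exp_add]
    congr 3
    rw [inner_smul_left]
    simp only [conj_trivial]
    field_simp
    ring
  simp_rw [key]
  rw [lintegral_const_mul' _ _ ENNReal.ofReal_ne_top,
    lintegral_gaussianMeasure_exp (one_div_pos.2 hA), ← ENNReal.ofReal_mul (by positivity),
    mul_mul_mul_comm, ← Real.exp_add, ← ENNReal.ofReal_one]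
  congr 1
  rw [one_div_one_div, one_div_mul_cancel (by positivity), one_mul, Real.exp_eq_one_iff,
    norm_smul, Real.norm_eq_abs, mul_pow, sq_abs]
  field_simp
  ring

lemma mehlerKernel_le {t : ℝ} (ht : 0 < t) (x y : EuclideanSpace ℝ (Fin d)) :
    mehlerKernel t x y ≤ 1 / (1 - Real.exp (-2 * t)) ^ ((d : ℝ) / 2) * Real.exp (‖x‖ ^ 2) := by
  have := one_sub_exp_pos ht
  rw [mehlerKernel_eq ht]
  gcongr
  have : 0 ≤ ‖x - Real.exp (-t) • y‖ ^ 2 / (1 - Real.exp (-2 * t)) := by positivity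
  linarith

end Mehler

/-! ### Comparison of the kernel with the oscillation of the exponent -/

section Dichotomy

variable {d : ℕ} {p : EuclideanSpace ℝ (Fin d) → ℝ}

lemma LogHolderLocal.exists_le (hp0 : LogHolderLocal p) : ∃ P : ℝ, 1 ≤ P ∧ ∀ x, p x ≤ P := by
  obtain ⟨C, hC, h⟩ := hp0
  refine ⟨max 1 (p 0 + C), le_max_left _ _, fun x => le_trans ?_ (le_max_right _ _)⟩
  have h1 := h x 0
  have h2 : (1 : ℝ) ≤ Real.log (Real.exp 1 + 1 / ‖x - 0‖) := by
    rw [Real.le_log_iff_exp_le (by positivity)]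
    have : 0 ≤ 1 / ‖x - 0‖ := by positivity
    linarith
  have h3 : C / Real.log (Real.exp 1 + 1 / ‖x - 0‖) ≤ C := div_le_self hC.le h2
  linarith [le_abs_self (p x - p 0)]

lemma GaussianExponent.exists_sub_le (hp : GaussianExponent p) :
    ∃ D : ℝ, 0 < D ∧ ∀ x y, x ≠ 0 → y ≠ 0 → p x - p y ≤ D / ‖x‖ ^ 2 + D / ‖y‖ ^ 2 := by
  obtain ⟨C, q, hC, _, h⟩ := hp.decay
  refine ⟨C, hC, fun x y hx hy => ?_⟩
  linarith [le_abs_self (p x - q), neg_abs_le (p y - q), h x hx, h y hy]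

lemma exists_mul_log_le (n : ℕ) {δ : ℝ} (hδ : 0 < δ) :
    ∃ C : ℝ, 0 ≤ C ∧ ∀ u : ℝ, 0 < u → n * Real.log u ≤ C + δ * u := by
  refine ⟨|n * Real.log (δ / (n + 1)) + n|, abs_nonneg _, fun u hu => ?_⟩
  have h := Real.log_le_sub_one_of_pos (show 0 < δ / (n + 1) * u by positivity)
  rw [Real.log_mul (by positivity) hu.ne'] at h
  have h2 : (n : ℝ) * (δ / (n + 1) * u) ≤ δ * u := by
    have : (n : ℝ) * (δ / (n + 1) * u) = (n / (n + 1)) * (δ * u) := by ring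
    rw [this]
    exact mul_le_of_le_one_left (by positivity) ((div_le_one (by positivity)).2 (by linarith))
  have h3 := mul_le_mul_of_nonneg_left h (Nat.cast_nonneg (α := ℝ) n)
  have h4 := neg_abs_le (n * Real.log (δ / (n + 1)) + n)
  nlinarith

/-- The part of the dichotomy in which the logarithm `k` of the kernel is controlled by `‖y‖²`:
either `ℓ > P ‖y‖²`, and then `k` is at most `ℓ / P` up to a constant, or the decay of the exponent
at infinity absorbs `ℓ`. -/
lemma dichotomy_of_le_sq {P D C₀ M : ℝ} (hP : 1 ≤ P) (hD : 0 < D) (hC₀ : 0 ≤ C₀) (hM : 0 ≤ M)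
    (hp1 : ∀ x, 1 ≤ p x) (hpP : ∀ x, p x ≤ P)
    (hpD : ∀ x y, x ≠ 0 → y ≠ 0 → p x - p y ≤ D / ‖x‖ ^ 2 + D / ‖y‖ ^ 2)
    {x y : EuclideanSpace ℝ (Fin d)} {k ℓ : ℝ} (hℓ : 0 ≤ ℓ) (hk : k ≤ C₀ + ‖y‖ ^ 2)
    (hℓx : ℓ ≤ P * ‖y‖ ^ 2 → ℓ ≤ C₀ + M * ‖x‖ ^ 2) :
    (p x - p y) * ℓ ≤ (P + D) * (C₀ + M) + D * P + C₀ ∨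
      k ≤ (P + D) * (C₀ + M) + D * P + C₀ + ℓ / P := by
  have hP0 : 0 < P := by linarith
  have hpos : 0 ≤ (P + D) * (C₀ + M) := by positivity
  have hDP : 0 ≤ D * P := by positivity
  rcases lt_or_ge (P * ‖y‖ ^ 2) ℓ with h | h
  · right
    have : ‖y‖ ^ 2 ≤ ℓ / P := by rw [le_div_iff₀ hP0]; linarith
    linarith
  left
  have h1 := hℓx h
  have hΔ : p x - p y ≤ P := by linarith [hpP x, hp1 y]
  rcases lt_or_ge ‖x‖ 1 with hx | hx
  · have hx2 : ‖x‖ ^ 2 ≤ 1 := by nlinarith [norm_nonneg x]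
    have : ℓ ≤ C₀ + M := by nlinarith
    have h3 : (p x - p y) * ℓ ≤ P * (C₀ + M) := by
      calc _ ≤ P * ℓ := by gcongr
        _ ≤ _ := by gcongr
    have : 0 ≤ D * (C₀ + M) := by positivity
    nlinarith
  · have hx0 : x ≠ 0 := by rintro rfl; simp at hx; linarith
    have hx2 : 1 ≤ ‖x‖ ^ 2 := by nlinarith
    by_cases hy0 : y = 0
    · have : ℓ = 0 := by simp [hy0] at h; linarith
      rw [this]; simp; positivity
    have hy2 : 0 < ‖y‖ ^ 2 := by positivity
    have h4 : (p x - p y) * ℓ ≤ D * (ℓ / ‖x‖ ^ 2) + D * (ℓ / ‖y‖ ^ 2) := by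
      calc _ ≤ (D / ‖x‖ ^ 2 + D / ‖y‖ ^ 2) * ℓ := by gcongr; exact hpD x y hx0 hy0
        _ = _ := by ring
    have h5 : ℓ / ‖x‖ ^ 2 ≤ C₀ + M := by
      rw [div_le_iff₀ (by linarith)]; nlinarith
    have h6 : ℓ / ‖y‖ ^ 2 ≤ P := by rw [div_le_iff₀ hy2]; exact h
    have h7 := mul_le_mul_of_nonneg_left h5 hD.le
    have h8 := mul_le_mul_of_nonneg_left h6 hD.le
    have : 0 ≤ P * (C₀ + M) := by positivity
    nlinarith

/-- Local log-Hölder continuity at the scale `η`. -/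
lemma sub_mul_log_le {H η : ℝ} (hH : 0 < H) (hη : 0 < η) (hη1 : η < 1)
    {x y : EuclideanSpace ℝ (Fin d)}
    (h : |p x - p y| ≤ H / Real.log (Real.exp 1 + 1 / ‖x - y‖)) (hxy : ‖x - y‖ ≤ η) :
    (p x - p y) * Real.log (1 / η) ≤ H := by
  have hlog : 0 < Real.log (1 / η) := Real.log_pos (by rw [lt_div_iff₀ hη]; linarith)
  by_cases hx : x = y
  · simp [hx]; exact hH.le
  have hn : 0 < ‖x - y‖ := norm_pos_iff.2 (sub_ne_zero.2 hx)
  have h2 : Real.log (1 / η) ≤ Real.log (Real.exp 1 + 1 / ‖x - y‖) := by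
    apply Real.log_le_log (by positivity)
    have : 1 / η ≤ 1 / ‖x - y‖ := one_div_le_one_div_of_le hn hxy
    linarith [Real.exp_pos 1]
  calc (p x - p y) * Real.log (1 / η) ≤ |p x - p y| * Real.log (1 / η) := by
        gcongr; exact le_abs_self _
    _ ≤ H / Real.log (Real.exp 1 + 1 / ‖x - y‖) * Real.log (1 / η) := by gcongr
    _ ≤ H / Real.log (1 / η) * Real.log (1 / η) := by gcongr
    _ = H := by field_simp

lemma sub_mul_norm_sq_le {D : ℝ} (hD : 0 < D)
    (hpD : ∀ x y, x ≠ 0 → y ≠ 0 → p x - p y ≤ D / ‖x‖ ^ 2 + D / ‖y‖ ^ 2) {b : ℝ}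
    {x y : EuclideanSpace ℝ (Fin d)} (hx0 : x ≠ 0) (hxy : ‖x‖ ≤ b * ‖y‖) :
    (p x - p y) * ‖x‖ ^ 2 ≤ (1 + b ^ 2) * D := by
  have hx : 0 < ‖x‖ := norm_pos_iff.2 hx0
  have hy0 : y ≠ 0 := by rintro rfl; rw [norm_zero, mul_zero] at hxy; linarith
  have hy : 0 < ‖y‖ := norm_pos_iff.2 hy0
  have h1 := hpD x y hx0 hy0
  have h2 : ‖x‖ ^ 2 / ‖y‖ ^ 2 ≤ b ^ 2 := by
    rw [div_le_iff₀ (by positivity), ← mul_pow]; gcongr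
  calc (p x - p y) * ‖x‖ ^ 2 ≤ (D / ‖x‖ ^ 2 + D / ‖y‖ ^ 2) * ‖x‖ ^ 2 := by gcongr
    _ = D + D * (‖x‖ ^ 2 / ‖y‖ ^ 2) := by field_simp
    _ ≤ D + D * b ^ 2 := by gcongr
    _ = _ := by ring

lemma norm_sub_smul_ge {r : ℝ} (hr1 : r < 1) (x y : EuclideanSpace ℝ (Fin d)) :
    ‖x - y‖ - (1 - r) * ‖x‖ ≤ ‖y - r • x‖ := by
  have e : x - y = (1 - r) • x - (y - r • x) := by rw [sub_smul, one_smul]; abel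
  have := norm_sub_le ((1 - r) • x) (y - r • x)
  rw [← e, norm_smul, Real.norm_eq_abs, abs_of_pos (by linarith)] at this
  linarith

lemma norm_sub_smul_ge_of_not_comparable {r : ℝ} (hr : 1 / 2 ≤ r) (hr1 : r < 1)
    {x y : EuclideanSpace ℝ (Fin d)} (h : ‖y‖ ≤ ‖x‖ / 4 ∨ 4 * ‖x‖ ≤ ‖y‖) :
    ‖x - y‖ / 5 ≤ ‖y - r • x‖ ∧ 3 / 4 * ‖y‖ ≤ ‖y - r • x‖ := by
  have hr0 : 0 < r := by linarith
  have hn1 : r * ‖x‖ - ‖y‖ ≤ ‖y - r • x‖ := by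
    have := norm_sub_norm_le (r • x) y
    rwa [norm_smul, Real.norm_eq_abs, abs_of_pos hr0, norm_sub_rev] at this
  have hn2 : ‖y‖ - r * ‖x‖ ≤ ‖y - r • x‖ := by
    have := norm_sub_norm_le y (r • x)
    rwa [norm_smul, Real.norm_eq_abs, abs_of_pos hr0] at this
  have hxy : ‖x - y‖ ≤ ‖x‖ + ‖y‖ := norm_sub_le x y
  have h1 : 1 / 2 * ‖x‖ ≤ r * ‖x‖ := by gcongr
  have h2 : r * ‖x‖ ≤ 1 * ‖x‖ := by gcongr
  have hx := norm_nonneg x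
  have hy := norm_nonneg y
  rcases h with h | h <;> constructor <;> linarith

/-- The dichotomy for times bounded below, where the factor `ε^{-d/2}` of the kernel is bounded. -/
lemma exponent_kernel_dichotomy_of_le (hp : GaussianExponent p)
    {P : ℝ} (hP : 1 ≤ P) (hpP : ∀ x, p x ≤ P) {ε₀ : ℝ} (hε₀ : 0 < ε₀) (hε₀1 : ε₀ ≤ 1) :
    ∃ C : ℝ, 0 ≤ C ∧ ∀ ε v : ℝ, ε₀ ≤ ε → 0 ≤ v →
      ∀ (x y : EuclideanSpace ℝ (Fin d)) (ℓ : ℝ), 0 ≤ ℓ →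
      ℓ ≤ Real.log 2 + d / 2 * Real.log (1 / ε) + ‖x‖ ^ 2 →
      (p x - p y) * ℓ ≤ C ∨ d / 2 * Real.log (1 / ε) + ‖y‖ ^ 2 - v / ε ≤ C + ℓ / P := by
  obtain ⟨D, hD, hpD⟩ := hp.exists_sub_le
  have hl2 : 0 < Real.log 2 := Real.log_pos (by norm_num)
  have hlε₀ : 0 ≤ Real.log (1 / ε₀) := Real.log_nonneg (by rw [le_div_iff₀ hε₀]; linarith)
  have hC₀ : 0 ≤ Real.log 2 + d / 2 * Real.log (1 / ε₀) := by positivity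
  have hP0 : 0 < P := by linarith
  obtain ⟨C₀, hC₀eq⟩ : ∃ C₀ : ℝ, C₀ = Real.log 2 + d / 2 * Real.log (1 / ε₀) := ⟨_, rfl⟩
  rw [← hC₀eq] at hC₀
  refine ⟨(P + D) * (C₀ + 1) + D * P + C₀, by positivity, fun ε v hε hv x y ℓ hℓ hℓle => ?_⟩
  have hε0 : 0 < ε := by linarith
  have hc : (d : ℝ) / 2 * Real.log (1 / ε) ≤ d / 2 * Real.log (1 / ε₀) := by gcongr
  have hv : 0 ≤ v / ε := by positivity
  exact dichotomy_of_le_sq hP hD hC₀ zero_le_one hp.one_le hpP hpD hℓ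
    (by linarith) (fun _ => by linarith)

/-- The dichotomy for small times, at space scale `η = ε^{1/4}`. -/
lemma exponent_kernel_dichotomy_of_lt (hp : GaussianExponent p) (hp0 : LogHolderLocal p)
    {P : ℝ} (hP : 1 ≤ P) (hpP : ∀ x, p x ≤ P) :
    ∃ C : ℝ, 0 ≤ C ∧ ∀ r η : ℝ, 0 < η → 0 < r → 1 - r ^ 2 = η ^ 4 → 4 * (d + 1) * η ^ 4 < 1 →
      ∀ (x y : EuclideanSpace ℝ (Fin d)) (ℓ : ℝ), 0 ≤ ℓ →
      ℓ ≤ Real.log 2 + d * Real.log (1 / η ^ 2) + ‖x‖ ^ 2 →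
      (p x - p y) * ℓ ≤ C ∨
      d * Real.log (1 / η ^ 2) + ‖y‖ ^ 2 - ‖y - r • x‖ ^ 2 / η ^ 4 ≤ C + ℓ / P := by
  obtain ⟨D, hD, hpD⟩ := hp.exists_sub_le
  obtain ⟨H, hH, hpH⟩ := hp0
  obtain ⟨C₁, hC₁, hC₁u⟩ := exists_mul_log_le d (δ := 1 / 50) (by norm_num)
  have hp1 := hp.one_le
  have hl2 : 0 < Real.log 2 := Real.log_pos (by norm_num)
  have hP0 : 0 < P := by linarith
  obtain ⟨C, hC0, hCA, hCB, hCC⟩ : ∃ C : ℝ, 0 ≤ C ∧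
      (P + D) * (C₁ + 16 * P) + D * P + C₁ ≤ C ∧ C₁ ≤ C ∧
      P * Real.log 2 + 2 * d * H + 4 * P + 34 * D ≤ C := by
    have h1 : 0 ≤ (P + D) * (C₁ + 16 * P) + D * P + C₁ := by positivity
    have h2 : 0 ≤ P * Real.log 2 + 2 * d * H + 4 * P + 34 * D := by positivity
    exact ⟨((P + D) * (C₁ + 16 * P) + D * P + C₁) + C₁ +
      (P * Real.log 2 + 2 * d * H + 4 * P + 34 * D), by positivity, by linarith, by linarith,
      by linarith⟩
  refine ⟨C, hC0, fun r η hη hr hrη hηd x y ℓ hℓ hℓle => ?_⟩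
  have hη4 : 0 < η ^ 4 := by positivity
  have hη14 : η ^ 4 < 1 / 4 := by
    have : 0 ≤ (d : ℝ) * η ^ 4 := by positivity
    linarith
  have hr1 : r < 1 := lt_of_pow_lt_pow_left₀ 2 zero_le_one (by linarith)
  have hr2 : 1 / 2 ≤ r := (lt_of_pow_lt_pow_left₀ 2 hr.le (by linarith)).le
  have hη1 : η < 1 := by
    by_contra hc
    have : (1 : ℝ) ≤ η ^ 4 := one_le_pow₀ (not_lt.1 hc)
    linarith
  have hΔP : p x - p y ≤ P := by linarith [hpP x, hp1 y]
  have hlogη : 0 < Real.log (1 / η) := Real.log_pos (by rw [lt_div_iff₀ hη]; linarith)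
  obtain ⟨c, hc⟩ : ∃ c : ℝ, d * Real.log (1 / η ^ 2) = c := ⟨_, rfl⟩
  have hc1 : c = 2 * d * Real.log (1 / η) := by
    rw [← hc, one_div, one_div, ← inv_pow, Real.log_pow]; push_cast; ring
  have hc0 : 0 ≤ c := by rw [hc1]; positivity
  have hc2 : c ≤ d * (1 / η ^ 2) := by
    rw [← hc]
    have := Real.log_le_sub_one_of_pos (show 0 < 1 / η ^ 2 by positivity)
    gcongr
    linarith
  -- at distance at least of order `η` from `r x`, the Gaussian factor beats `ε^{-d/2}`;
  -- the constant is `1 / 50 = (1 / 5)² / 2`, for half of the exponent at distance `η / 5`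
  have hfar : ∀ v : ℝ, η ^ 2 / 50 ≤ v → c ≤ C₁ + v / η ^ 4 := by
    intro v hv
    have h1 := hC₁u (1 / η ^ 2) (by positivity)
    rw [hc] at h1
    have h2 : 1 / 50 * (1 / η ^ 2) ≤ v / η ^ 4 := by
      rw [le_div_iff₀ hη4]
      calc 1 / 50 * (1 / η ^ 2) * η ^ 4 = η ^ 2 / 50 := by field_simp
        _ ≤ v := hv
    linarith
  rw [hc] at hℓle ⊢
  clear hc hC₁u
  by_cases hΔ : p x - p y ≤ 0
  · left
    exact (mul_nonpos_of_nonpos_of_nonneg hΔ hℓ).trans hC0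
  rw [not_le] at hΔ
  have hΔℓ : (p x - p y) * ℓ ≤ P * Real.log 2 + (p x - p y) * c + (p x - p y) * ‖x‖ ^ 2 := by
    calc (p x - p y) * ℓ ≤ (p x - p y) * (Real.log 2 + c + ‖x‖ ^ 2) := by gcongr
      _ = (p x - p y) * Real.log 2 + (p x - p y) * c + (p x - p y) * ‖x‖ ^ 2 := by ring
      _ ≤ _ := by gcongr
  have hdH : 0 ≤ 2 * d * H := by positivity
  have hx := norm_nonneg x
  have hy := norm_nonneg y
  rcases le_or_gt ‖x - y‖ η with hnear | hdist
  · -- the log-Hölder condition absorbs `c`, and `x`, `y` have comparable size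
    left
    have h1 := sub_mul_log_le hH hη hη1 (hpH x y) hnear
    have h2 : (p x - p y) * c ≤ 2 * d * H := by
      rw [hc1]
      calc _ = 2 * d * ((p x - p y) * Real.log (1 / η)) := by ring
        _ ≤ _ := by gcongr
    have h3 : (p x - p y) * ‖x‖ ^ 2 ≤ 4 * P + 5 * D := by
      rcases le_or_gt ‖x‖ 2 with hx2 | hx2
      · calc _ ≤ P * 2 ^ 2 := by gcongr
          _ ≤ _ := by linarith
      · have hx0 : x ≠ 0 := by rintro rfl; rw [norm_zero] at hx2; linarith
        have : ‖x‖ ≤ 2 * ‖y‖ := by linarith [norm_sub_norm_le x y]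
        have := sub_mul_norm_sq_le hD hpD hx0 this
        linarith
    linarith
  by_cases hcomp : ‖y‖ ≤ ‖x‖ / 4 ∨ 4 * ‖x‖ ≤ ‖y‖
  · -- sizes not comparable: the kernel is bounded
    right
    obtain ⟨h1, h2⟩ := norm_sub_smul_ge_of_not_comparable hr2 hr1 hcomp
    obtain ⟨v, hv⟩ : ∃ v : ℝ, v = ‖y - r • x‖ := ⟨_, rfl⟩
    rw [← hv] at h1 h2 ⊢
    have h3 : (3 / 4 * ‖y‖) ^ 2 ≤ v ^ 2 := by gcongr
    have h7 : (η / 5) ^ 2 ≤ v ^ 2 := by gcongr; linarith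
    have h4 : 2 * v ^ 2 ≤ v ^ 2 / η ^ 4 / 2 := by
      rw [div_div, le_div_iff₀ (by positivity)]
      nlinarith [sq_nonneg v]
    have h5 := hfar (v ^ 2 / 2) (by linarith)
    have h6 : v ^ 2 / 2 / η ^ 4 = v ^ 2 / η ^ 4 / 2 := by ring
    have : 0 ≤ ℓ / P := by positivity
    linarith [sq_nonneg v]
  rw [not_or, not_le, not_le] at hcomp
  obtain ⟨hcx, hcy⟩ := hcomp
  have hx0 : x ≠ 0 := by rintro rfl; rw [norm_zero] at hcx hcy; linarith
  have hd17 := sub_mul_norm_sq_le hD hpD (y := y) hx0 (b := 4) (by linarith)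
  rcases le_or_gt c (‖x‖ ^ 2) with hcx2 | hcx2
  · left
    have : (p x - p y) * c ≤ (p x - p y) * ‖x‖ ^ 2 := by gcongr
    linarith
  -- here `‖x‖² < c`, so the drift `(1 - r) x` is small compared with `η`
  have hdrift : (1 - r) * ‖x‖ ≤ η / 2 := by
    have h1 : (1 - r) * ‖x‖ ≤ η ^ 4 * ‖x‖ := by
      gcongr; nlinarith
    have h4 : (η ^ 4 * ‖x‖) ^ 2 ≤ (η / 2) ^ 2 := by
      calc (η ^ 4 * ‖x‖) ^ 2 = (η ^ 4) ^ 2 * ‖x‖ ^ 2 := by ring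
        _ ≤ (η ^ 4) ^ 2 * (d * (1 / η ^ 2)) := by gcongr; linarith
        _ = (d * η ^ 4) * η ^ 2 := by field_simp
        _ ≤ 1 / 4 * η ^ 2 := by gcongr; linarith
        _ = _ := by ring
    have := abs_le_of_sq_le_sq h4 (by positivity)
    linarith [le_abs_self (η ^ 4 * ‖x‖)]
  have h1 : η / 2 ≤ ‖y - r • x‖ := by linarith [norm_sub_smul_ge hr1 x y]
  have h1' : (η / 2) ^ 2 ≤ ‖y - r • x‖ ^ 2 := by gcongr
  have h2 := hfar (‖y - r • x‖ ^ 2) (by linarith [sq_nonneg η])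
  refine (dichotomy_of_le_sq hP hD hC₁ (M := 16 * P) (by positivity) hp1 hpP hpD (x := x) (y := y)
    hℓ (k := c + ‖y‖ ^ 2 - ‖y - r • x‖ ^ 2 / η ^ 4) (by linarith)
    (fun h => ?_)).imp (fun h => h.trans hCA) (fun h => h.trans (by linarith))
  have : ‖y‖ ^ 2 ≤ (4 * ‖x‖) ^ 2 := by gcongr
  calc ℓ ≤ P * ‖y‖ ^ 2 := h
    _ ≤ P * (4 * ‖x‖) ^ 2 := by gcongr
    _ = 16 * P * ‖x‖ ^ 2 := by ring
    _ ≤ _ := by linarith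

/-- The dichotomy behind the uniform boundedness of the Ornstein-Uhlenbeck semigroup on
`L^{p(·)}(γ)`. With `ε = 1 - r²` and `c = (d/2) log (1/ε)`, the logarithm of the Mehler kernel is
`c + ‖y‖² - ‖y - r x‖² / ε`, and `ℓ` stands for the logarithm of an average of `|f|^{p(·)}`, which
is at most `log 2 + c + ‖x‖²`. Either the oscillation of the exponent is negligible against `ℓ`,
or the kernel at `y` is dominated by a power of the average. -/
lemma exponent_kernel_dichotomy (hp : GaussianExponent p) (hp0 : LogHolderLocal p)
    {P : ℝ} (hP : 1 ≤ P) (hpP : ∀ x, p x ≤ P) :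
    ∃ C : ℝ, 0 ≤ C ∧ ∀ r : ℝ, 0 < r → r < 1 → ∀ (x y : EuclideanSpace ℝ (Fin d)) (ℓ : ℝ), 0 ≤ ℓ →
      ℓ ≤ Real.log 2 + d / 2 * Real.log (1 / (1 - r ^ 2)) + ‖x‖ ^ 2 →
      (p x - p y) * ℓ ≤ C ∨
      d / 2 * Real.log (1 / (1 - r ^ 2)) + ‖y‖ ^ 2 - ‖y - r • x‖ ^ 2 / (1 - r ^ 2) ≤ C + ℓ / P := by
  have hε₀ : (0 : ℝ) < 1 / (4 * (d + 1)) := by positivity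
  obtain ⟨C₁, hC₁, h₁⟩ := exponent_kernel_dichotomy_of_lt hp hp0 hP hpP
  obtain ⟨C₂, hC₂, h₂⟩ := exponent_kernel_dichotomy_of_le hp hP hpP hε₀
    (by rw [div_le_one (by positivity)]; linarith [Nat.cast_nonneg (α := ℝ) d])
  refine ⟨C₁ + C₂, by positivity, fun r hr hr1 x y ℓ hℓ hℓle => ?_⟩
  rcases lt_or_ge (1 - r ^ 2) (1 / (4 * ((d : ℝ) + 1))) with hsm | hlg
  · have hε : 0 < 1 - r ^ 2 := by nlinarith
    obtain ⟨η, hη, hη4⟩ : ∃ η : ℝ, 0 < η ∧ 1 - r ^ 2 = η ^ 4 := by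
      refine ⟨√(√(1 - r ^ 2)), by positivity, ?_⟩
      have : (√(√(1 - r ^ 2))) ^ 4 = ((√(√(1 - r ^ 2))) ^ 2) ^ 2 := by ring
      rw [this, Real.sq_sqrt (by positivity), Real.sq_sqrt hε.le]
    have e : (d : ℝ) / 2 * Real.log (1 / (1 - r ^ 2)) = d * Real.log (1 / η ^ 2) := by
      rw [hη4, one_div, one_div, ← inv_pow, ← inv_pow, Real.log_pow, Real.log_pow]
      push_cast; ring
    rw [lt_div_iff₀ (by positivity), hη4] at hsm
    rw [e] at hℓle ⊢
    rw [hη4]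
    exact (h₁ r η hη hr hη4 (by linarith) x y ℓ hℓ hℓle).imp (fun h => by linarith)
      (fun h => by linarith)
  · exact (h₂ (1 - r ^ 2) (‖y - r • x‖ ^ 2) hlg (by positivity) x y ℓ hℓ hℓle).imp
      (fun h => by linarith) (fun h => by linarith)

end Dichotomy

/-! ### Averages of the Ornstein-Uhlenbeck semigroup on the variable Lebesgue space -/

section Average

variable {d : ℕ} {p : EuclideanSpace ℝ (Fin d) → ℝ}

lemma measurable_ofReal_mehlerKernel_mul {F : EuclideanSpace ℝ (Fin d) → ℝ≥0∞}
    (hF : Measurable F) :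
    Measurable fun z : (EuclideanSpace ℝ (Fin d) × ℝ) × EuclideanSpace ℝ (Fin d) =>
      ENNReal.ofReal (mehlerKernel z.1.2 z.1.1 z.2) * F z.2 := by
  have := (measurable_mehlerKernel (d := d)).comp
    (show Measurable fun z : (EuclideanSpace ℝ (Fin d) × ℝ) × EuclideanSpace ℝ (Fin d) =>
      (z.1.2, z.1.1, z.2) by fun_prop)
  exact this.ennreal_ofReal.mul (hF.comp measurable_snd)

lemma measurable_lintegral_mehlerKernel_mul {F : EuclideanSpace ℝ (Fin d) → ℝ≥0∞}
    (hF : Measurable F) :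
    Measurable fun z : EuclideanSpace ℝ (Fin d) × ℝ =>
      ∫⁻ y, ENNReal.ofReal (mehlerKernel z.2 z.1 y) * F y ∂(gaussianMeasure d) :=
  (measurable_ofReal_mehlerKernel_mul hF).lintegral_prod_right'

/-- Truncation of `a` at the level `L`. -/
lemma le_add_rpow_mul_rpow {a L : ℝ≥0∞} (hL : L ≠ 0) (hLt : L ≠ ∞) {q : ℝ} (hq : 1 ≤ q) :
    a ≤ L + a ^ q * L ^ (1 - q) := by
  rcases le_or_gt a L with h | h
  · exact h.trans le_self_add
  refine le_trans ?_ le_add_self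
  have h1 : 1 ≤ a / L := by
    rw [ENNReal.le_div_iff_mul_le (Or.inl hL) (Or.inl hLt), one_mul]; exact h.le
  calc a = L * (a / L) := (ENNReal.mul_div_cancel hL hLt).symm
    _ ≤ L * (a / L) ^ q := by
      gcongr
      calc a / L = (a / L) ^ (1 : ℝ) := by simp
        _ ≤ _ := ENNReal.rpow_le_rpow_of_exponent_le h1 hq
    _ = _ := by
      rw [ENNReal.div_rpow_of_nonneg _ _ (by linarith), sub_eq_add_neg,
        ENNReal.rpow_add _ _ hL hLt, ENNReal.rpow_neg, ENNReal.rpow_one, div_eq_mul_inv]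
      ring

/-- The Mehler kernel in exponential form. -/
lemma mehlerKernel_eq_exp {t : ℝ} (ht : 0 < t) (x y : EuclideanSpace ℝ (Fin d)) :
    mehlerKernel t x y = Real.exp (d / 2 * Real.log (1 / (1 - Real.exp (-t) ^ 2)) + ‖y‖ ^ 2 -
      ‖y - Real.exp (-t) • x‖ ^ 2 / (1 - Real.exp (-t) ^ 2)) := by
  have h := one_sub_exp_pos ht
  rw [mehlerKernel_comm, mehlerKernel_eq ht]
  rw [exp_neg_two_mul] at *
  rw [add_sub_assoc, Real.exp_add]
  congr 1
  rw [mul_comm, Real.exp_mul, Real.exp_log (by positivity), Real.div_rpow zero_le_one h.le,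
    Real.one_rpow]

/-- The kernel estimate extracted from the dichotomy: `exp (ℓ / p x)` is the level at which a
function is truncated. -/
lemma exists_mehlerKernel_mul_exp_le (hp : GaussianExponent p) (hp0 : LogHolderLocal p) :
    ∃ C : ℝ, 0 ≤ C ∧ ∀ t : ℝ, 0 < t → ∀ (x y : EuclideanSpace ℝ (Fin d)) (A : ℝ), 1 ≤ A →
      A ≤ 1 + 1 / (1 - Real.exp (-2 * t)) ^ ((d : ℝ) / 2) * Real.exp (‖x‖ ^ 2) →
      mehlerKernel t x y * Real.exp (Real.log A / p x * (p x - p y)) ≤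
        Real.exp C * (mehlerKernel t x y + A) := by
  obtain ⟨P, hP, hpP⟩ := hp0.exists_le
  obtain ⟨C, hC, h⟩ := exponent_kernel_dichotomy hp hp0 hP hpP
  refine ⟨C, hC, fun t ht x y A hA hAle => ?_⟩
  have hε := one_sub_exp_pos ht
  have hr1 : Real.exp (-t) < 1 := by rw [Real.exp_lt_one_iff]; linarith
  have hpx := hp.one_le x
  have hpx0 : 0 < p x := by linarith
  have hpy := hp.one_le y
  have hP0 : 0 < P := by linarith
  have hA0 : 0 < A := by linarith
  have hℓ : 0 ≤ Real.log A := Real.log_nonneg hA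
  have hK := mehlerKernel_pos ht x y
  have hK' := mehlerKernel_eq_exp ht x y
  rw [exp_neg_two_mul] at hAle hε
  have hℓle : Real.log A ≤ Real.log 2 + d / 2 * Real.log (1 / (1 - Real.exp (-t) ^ 2)) +
      ‖x‖ ^ 2 := by
    rw [Real.log_le_iff_le_exp hA0, Real.exp_add, Real.exp_add, Real.exp_log two_pos,
      mul_comm (_ / _) (Real.log _), Real.exp_mul, Real.exp_log (by positivity),
      Real.div_rpow zero_le_one hε.le, Real.one_rpow]
    have h1 : 1 ≤ 1 / (1 - Real.exp (-t) ^ 2) ^ ((d : ℝ) / 2) := by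
      rw [le_div_iff₀ (by positivity), one_mul]
      exact Real.rpow_le_one hε.le (by linarith [sq_nonneg (Real.exp (-t))]) (by positivity)
    have h2 : 1 ≤ Real.exp (‖x‖ ^ 2) := Real.one_le_exp (by positivity)
    have := one_le_mul_of_one_le_of_one_le h1 h2
    linarith
  rcases h (Real.exp (-t)) (Real.exp_pos _) hr1 x y (Real.log A) hℓ hℓle with h1 | h1
  · have h2 : Real.log A / p x * (p x - p y) ≤ C := by
      rw [div_mul_eq_mul_div, div_le_iff₀ hpx0]
      nlinarith
    calc _ ≤ mehlerKernel t x y * Real.exp C := by gcongr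
      _ = Real.exp C * mehlerKernel t x y := mul_comm _ _
      _ ≤ _ := by gcongr; linarith
  · have h2 : Real.log A / P ≤ Real.log A / p x * p y := by
      calc Real.log A / P ≤ Real.log A / p x := by gcongr; exact hpP x
        _ ≤ Real.log A / p x * p y := le_mul_of_one_le_right (by positivity) hpy
    have h3 : Real.log A / p x * (p x - p y) = Real.log A - Real.log A / p x * p y := by
      field_simp
    calc _ = Real.exp (_ + Real.log A / p x * (p x - p y)) := by rw [hK', ← Real.exp_add]
      _ ≤ Real.exp (C + Real.log A) := by
        apply Real.exp_le_exp.2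
        rw [h3]; linarith
      _ = Real.exp C * A := by rw [Real.exp_add, Real.exp_log hA0]
      _ ≤ _ := by gcongr; linarith

/-- Jensen's inequality for the Mehler kernel and a variable exponent, up to constants. -/
lemma exists_rpow_lintegral_mehlerKernel_le (hp : GaussianExponent p) (hp0 : LogHolderLocal p) :
    ∃ C : ℝ≥0∞, 1 ≤ C ∧ C < ∞ ∧ ∀ t : ℝ, 0 < t → ∀ F : EuclideanSpace ℝ (Fin d) → ℝ≥0∞,
      Measurable F → modular (gaussianMeasure d) p F ≤ 1 → ∀ x,
      (∫⁻ y, ENNReal.ofReal (mehlerKernel t x y) * F y ∂(gaussianMeasure d)) ^ p x ≤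
        C * (1 + ∫⁻ y, ENNReal.ofReal (mehlerKernel t x y) * F y ^ p y ∂(gaussianMeasure d)) := by
  obtain ⟨P, hP, hpP⟩ := hp0.exists_le
  obtain ⟨C, hC, h⟩ := exists_mehlerKernel_mul_exp_le hp hp0
  set B : ℝ≥0∞ := 1 + 2 * ENNReal.ofReal (Real.exp C) with hB
  have hB1 : 1 ≤ B := le_self_add
  have hBt : B < ∞ := by
    rw [hB]; exact ENNReal.add_lt_top.2 ⟨by simp, ENNReal.mul_lt_top (by simp) (by simp)⟩
  refine ⟨B ^ P, ENNReal.one_le_rpow hB1 (by linarith),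
    ENNReal.rpow_lt_top_of_nonneg (by linarith) hBt.ne, fun t ht F hF hmod x => ?_⟩
  have hFp : AEMeasurable (fun y => F y ^ p y) (gaussianMeasure d) :=
    hF.aemeasurable.pow hp.aemeasurable
  have hK : Measurable fun y => ENNReal.ofReal (mehlerKernel t x y) :=
    ((measurable_mehlerKernel (d := d)).comp
      (show Measurable fun y : EuclideanSpace ℝ (Fin d) => (t, x, y) by fun_prop)).ennreal_ofReal
  have hε := one_sub_exp_pos ht
  set I : ℝ≥0∞ := ∫⁻ y, ENNReal.ofReal (mehlerKernel t x y) * F y ^ p y ∂(gaussianMeasure d)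
    with hI
  have hIle : I ≤ ENNReal.ofReal (1 / (1 - Real.exp (-2 * t)) ^ ((d : ℝ) / 2) *
      Real.exp (‖x‖ ^ 2)) := by
    calc I ≤ ∫⁻ y, ENNReal.ofReal (1 / (1 - Real.exp (-2 * t)) ^ ((d : ℝ) / 2) *
          Real.exp (‖x‖ ^ 2)) * F y ^ p y ∂(gaussianMeasure d) := by
          rw [hI]; gcongr with y; exact mehlerKernel_le ht x y
      _ = _ * modular (gaussianMeasure d) p F := lintegral_const_mul' _ _ ENNReal.ofReal_ne_top
      _ ≤ _ * 1 := by gcongr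
      _ = _ := mul_one _
  have hIt : I ≠ ∞ := (hIle.trans_lt ENNReal.ofReal_lt_top).ne
  obtain ⟨A, hA⟩ : ∃ A : ℝ, A = 1 + I.toReal := ⟨_, rfl⟩
  have hA1 : 1 ≤ A := by rw [hA]; linarith [ENNReal.toReal_nonneg (a := I)]
  have hA0 : 0 < A := by linarith
  have hAle : A ≤ 1 + 1 / (1 - Real.exp (-2 * t)) ^ ((d : ℝ) / 2) * Real.exp (‖x‖ ^ 2) := by
    rw [hA]; gcongr
    exact ENNReal.toReal_le_of_le_ofReal (by positivity) hIle
  have hAI : ENNReal.ofReal A = 1 + I := by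
    rw [hA, ENNReal.ofReal_add zero_le_one ENNReal.toReal_nonneg, ENNReal.ofReal_one,
      ENNReal.ofReal_toReal hIt]
  have hpx := hp.one_le x
  -- the truncation level, chosen so that `L ^ p x = A`
  obtain ⟨L, hL⟩ : ∃ L : ℝ≥0∞, L = ENNReal.ofReal (Real.exp (Real.log A / p x)) := ⟨_, rfl⟩
  have hLz : ∀ z : ℝ, L ^ z = ENNReal.ofReal (Real.exp (Real.log A / p x * z)) := by
    intro z
    rw [hL, ENNReal.ofReal_rpow_of_pos (Real.exp_pos _), ← Real.exp_mul]
  have hL0 : L ≠ 0 := by rw [hL]; simp [Real.exp_pos]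
  have hLt : L ≠ ∞ := by rw [hL]; exact ENNReal.ofReal_ne_top
  have hLp : L ^ p x = 1 + I := by
    rw [hLz, div_mul_cancel₀ _ (by linarith), Real.exp_log hA0, hAI]
  have hpt : ∀ y, ENNReal.ofReal (mehlerKernel t x y) * F y ≤
      L * ENNReal.ofReal (mehlerKernel t x y) + L ^ (1 - p x) * ENNReal.ofReal (Real.exp C) *
        (ENNReal.ofReal (mehlerKernel t x y) * F y ^ p y + (1 + I) * F y ^ p y) := by
    intro y
    have h1 := h t ht x y A hA1 hAle
    have hKp := mehlerKernel_pos ht x y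
    have h2 : ENNReal.ofReal (mehlerKernel t x y) * L ^ (p x - p y) ≤
        ENNReal.ofReal (Real.exp C) * (ENNReal.ofReal (mehlerKernel t x y) + (1 + I)) := by
      rw [hLz, ← hAI, ← ENNReal.ofReal_mul hKp.le, ← ENNReal.ofReal_add hKp.le hA0.le,
        ← ENNReal.ofReal_mul (Real.exp_pos _).le]
      exact ENNReal.ofReal_le_ofReal h1
    calc ENNReal.ofReal (mehlerKernel t x y) * F y
        ≤ ENNReal.ofReal (mehlerKernel t x y) * (L + F y ^ p y * L ^ (1 - p y)) := by
          gcongr; exact le_add_rpow_mul_rpow hL0 hLt (hp.one_le y)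
      _ = L * ENNReal.ofReal (mehlerKernel t x y) + L ^ (1 - p x) *
          (ENNReal.ofReal (mehlerKernel t x y) * L ^ (p x - p y)) * F y ^ p y := by
          have : 1 - p y = (1 - p x) + (p x - p y) := by ring
          rw [this, ENNReal.rpow_add _ _ hL0 hLt]; ring
      _ ≤ L * ENNReal.ofReal (mehlerKernel t x y) + L ^ (1 - p x) * (ENNReal.ofReal (Real.exp C) *
          (ENNReal.ofReal (mehlerKernel t x y) + (1 + I))) * F y ^ p y := by gcongr
      _ = _ := by ring
  have hmain : ∫⁻ y, ENNReal.ofReal (mehlerKernel t x y) * F y ∂(gaussianMeasure d) ≤ B * L := by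
    refine (lintegral_mono hpt).trans ?_
    have hKF : AEMeasurable (fun y => ENNReal.ofReal (mehlerKernel t x y) * F y ^ p y)
      (gaussianMeasure d) := hK.aemeasurable.mul hFp
    rw [lintegral_add_left (hK.const_mul _), lintegral_const_mul' _ _ hLt,
      lintegral_mehlerKernel ht, lintegral_const_mul' _ _ (ENNReal.mul_ne_top
        (by rw [hLz]; exact ENNReal.ofReal_ne_top) ENNReal.ofReal_ne_top),
      lintegral_add_left' hKF,
      lintegral_const_mul' _ _ (ENNReal.add_ne_top.2 ⟨ENNReal.one_ne_top, hIt⟩)]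
    calc _ ≤ L * 1 + L ^ (1 - p x) * ENNReal.ofReal (Real.exp C) * ((1 + I) + (1 + I) * 1) := by
          gcongr
          · exact le_add_self
          · exact hmod
      _ = L + L ^ (1 - p x) * L ^ p x * ENNReal.ofReal (Real.exp C) * 2 := by rw [hLp]; ring
      _ = B * L := by
          rw [← ENNReal.rpow_add _ _ hL0 hLt, sub_add_cancel, ENNReal.rpow_one, hB]; ring
  calc _ ≤ (B * L) ^ p x := ENNReal.rpow_le_rpow hmain (by linarith)
    _ = B ^ p x * L ^ p x := ENNReal.mul_rpow_of_nonneg _ _ (by linarith)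
    _ ≤ B ^ P * (1 + I) := by
      rw [hLp]; gcongr
      exact hpP x

/-- The average `∫ T_s F m(ds)` of the Ornstein-Uhlenbeck semigroup applied to a nonnegative
function. -/
noncomputable def ouAverage (m : Measure ℝ) (F : EuclideanSpace ℝ (Fin d) → ℝ≥0∞)
    (x : EuclideanSpace ℝ (Fin d)) : ℝ≥0∞ :=
  ∫⁻ s, ∫⁻ y, ENNReal.ofReal (mehlerKernel s x y) * F y ∂(gaussianMeasure d) ∂m

/-- The averages of the Ornstein-Uhlenbeck semigroup preserve the Gaussian integral. -/
lemma lintegral_ouAverage {m : Measure ℝ} [IsProbabilityMeasure m] (hm : ∀ᵐ s ∂m, 0 < s)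
    {G : EuclideanSpace ℝ (Fin d) → ℝ≥0∞} (hG : Measurable G) :
    ∫⁻ x, ouAverage m G x ∂(gaussianMeasure d) = ∫⁻ y, G y ∂(gaussianMeasure d) := by
  have hmeas := measurable_ofReal_mehlerKernel_mul hG
  have hswap := lintegral_lintegral_swap (μ := gaussianMeasure d) (ν := m)
    (f := fun x s => ∫⁻ y, ENNReal.ofReal (mehlerKernel s x y) * G y ∂(gaussianMeasure d))
    (measurable_lintegral_mehlerKernel_mul hG).aemeasurable
  simp only [ouAverage]
  rw [hswap]
  have h1 : ∀ᵐ s ∂m, ∫⁻ x, ∫⁻ y, ENNReal.ofReal (mehlerKernel s x y) * G y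
      ∂(gaussianMeasure d) ∂(gaussianMeasure d) = ∫⁻ y, G y ∂(gaussianMeasure d) := by
    filter_upwards [hm] with s hs
    have hs' : Measurable (Function.uncurry fun x y : EuclideanSpace ℝ (Fin d) =>
        ENNReal.ofReal (mehlerKernel s x y) * G y) := by
      have := hmeas.comp (show Measurable fun z : EuclideanSpace ℝ (Fin d) ×
        EuclideanSpace ℝ (Fin d) => ((z.1, s), z.2) by fun_prop)
      exact this
    rw [lintegral_lintegral_swap hs'.aemeasurable]
    refine lintegral_congr fun y => ?_
    have hK : Measurable fun x => ENNReal.ofReal (mehlerKernel s y x) := by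
      have := (measurable_mehlerKernel (d := d)).comp
        (show Measurable fun x : EuclideanSpace ℝ (Fin d) => (s, y, x) by fun_prop)
      exact this.ennreal_ofReal
    simp_rw [mehlerKernel_comm s _ y]
    rw [lintegral_mul_const _ hK, lintegral_mehlerKernel hs, one_mul]
  rw [lintegral_congr_ae h1]
  simp

/-- Averages of the Ornstein-Uhlenbeck semigroup are bounded on `L^{p(·)}(γ)`, uniformly in the
averaging probability measure. -/
theorem exists_luxNorm_ouAverage_le (hp : GaussianExponent p) (hp0 : LogHolderLocal p) :
    ∃ C : ℝ≥0∞, 1 ≤ C ∧ C < ∞ ∧ ∀ m : Measure ℝ, IsProbabilityMeasure m → (∀ᵐ s ∂m, 0 < s) →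
      ∀ F : EuclideanSpace ℝ (Fin d) → ℝ≥0∞, Measurable F →
      luxNorm (gaussianMeasure d) p (ouAverage m F) ≤ C * luxNorm (gaussianMeasure d) p F := by
  obtain ⟨C, hC1, hCt, h⟩ := exists_rpow_lintegral_mehlerKernel_le hp hp0
  have hC0 : C ≠ 0 := fun h => by simp [h] at hC1
  have h2C : 1 ≤ C * 2 := hC1.trans (le_mul_of_one_le_right' (by norm_num))
  have h2Ct : C * 2 < ∞ := ENNReal.mul_lt_top hCt (by simp)
  have hp1 : ∀ᵐ x ∂(gaussianMeasure d), 1 ≤ p x := ae_of_all _ hp.one_le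
  refine ⟨C * 2, h2C, h2Ct, fun m _ hm F hF => ?_⟩
  have hmod : ∀ F : EuclideanSpace ℝ (Fin d) → ℝ≥0∞, Measurable F →
      modular (gaussianMeasure d) p F ≤ 1 →
      modular (gaussianMeasure d) p (ouAverage m F) ≤ C * 2 := by
    intro F hF hF1
    have hFp : AEMeasurable (fun y => F y ^ p y) (gaussianMeasure d) :=
      hF.aemeasurable.pow hp.aemeasurable
    obtain ⟨G, hG, hFG⟩ : ∃ G : EuclideanSpace ℝ (Fin d) → ℝ≥0∞, Measurable G ∧
        (fun y => F y ^ p y) =ᵐ[gaussianMeasure d] G := ⟨hFp.mk _, hFp.measurable_mk, hFp.ae_eq_mk⟩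
    have hpt : ∀ x, ouAverage m F x ^ p x ≤ C * (1 + ouAverage m G x) := by
      intro x
      have hu : Measurable fun s => ∫⁻ y, ENNReal.ofReal (mehlerKernel s x y) * F y
          ∂(gaussianMeasure d) := by
        have := (measurable_lintegral_mehlerKernel_mul hF).comp
          (show Measurable fun s : ℝ => (x, s) by fun_prop)
        exact this
      have hJ := lintegral_rpow_le_of_isProbabilityMeasure (μ := m) hu.aemeasurable (hp.one_le x)
      calc ouAverage m F x ^ p x ≤ ∫⁻ s, (∫⁻ y, ENNReal.ofReal (mehlerKernel s x y) * F y
              ∂(gaussianMeasure d)) ^ p x ∂m := hJ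
        _ ≤ ∫⁻ s, C * (1 + ∫⁻ y, ENNReal.ofReal (mehlerKernel s x y) * G y
              ∂(gaussianMeasure d)) ∂m := by
            refine lintegral_mono_ae ?_
            filter_upwards [hm] with s hs
            refine (h s hs F hF hF1 x).trans (le_of_eq ?_)
            congr 2
            refine lintegral_congr_ae ?_
            filter_upwards [hFG] with y hy
            rw [hy]
        _ = _ := by
            rw [lintegral_const_mul' _ _ hCt.ne, lintegral_add_left measurable_const]
            simp [ouAverage]
    calc modular (gaussianMeasure d) p (ouAverage m F)
        ≤ ∫⁻ x, C * (1 + ouAverage m G x) ∂(gaussianMeasure d) := lintegral_mono hpt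
      _ = C * (1 + ∫⁻ y, G y ∂(gaussianMeasure d)) := by
          rw [lintegral_const_mul' _ _ hCt.ne, lintegral_add_left measurable_const,
            lintegral_ouAverage hm hG]
          simp
      _ = C * (1 + modular (gaussianMeasure d) p F) := by
          rw [lintegral_congr_ae hFG.symm]; rfl
      _ ≤ C * (1 + 1) := by gcongr
      _ = C * 2 := by norm_num
  have h2C0 : C * 2 ≠ 0 := mul_ne_zero hC0 two_ne_zero
  rw [mul_comm (C * 2), ← ENNReal.div_le_iff_le_mul (Or.inl h2C0) (Or.inl h2Ct.ne)]
  refine le_sInf ?_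
  rintro c ⟨hc0, hct, hc⟩
  rw [ENNReal.div_le_iff_le_mul (Or.inl h2C0) (Or.inl h2Ct.ne)]
  have := luxNorm_le_of_modular_le hp1 hc0 hct h2C h2Ct (g := ouAverage m F) (p := p) (by
    convert! hmod (fun x => F x / c) (hF.div_const c) hc using 2
    funext x
    unfold ouAverage
    simp_rw [div_eq_mul_inv, ← mul_assoc]
    rw [← lintegral_mul_const' _ _ (by simpa using hc0.ne')]
    refine lintegral_congr fun s => ?_
    rw [← lintegral_mul_const' _ _ (by simpa using hc0.ne')])
  rwa [mul_comm c]

end Average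

/-! ### The one-sided stable densities of order one half -/

section Stable

lemma lintegral_exp_neg_mul_sq {κ : ℝ} (hκ : 0 < κ) :
    ∫⁻ u : ℝ, ENNReal.ofReal (Real.exp (-κ * u ^ 2)) = ENNReal.ofReal √(Real.pi / κ) := by
  rw [← integral_gaussian, ofReal_integral_eq_lintegral_ofReal (integrable_exp_neg_mul_sq hκ)
    (ae_of_all _ fun _ => (Real.exp_pos _).le)]

lemma lintegral_Ioi_exp_neg_mul_sq {κ : ℝ} (hκ : 0 < κ) :
    ∫⁻ u in Ioi (0 : ℝ), ENNReal.ofReal (Real.exp (-κ * u ^ 2)) =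
      ENNReal.ofReal (√(Real.pi / κ) / 2) := by
  rw [← integral_gaussian_Ioi, ofReal_integral_eq_lintegral_ofReal
    (integrable_exp_neg_mul_sq hκ).integrableOn (ae_of_all _ fun _ => (Real.exp_pos _).le)]

/-- The substitution `u = t w - s / w`, which maps the half-line onto the line. -/
lemma lintegral_Ioi_comp_mul_sub_div {t s : ℝ} (ht : 0 < t) (hs : 0 < s) (g : ℝ → ℝ≥0∞) :
    ∫⁻ w in Ioi (0 : ℝ), ENNReal.ofReal (t + s / w ^ 2) * g (t * w - s / w) = ∫⁻ u, g u := by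
  have him : (fun w : ℝ => t * w - s / w) '' Ioi 0 = univ := by
    refine eq_univ_of_forall fun u => ?_
    have hsq : u ^ 2 < u ^ 2 + 4 * t * s := by linarith [mul_pos ht hs]
    have hlt : |u| < √(u ^ 2 + 4 * t * s) := by
      rw [← Real.sqrt_sq_eq_abs]; exact Real.sqrt_lt_sqrt (sq_nonneg u) hsq
    have hpos : 0 < u + √(u ^ 2 + 4 * t * s) := by linarith [neg_abs_le u]
    refine ⟨(u + √(u ^ 2 + 4 * t * s)) / (2 * t), div_pos hpos (by positivity), ?_⟩
    have h2 := Real.sq_sqrt (show 0 ≤ u ^ 2 + 4 * t * s by linarith [sq_nonneg u])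
    generalize √(u ^ 2 + 4 * t * s) = v at *
    simp only
    field_simp
    linarith
  have hmono : StrictMonoOn (fun w : ℝ => t * w - s / w) (Ioi 0) := by
    intro a ha b hb hab
    have h1 : t * a < t * b := by gcongr
    have h2 : s / b < s / a := div_lt_div_of_pos_left hs ha hab
    simp only; linarith
  have h := lintegral_image_eq_lintegral_abs_deriv_mul (measurableSet_Ioi (a := (0 : ℝ)))
    (f := fun w => t * w - s / w) (f' := fun w => t + s / w ^ 2) (fun w hw => by
      have hw0 : w ≠ 0 := (mem_Ioi.1 hw).ne'
      have := ((hasDerivAt_id w).const_mul t).sub ((hasDerivAt_inv hw0).const_mul s)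
      refine (this.congr_deriv ?_).hasDerivWithinAt.congr_of_mem (fun z _ => ?_) hw
      · field_simp; ring
      · simp [div_eq_mul_inv]) hmono.injOn g
  rw [him, Measure.restrict_univ] at h
  rw [h]
  refine setLIntegral_congr_fun measurableSet_Ioi fun w hw => ?_
  have hw0 : 0 < w := hw
  rw [abs_of_pos (by positivity)]

/-- The substitution `w ↦ s / (t w)`, which exchanges `t w` and `s / w`. -/
lemma lintegral_Ioi_comp_div {t s : ℝ} (ht : 0 < t) (hs : 0 < s) (g : ℝ → ℝ≥0∞) :
    ∫⁻ w in Ioi (0 : ℝ), ENNReal.ofReal (s / (t * w ^ 2)) * g (s / (t * w)) =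
      ∫⁻ w in Ioi (0 : ℝ), g w := by
  have him : (fun w : ℝ => s / (t * w)) '' Ioi 0 = Ioi 0 := by
    ext u
    constructor
    · rintro ⟨w, hw, rfl⟩
      have : 0 < w := hw
      exact div_pos hs (by positivity)
    · intro hu
      have hu' : 0 < u := hu
      refine ⟨s / (t * u), div_pos hs (by positivity), ?_⟩
      simp only
      field_simp
  have hinj : InjOn (fun w : ℝ => s / (t * w)) (Ioi 0) := by
    intro a ha b hb hab
    have ha' : 0 < a := ha
    have hb' : 0 < b := hb
    simp only at hab
    field_simp at hab
    linarith
  have h := lintegral_image_eq_lintegral_abs_deriv_mul (measurableSet_Ioi (a := (0 : ℝ)))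
    (f := fun w => s / (t * w)) (f' := fun w => -(s / (t * w ^ 2))) (fun w hw => by
      have hw0 : w ≠ 0 := (mem_Ioi.1 hw).ne'
      have := (hasDerivAt_inv hw0).const_mul (s / t)
      refine (this.congr_deriv ?_).hasDerivWithinAt.congr_of_mem (fun z _ => ?_) hw
      · field_simp
      · rw [div_mul_eq_div_div, div_eq_mul_inv (s / t)]) hinj g
  rw [him] at h
  rw [h]
  refine setLIntegral_congr_fun measurableSet_Ioi fun w hw => ?_
  have hw0 : 0 < w := hw
  rw [abs_neg, abs_of_pos (by positivity)]

/-- The integral left over in the convolution of two stable densities. -/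
lemma lintegral_Ioi_one_add_inv_sq_mul_exp {t s κ : ℝ} (ht : 0 < t) (hs : 0 < s) (hκ : 0 < κ) :
    ∫⁻ w in Ioi (0 : ℝ), ENNReal.ofReal
      (t * s * (1 + 1 / w ^ 2) * Real.exp (-κ * (t * w - s / w) ^ 2)) =
      ENNReal.ofReal ((t + s) * (√(Real.pi / κ) / 2)) := by
  set R : ℝ≥0∞ := ENNReal.ofReal √(Real.pi / κ) with hR
  set I₁ : ℝ≥0∞ := ∫⁻ w in Ioi (0 : ℝ), ENNReal.ofReal
    (t * Real.exp (-κ * (t * w - s / w) ^ 2)) with hI₁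
  set I₂ : ℝ≥0∞ := ∫⁻ w in Ioi (0 : ℝ), ENNReal.ofReal
    (s / w ^ 2 * Real.exp (-κ * (t * w - s / w) ^ 2)) with hI₂
  have hsum : I₁ + I₂ = R := by
    rw [hR, ← lintegral_exp_neg_mul_sq hκ, ← lintegral_Ioi_comp_mul_sub_div ht hs, hI₁, hI₂,
      ← lintegral_add_left (by fun_prop)]
    refine setLIntegral_congr_fun measurableSet_Ioi fun w hw => ?_
    have hw0 : 0 < w := hw
    rw [← ENNReal.ofReal_add (by positivity) (by positivity), ← ENNReal.ofReal_mul (by positivity),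
      add_mul]
  have heq : I₁ = I₂ := by
    rw [hI₁, hI₂, ← lintegral_Ioi_comp_div ht hs]
    refine setLIntegral_congr_fun measurableSet_Ioi fun w hw => ?_
    have hw0 : 0 < w := hw
    rw [← ENNReal.ofReal_mul (by positivity)]
    have e : (t * (s / (t * w)) - s / (s / (t * w))) = -(t * w - s / w) := by
      field_simp; ring
    rw [e, neg_sq]
    congr 1
    field_simp
  have h2 : 2 * I₁ = R := by rw [two_mul]; nth_rewrite 2 [heq]; exact hsum
  have h1 : I₁ = ENNReal.ofReal (√(Real.pi / κ) / 2) := by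
    rw [ENNReal.ofReal_div_of_pos two_pos, ← hR, ← h2, mul_comm, ENNReal.ofReal_ofNat,
      ENNReal.mul_div_cancel_right (by simp) (by simp)]
  calc _ = ∫⁻ w in Ioi (0 : ℝ), (ENNReal.ofReal s * ENNReal.ofReal
          (t * Real.exp (-κ * (t * w - s / w) ^ 2)) + ENNReal.ofReal t * ENNReal.ofReal
          (s / w ^ 2 * Real.exp (-κ * (t * w - s / w) ^ 2))) := by
        refine setLIntegral_congr_fun measurableSet_Ioi fun w hw => ?_
        have hw0 : 0 < w := hw
        rw [← ENNReal.ofReal_mul (by positivity), ← ENNReal.ofReal_mul (by positivity),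
          ← ENNReal.ofReal_add (by positivity) (by positivity)]
        congr 1
        ring
    _ = ENNReal.ofReal s * I₁ + ENNReal.ofReal t * I₂ := by
        rw [lintegral_add_left (by fun_prop), lintegral_const_mul' _ _ (by simp),
          lintegral_const_mul' _ _ (by simp)]
    _ = _ := by
        rw [← heq, h1, ← ENNReal.ofReal_mul (by positivity), ← ENNReal.ofReal_mul (by positivity),
          ← ENNReal.ofReal_add (by positivity) (by positivity)]
        congr 1
        ring

lemma rpow_neg_three_halves {a : ℝ} (ha : 0 < a) :
    a ^ (-(3 / 2) : ℝ) = a⁻¹ * (√a)⁻¹ := by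
  rw [show (-(3 / 2) : ℝ) = (-1) + (-(1 / 2)) by norm_num, Real.rpow_add ha, Real.rpow_neg_one,
    Real.rpow_neg ha.le, ← Real.sqrt_eq_rpow]

lemma stableDensity_eq {t a : ℝ} (ha : 0 < a) :
    stableDensity t a = t / (2 * √Real.pi) * Real.exp (-(t ^ 2) / (4 * a)) * (a⁻¹ * (√a)⁻¹) := by
  rw [stableDensity, rpow_neg_three_halves ha]

lemma stableDensity_pos {t a : ℝ} (ht : 0 < t) (ha : 0 < a) : 0 < stableDensity t a := by
  unfold stableDensity
  have := Real.pi_pos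
  positivity

lemma measurable_stableDensity (t : ℝ) : Measurable (stableDensity t) := by
  unfold stableDensity
  fun_prop

/-- The stable densities form a convolution semigroup: with `a = c / (1 + w²)`,
`t² / a + s² / (c - a) = ((t + s)² + (t w - s / w)²) / c`. -/
lemma setLIntegral_stableDensity_mul_stableDensity {t s c : ℝ} (ht : 0 < t) (hs : 0 < s)
    (hc : 0 < c) :
    ∫⁻ a in Ioo 0 c, ENNReal.ofReal (stableDensity t a * stableDensity s (c - a)) =
      ENNReal.ofReal (stableDensity (t + s) c) := by
  have hpi := Real.pi_pos
  have him : (fun w : ℝ => c / (1 + w ^ 2)) '' Ioi 0 = Ioo 0 c := by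
    ext a
    constructor
    · rintro ⟨w, hw, rfl⟩
      have hw' : 0 < w := hw
      refine ⟨by positivity, ?_⟩
      simp only
      exact div_lt_self hc (by have := pow_pos hw' 2; linarith)
    · rintro ⟨ha0, hac⟩
      have h1 : 0 < c / a - 1 := by rw [sub_pos, lt_div_iff₀ ha0]; linarith
      refine ⟨√(c / a - 1), Real.sqrt_pos.2 h1, ?_⟩
      simp only
      rw [Real.sq_sqrt h1.le]
      field_simp
      ring
  have hinj : InjOn (fun w : ℝ => c / (1 + w ^ 2)) (Ioi 0) := by
    intro a ha b hb hab
    have ha' : 0 < a := ha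
    have hb' : 0 < b := hb
    simp only at hab
    rw [div_eq_div_iff (by positivity) (by positivity)] at hab
    have h3 : a ^ 2 = b ^ 2 := by
      have := mul_left_cancel₀ hc.ne' hab
      linarith
    exact (pow_left_inj₀ ha'.le hb'.le two_ne_zero).1 h3
  rw [← him, lintegral_image_eq_lintegral_abs_deriv_mul (measurableSet_Ioi (a := (0 : ℝ)))
    (f := fun w => c / (1 + w ^ 2)) (f' := fun w => -(2 * c * w / (1 + w ^ 2) ^ 2)) (fun w hw => by
      have h1 : 1 + w ^ 2 ≠ 0 := by positivity
      have := (((hasDerivAt_pow 2 w).const_add 1).inv h1).const_mul c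
      refine (this.congr_deriv ?_).hasDerivWithinAt.congr_of_mem (fun z _ => ?_) hw
      · push_cast; ring
      · simp [div_eq_mul_inv]) hinj]
  have key : ∀ w ∈ Ioi (0 : ℝ), ENNReal.ofReal |-(2 * c * w / (1 + w ^ 2) ^ 2)| *
      ENNReal.ofReal (stableDensity t (c / (1 + w ^ 2)) *
        stableDensity s (c - c / (1 + w ^ 2))) =
      ENNReal.ofReal (1 / (2 * Real.pi * c ^ 2) * Real.exp (-((t + s) ^ 2) / (4 * c))) *
      ENNReal.ofReal (t * s * (1 + 1 / w ^ 2) *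
        Real.exp (-(1 / (4 * c)) * (t * w - s / w) ^ 2)) := by
    intro w hw
    have hw0 : 0 < w := hw
    have e1 : c - c / (1 + w ^ 2) = c * w ^ 2 / (1 + w ^ 2) := by field_simp; ring
    rw [← ENNReal.ofReal_mul (abs_nonneg _), ← ENNReal.ofReal_mul (by positivity), abs_neg,
      abs_of_pos (by positivity), e1, stableDensity_eq (by positivity),
      stableDensity_eq (by positivity)]
    congr 1
    have e2 : Real.exp (-(t ^ 2) / (4 * (c / (1 + w ^ 2)))) *
        Real.exp (-(s ^ 2) / (4 * (c * w ^ 2 / (1 + w ^ 2)))) =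
        Real.exp (-((t + s) ^ 2) / (4 * c)) *
          Real.exp (-(1 / (4 * c)) * (t * w - s / w) ^ 2) := by
      rw [← Real.exp_add, ← Real.exp_add]
      congr 1
      field_simp
      ring
    have e3 : √(c / (1 + w ^ 2)) * √(c * w ^ 2 / (1 + w ^ 2)) = c * w / (1 + w ^ 2) := by
      rw [← Real.sqrt_mul (by positivity), Real.sqrt_eq_iff_mul_self_eq (by positivity)
        (by positivity)]
      field_simp
    have e4 : √Real.pi * √Real.pi = Real.pi := Real.mul_self_sqrt hpi.le
    calc _ = 2 * c * w / (1 + w ^ 2) ^ 2 * (t * s / (4 * (√Real.pi * √Real.pi))) *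
          (Real.exp (-(t ^ 2) / (4 * (c / (1 + w ^ 2)))) *
            Real.exp (-(s ^ 2) / (4 * (c * w ^ 2 / (1 + w ^ 2))))) *
          ((c / (1 + w ^ 2))⁻¹ * (c * w ^ 2 / (1 + w ^ 2))⁻¹ *
            (√(c / (1 + w ^ 2)) * √(c * w ^ 2 / (1 + w ^ 2)))⁻¹) := by
          rw [mul_inv (√(c / (1 + w ^ 2)))]
          field_simp
          ring
      _ = _ := by
          rw [e2, e3, e4]
          field_simp
          ring
  rw [setLIntegral_congr_fun measurableSet_Ioi key, lintegral_const_mul' _ _ (by simp),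
    lintegral_Ioi_one_add_inv_sq_mul_exp ht hs (by positivity),
    ← ENNReal.ofReal_mul (by positivity), stableDensity_eq hc]
  congr 1
  have e5 : √(Real.pi / (1 / (4 * c))) = 2 * √Real.pi * √c := by
    rw [Real.sqrt_eq_iff_mul_self_eq (by positivity) (by positivity)]
    have := Real.mul_self_sqrt hpi.le
    have := Real.mul_self_sqrt hc.le
    calc Real.pi / (1 / (4 * c)) = 4 * Real.pi * c := by field_simp
      _ = 4 * (√Real.pi * √Real.pi) * (√c * √c) := by simp only [*]
      _ = _ := by ring
  rw [e5]
  have h1 : Real.pi = √Real.pi ^ 2 := (Real.sq_sqrt hpi.le).symm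
  have h2 : c = √c ^ 2 := (Real.sq_sqrt hc.le).symm
  have h3 : 0 < √Real.pi := Real.sqrt_pos.2 hpi
  have h4 : 0 < √c := Real.sqrt_pos.2 hc
  generalize Real.exp _ = e
  generalize √Real.pi = u at *
  generalize √c = v at *
  rw [h1, h2]
  field_simp

lemma setLIntegral_stableDensity {t : ℝ} (ht : 0 < t) :
    ∫⁻ a in Ioi (0 : ℝ), ENNReal.ofReal (stableDensity t a) = 1 := by
  have hpi := Real.pi_pos
  have him : (fun w : ℝ => 1 / w ^ 2) '' Ioi 0 = Ioi 0 := by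
    ext a
    constructor
    · rintro ⟨w, hw, rfl⟩
      have hw' : 0 < w := hw
      exact one_div_pos.2 (pow_pos hw' 2)
    · intro ha
      have ha' : 0 < a := ha
      refine ⟨√(1 / a), Real.sqrt_pos.2 (by positivity), ?_⟩
      simp only
      rw [Real.sq_sqrt (by positivity), one_div_one_div]
  have hinj : InjOn (fun w : ℝ => 1 / w ^ 2) (Ioi 0) := by
    intro a ha b hb hab
    have ha' : 0 < a := ha
    have hb' : 0 < b := hb
    simp only at hab
    rw [div_eq_div_iff (by positivity) (by positivity)] at hab
    exact (pow_left_inj₀ ha'.le hb'.le two_ne_zero).1 (by linarith)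
  rw [← him, lintegral_image_eq_lintegral_abs_deriv_mul (measurableSet_Ioi (a := (0 : ℝ)))
    (f := fun w => 1 / w ^ 2) (f' := fun w => -(2 / w ^ 3)) (fun w hw => by
      have hw0 : 0 < w := hw
      have h1 : w ^ 2 ≠ 0 := by positivity
      have := (hasDerivAt_pow 2 w).inv h1
      refine (this.congr_deriv ?_).hasDerivWithinAt.congr_of_mem (fun z _ => ?_) hw
      · push_cast; field_simp
      · simp) hinj]
  have key : ∀ w ∈ Ioi (0 : ℝ), ENNReal.ofReal |-(2 / w ^ 3)| *
      ENNReal.ofReal (stableDensity t (1 / w ^ 2)) =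
      ENNReal.ofReal (t / √Real.pi) * ENNReal.ofReal (Real.exp (-(t ^ 2 / 4) * w ^ 2)) := by
    intro w hw
    have hw0 : 0 < w := hw
    rw [← ENNReal.ofReal_mul (abs_nonneg _), ← ENNReal.ofReal_mul (by positivity), abs_neg,
      abs_of_pos (by positivity), stableDensity_eq (by positivity), Real.sqrt_div zero_le_one,
      Real.sqrt_one, Real.sqrt_sq hw0.le]
    congr 1
    have : -(t ^ 2) / (4 * (1 / w ^ 2)) = -(t ^ 2 / 4) * w ^ 2 := by field_simp
    rw [this]
    field_simp
  rw [setLIntegral_congr_fun measurableSet_Ioi key, lintegral_const_mul' _ _ (by simp),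
    lintegral_Ioi_exp_neg_mul_sq (by positivity), ← ENNReal.ofReal_mul (by positivity),
    ENNReal.ofReal_eq_one]
  rw [show Real.pi / (t ^ 2 / 4) = Real.pi * (2 / t) ^ 2 by field_simp; norm_num,
    Real.sqrt_mul hpi.le, Real.sqrt_sq (by positivity)]
  have : 0 < √Real.pi := Real.sqrt_pos.2 hpi
  field_simp

/-- The one-sided stable law of order `1/2`. -/
noncomputable def stableMeasure (t : ℝ) : Measure ℝ :=
  volume.withDensity ((Ioi (0 : ℝ)).indicator fun a => ENNReal.ofReal (stableDensity t a))

lemma measurable_indicator_stableDensity (t : ℝ) :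
    Measurable ((Ioi (0 : ℝ)).indicator fun a => ENNReal.ofReal (stableDensity t a)) :=
  (measurable_stableDensity t).ennreal_ofReal.indicator measurableSet_Ioi

lemma stableMeasure_eq (t : ℝ) : stableMeasure t = (volume.restrict (Ioi (0 : ℝ))).withDensity
    fun a => ENNReal.ofReal (stableDensity t a) := by
  rw [stableMeasure, withDensity_indicator measurableSet_Ioi]

lemma isProbabilityMeasure_stableMeasure {t : ℝ} (ht : 0 < t) :
    IsProbabilityMeasure (stableMeasure t) := by
  constructor
  rw [stableMeasure_eq, withDensity_apply _ MeasurableSet.univ, Measure.restrict_univ,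
    setLIntegral_stableDensity ht]

lemma ae_stableMeasure_pos (t : ℝ) : ∀ᵐ a ∂(stableMeasure t), 0 < a := by
  rw [stableMeasure_eq]
  exact (withDensity_absolutelyContinuous _ _).ae_le (ae_restrict_mem measurableSet_Ioi)

lemma lintegral_stableMeasure (t : ℝ) (G : ℝ → ℝ≥0∞) :
    ∫⁻ a, G a ∂(stableMeasure t) =
      ∫⁻ a in Ioi (0 : ℝ), ENNReal.ofReal (stableDensity t a) * G a := by
  rw [stableMeasure_eq, lintegral_withDensity_eq_lintegral_mul_non_measurable _
    (measurable_stableDensity t).ennreal_ofReal (by simp)]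
  rfl

lemma integral_stableMeasure {t : ℝ} (ht : 0 < t) (G : ℝ → ℝ) :
    ∫ a, G a ∂(stableMeasure t) = ∫ a in Ioi (0 : ℝ), G a * stableDensity t a := by
  rw [stableMeasure_eq, integral_withDensity_eq_integral_toReal_smul
    (measurable_stableDensity t).ennreal_ofReal (by simp)]
  refine setIntegral_congr_fun measurableSet_Ioi fun a ha => ?_
  rw [ENNReal.toReal_ofReal (stableDensity_pos ht ha).le, smul_eq_mul, mul_comm]

lemma conv_stableMeasure {t s : ℝ} (ht : 0 < t) (hs : 0 < s) :
    (stableMeasure t).conv (stableMeasure s) = stableMeasure (t + s) := by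
  unfold stableMeasure
  rw [conv_withDensity_eq_lconvolution (measurable_indicator_stableDensity t)
    (measurable_indicator_stableDensity s)]
  congr 1
  funext c
  rw [lconvolution_def]
  rcases le_or_gt c 0 with hc | hc
  · rw [indicator_of_notMem (by simpa using hc)]
    refine (lintegral_congr (g := fun _ => 0) fun a => ?_).trans lintegral_zero
    simp only [mul_eq_zero, indicator_apply_eq_zero, mem_Ioi]
    by_cases ha : 0 < a
    · right; intro h; linarith
    · left; intro h; exact absurd h ha
  · rw [indicator_of_mem (by simpa using hc), ← setLIntegral_stableDensity_mul_stableDensity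
      ht hs hc, ← lintegral_indicator measurableSet_Ioo]
    refine lintegral_congr fun a => ?_
    by_cases ha : a ∈ Ioo 0 c
    · rw [indicator_of_mem ha, indicator_of_mem (show a ∈ Ioi (0 : ℝ) from ha.1),
        indicator_of_mem (show -a + c ∈ Ioi (0 : ℝ) by simpa using ha.2),
        ENNReal.ofReal_mul (stableDensity_pos ht ha.1).le, neg_add_eq_sub]
    · rw [indicator_of_notMem ha]
      simp only [mul_eq_zero, indicator_apply_eq_zero, mem_Ioi]
      by_cases ha0 : 0 < a
      · right; intro h; exact absurd ⟨ha0, by linarith⟩ ha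
      · left; intro h; exact absurd h ha0

end Stable

/-! ### Time derivatives of the stable densities -/

section StableDeriv

/-- The polynomials `Q_k` with `∂_t^k σ_t(a) = a^{-1-k/2} Q_k(t / √a) e^{-t²/4a}`, where `σ_t` is
the stable density. -/
noncomputable def stablePoly : ℕ → Polynomial ℝ
  | 0 => Polynomial.C (1 / (2 * √Real.pi)) * Polynomial.X
  | k + 1 => Polynomial.derivative (stablePoly k) -
      Polynomial.C (1 / 2) * Polynomial.X * stablePoly k

/-- The `k`-th derivative in `t` of the stable density, for `a > 0`. -/
noncomputable def stableDensityDeriv (k : ℕ) (t a : ℝ) : ℝ :=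
  a⁻¹ * (√a)⁻¹ ^ k * (stablePoly k).eval (t / √a) * Real.exp (-(t ^ 2) / (4 * a))

lemma stableDensityDeriv_zero {t a : ℝ} (ha : 0 < a) :
    stableDensityDeriv 0 t a = stableDensity t a := by
  rw [stableDensity_eq ha, stableDensityDeriv, stablePoly]
  simp only [Polynomial.eval_mul, Polynomial.eval_C, Polynomial.eval_X]
  field_simp

lemma measurable_stableDensityDeriv (k : ℕ) :
    Measurable fun z : ℝ × ℝ => stableDensityDeriv k z.1 z.2 := by
  unfold stableDensityDeriv
  have : Measurable fun z : ℝ × ℝ => (stablePoly k).eval (z.1 / √z.2) :=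
    (stablePoly k).continuous.measurable.comp (by fun_prop)
  fun_prop

lemma hasDerivAt_stableDensityDeriv (k : ℕ) {a : ℝ} (ha : 0 < a) (t : ℝ) :
    HasDerivAt (fun t => stableDensityDeriv k t a) (stableDensityDeriv (k + 1) t a) t := by
  have hs : 0 < √a := Real.sqrt_pos.2 ha
  have h1 : HasDerivAt (fun t : ℝ => t / √a) (1 / √a) t := (hasDerivAt_id t).div_const _
  have h2 := ((stablePoly k).hasDerivAt (t / √a)).comp t h1
  have h3 : HasDerivAt (fun t : ℝ => -(t ^ 2) / (4 * a)) (-(2 * t) / (4 * a)) t := by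
    simpa using ((hasDerivAt_pow 2 t).neg.div_const (4 * a))
  have h4 := (h2.const_mul (a⁻¹ * (√a)⁻¹ ^ k)).mul h3.exp
  refine h4.congr_deriv ?_
  simp only [stableDensityDeriv, stablePoly, Polynomial.eval_sub, Polynomial.eval_mul,
    Polynomial.eval_C, Polynomial.eval_X, Function.comp_def]
  have ha2 : a = √a ^ 2 := (Real.sq_sqrt ha.le).symm
  generalize √a = v at *
  subst ha2
  generalize Polynomial.eval (t / v) (stablePoly k) = B
  generalize Polynomial.eval (t / v) (Polynomial.derivative (stablePoly k)) = A
  rw [pow_succ v⁻¹ k]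
  generalize v⁻¹ ^ k = w
  field_simp
  ring

/-- Polynomials are absorbed by `exp (3 u² / 16)`, where `3 / 16 = 1 / 4 - 1 / 16` is what remains
of the exponent of the stable density when the time is halved. -/
lemma exists_abs_eval_le_exp (R : Polynomial ℝ) :
    ∃ C : ℝ, 0 ≤ C ∧ ∀ u : ℝ, 0 ≤ u → |R.eval u| ≤ C * Real.exp (3 / 16 * u ^ 2) := by
  induction R using Polynomial.induction_on' with
  | add p q hp hq =>
    obtain ⟨C, hC, h⟩ := hp
    obtain ⟨D, hD, h'⟩ := hq
    refine ⟨C + D, by positivity, fun u hu => ?_⟩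
    rw [Polynomial.eval_add, add_mul]
    exact (abs_add_le _ _).trans (add_le_add (h u hu) (h' u hu))
  | monomial n c =>
    refine ⟨|c| * (n.factorial * Real.exp (4 / 3)), by positivity, fun u hu => ?_⟩
    rw [Polynomial.eval_monomial, abs_mul, abs_of_nonneg (pow_nonneg hu n), mul_assoc, mul_assoc,
      ← Real.exp_add]
    gcongr
    have h1 := Real.pow_div_factorial_le_exp u hu n
    rw [div_le_iff₀ (by positivity)] at h1
    calc u ^ n ≤ Real.exp u * n.factorial := h1
      _ ≤ Real.exp (4 / 3 + 3 / 16 * u ^ 2) * n.factorial := by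
        gcongr
        nlinarith [sq_nonneg (3 * u - 8)]
      _ = _ := mul_comm _ _

/-- The time derivatives of the stable density are dominated by the stable density at half the
time. -/
lemma exists_abs_stableDensityDeriv_le (k : ℕ) :
    ∃ C : ℝ, 0 < C ∧ ∀ t a : ℝ, 0 < t → 0 < a →
      |stableDensityDeriv k t a| ≤ C * (t ^ k)⁻¹ * stableDensity (t / 2) a := by
  obtain ⟨R, hR⟩ : ∃ R : Polynomial ℝ, Polynomial.X ^ k * stablePoly k = Polynomial.X * R := by
    cases k with
    | zero => exact ⟨Polynomial.C (1 / (2 * √Real.pi)), by rw [stablePoly]; ring⟩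
    | succ k => exact ⟨Polynomial.X ^ k * stablePoly (k + 1), by ring⟩
  obtain ⟨C, hC, h⟩ := exists_abs_eval_le_exp R
  have hpi := Real.sqrt_pos.2 Real.pi_pos
  refine ⟨4 * √Real.pi * C + 1, by positivity, fun t a ht ha => ?_⟩
  have hs : 0 < √a := Real.sqrt_pos.2 ha
  have hu : 0 < t / √a := by positivity
  have h1 := h (t / √a) hu.le
  have h2 : (t / √a) ^ k * |(stablePoly k).eval (t / √a)| =
      t / √a * |R.eval (t / √a)| := by
    have := congrArg (fun S => |Polynomial.eval (t / √a) S|) hR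
    simp only [Polynomial.eval_mul, Polynomial.eval_pow, Polynomial.eval_X, abs_mul, abs_pow,
      abs_of_pos hu] at this
    exact this
  have e1 : Real.exp (-(t ^ 2) / (4 * a)) =
      Real.exp (-(3 / 16 * (t / √a) ^ 2)) * Real.exp (-((t / 2) ^ 2) / (4 * a)) := by
    rw [← Real.exp_add, div_pow t, Real.sq_sqrt ha.le]
    congr 1
    field_simp
    ring
  have hnn : 0 ≤ stableDensity (t / 2) a := (stableDensity_pos (by positivity) ha).le
  calc |stableDensityDeriv k t a| = a⁻¹ * (t ^ k)⁻¹ *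
        ((t / √a) ^ k * |(stablePoly k).eval (t / √a)|) * Real.exp (-(t ^ 2) / (4 * a)) := by
        rw [stableDensityDeriv, abs_mul, abs_mul, abs_of_pos (Real.exp_pos _),
          abs_of_pos (by positivity : 0 < a⁻¹ * (√a)⁻¹ ^ k)]
        rw [div_pow, inv_pow]
        field_simp
    _ = a⁻¹ * (t ^ k)⁻¹ * (t / √a * |R.eval (t / √a)|) *
        (Real.exp (-(3 / 16 * (t / √a) ^ 2)) * Real.exp (-((t / 2) ^ 2) / (4 * a))) := by
        rw [h2, e1]
    _ ≤ a⁻¹ * (t ^ k)⁻¹ * (t / √a * (C * Real.exp (3 / 16 * (t / √a) ^ 2))) *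
        (Real.exp (-(3 / 16 * (t / √a) ^ 2)) * Real.exp (-((t / 2) ^ 2) / (4 * a))) := by
        gcongr
    _ = 4 * √Real.pi * C * (t ^ k)⁻¹ * stableDensity (t / 2) a := by
        rw [stableDensity_eq ha, Real.exp_neg]
        field_simp
        ring
    _ ≤ _ := by
        gcongr
        linarith

lemma stableDensity_le_mul {s t a : ℝ} (hs : 0 < s) (hst : s ≤ t) (ha : 0 < a) :
    stableDensity t a ≤ t / s * stableDensity s a := by
  have hpi := Real.sqrt_pos.2 Real.pi_pos
  have ht : 0 < t := by linarith
  rw [stableDensity_eq ha, stableDensity_eq ha]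
  calc _ ≤ t / (2 * √Real.pi) * Real.exp (-(s ^ 2) / (4 * a)) * (a⁻¹ * (√a)⁻¹) := by
        gcongr
    _ = _ := by field_simp

lemma integrableOn_stableDensity {t : ℝ} (ht : 0 < t) :
    IntegrableOn (stableDensity t) (Ioi 0) := by
  refine ⟨(measurable_stableDensity t).aestronglyMeasurable, ?_⟩
  have : ∫⁻ a in Ioi (0 : ℝ), ‖stableDensity t a‖ₑ = 1 := by
    rw [← setLIntegral_stableDensity ht]
    refine setLIntegral_congr_fun measurableSet_Ioi fun a ha => ?_
    exact Real.enorm_of_nonneg (stableDensity_pos ht ha).le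
  rw [HasFiniteIntegral, this]
  simp

/-- Differentiation under the integral sign in an integral against stable densities. -/
lemma hasDerivAt_integral_stableDensityDeriv {Ω : Type*} [MeasurableSpace Ω] {ν : Measure Ω}
    {W α : Ω → ℝ} (hW : Measurable W) (hα : Measurable α) (hpos : ∀ᵐ ω ∂ν, 0 < α ω)
    (hint : ∀ τ : ℝ, 0 < τ → Integrable (fun ω => W ω * stableDensity τ (α ω)) ν)
    (k : ℕ) {t : ℝ} (ht : 0 < t) :
    Integrable (fun ω => W ω * stableDensityDeriv k t (α ω)) ν ∧
    HasDerivAt (fun t => ∫ ω, W ω * stableDensityDeriv k t (α ω) ∂ν)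
      (∫ ω, W ω * stableDensityDeriv (k + 1) t (α ω) ∂ν) t := by
  have hmeas : ∀ (k : ℕ) (t : ℝ),
      AEStronglyMeasurable (fun ω => W ω * stableDensityDeriv k t (α ω)) ν := fun k t =>
    (hW.mul ((measurable_stableDensityDeriv k).comp
      (measurable_const.prodMk hα))).aestronglyMeasurable
  have hI : ∀ k : ℕ, Integrable (fun ω => W ω * stableDensityDeriv k t (α ω)) ν := by
    intro k
    obtain ⟨C, hC, h⟩ := exists_abs_stableDensityDeriv_le k
    refine ((hint (t / 2) (by positivity)).norm.const_mul (C * (t ^ k)⁻¹)).mono' (hmeas k t) ?_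
    filter_upwards [hpos] with ω hω
    rw [norm_mul, norm_mul, Real.norm_eq_abs (stableDensityDeriv _ _ _),
      Real.norm_of_nonneg (stableDensity_pos (by positivity) hω).le]
    calc _ ≤ ‖W ω‖ * (C * (t ^ k)⁻¹ * stableDensity (t / 2) (α ω)) := by
          gcongr; exact h t _ ht hω
      _ = _ := by ring
  refine ⟨hI k, ?_⟩
  obtain ⟨C, hC, h⟩ := exists_abs_stableDensityDeriv_le (k + 1)
  refine (hasDerivAt_integral_of_dominated_loc_of_deriv_le (s := Ioo (t / 2) (3 * t / 2))
    (F' := fun t ω => W ω * stableDensityDeriv (k + 1) t (α ω))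
    (bound := fun ω => C * ((t / 2) ^ (k + 1))⁻¹ * 3 * ‖W ω * stableDensity (t / 4) (α ω)‖)
    (Ioo_mem_nhds (by linarith) (by linarith))
    (Eventually.of_forall fun t => hmeas k t) (hI k) (hmeas (k + 1) t) ?_
    ((hint (t / 4) (by positivity)).norm.const_mul _) ?_).2
  · filter_upwards [hpos] with ω hω τ hτ
    have hτ0 : 0 < τ := by linarith [hτ.1]
    rw [norm_mul, norm_mul, Real.norm_eq_abs (stableDensityDeriv _ _ _),
      Real.norm_of_nonneg (stableDensity_pos (show 0 < t / 4 by positivity) hω).le]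
    have h1 : stableDensity (τ / 2) (α ω) ≤ 3 * stableDensity (t / 4) (α ω) := by
      refine (stableDensity_le_mul (s := t / 4) (by positivity) (by linarith [hτ.1]) hω).trans ?_
      have := (stableDensity_pos (show 0 < t / 4 by positivity) hω).le
      gcongr
      rw [div_le_iff₀ (by positivity)]
      linarith [hτ.2]
    calc _ ≤ ‖W ω‖ * (C * (τ ^ (k + 1))⁻¹ * stableDensity (τ / 2) (α ω)) := by
          gcongr; exact h τ _ hτ0 hω
      _ ≤ ‖W ω‖ * (C * ((t / 2) ^ (k + 1))⁻¹ * (3 * stableDensity (t / 4) (α ω))) := by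
          have := (stableDensity_pos (show 0 < τ / 2 by positivity) hω).le
          gcongr
          exact hτ.1.le
      _ = _ := by ring
  · filter_upwards [hpos] with ω hω τ _
    exact (hasDerivAt_stableDensityDeriv k hω τ).const_mul _

lemma iteratedDeriv_integral_stableDensity {Ω : Type*} [MeasurableSpace Ω] {ν : Measure Ω}
    {W α : Ω → ℝ} (hW : Measurable W) (hα : Measurable α) (hpos : ∀ᵐ ω ∂ν, 0 < α ω)
    (hint : ∀ τ : ℝ, 0 < τ → Integrable (fun ω => W ω * stableDensity τ (α ω)) ν)
    (k : ℕ) {t : ℝ} (ht : 0 < t) :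
    iteratedDeriv k (fun t => ∫ ω, W ω * stableDensity t (α ω) ∂ν) t =
      ∫ ω, W ω * stableDensityDeriv k t (α ω) ∂ν := by
  induction k generalizing t with
  | zero =>
    rw [iteratedDeriv_zero]
    refine integral_congr_ae ?_
    filter_upwards [hpos] with ω hω
    rw [stableDensityDeriv_zero hω]
  | succ k ih =>
    rw [iteratedDeriv_succ]
    have : iteratedDeriv k (fun t => ∫ ω, W ω * stableDensity t (α ω) ∂ν) =ᶠ[𝓝 t]
        fun t => ∫ ω, W ω * stableDensityDeriv k t (α ω) ∂ν := by
      filter_upwards [Ioi_mem_nhds ht] with τ hτ using ih hτ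
    rw [this.deriv_eq]
    exact (hasDerivAt_integral_stableDensityDeriv hW hα hpos hint k ht).2.deriv

end StableDeriv

/-! ### Time derivatives of the Poisson-Hermite semigroup -/

section Poisson

variable {d : ℕ} {f : EuclideanSpace ℝ (Fin d) → ℝ}

lemma measurable_mehlerKernel_right (t : ℝ) (x : EuclideanSpace ℝ (Fin d)) :
    Measurable fun y => mehlerKernel t x y := by
  have := (measurable_mehlerKernel (d := d)).comp
    (show Measurable fun y : EuclideanSpace ℝ (Fin d) => (t, x, y) by fun_prop)
  exact this

lemma measurable_ouSemigroup (hf : Measurable f) :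
    Measurable fun z : ℝ × EuclideanSpace ℝ (Fin d) => ouSemigroup z.1 f z.2 := by
  simp_rw [ouSemigroup_eq_integral_mehlerKernel]
  have h1 := (measurable_mehlerKernel (d := d)).comp
    (show Measurable fun z : (ℝ × EuclideanSpace ℝ (Fin d)) × EuclideanSpace ℝ (Fin d) =>
      (z.1.1, z.1.2, z.2) by fun_prop)
  have h2 : StronglyMeasurable fun z : (ℝ × EuclideanSpace ℝ (Fin d)) ×
      EuclideanSpace ℝ (Fin d) => mehlerKernel z.1.1 z.1.2 z.2 * f z.2 :=
    (h1.mul (hf.comp measurable_snd)).stronglyMeasurable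
  exact (h2.integral_prod_right' (ν := gaussianMeasure d)).measurable

lemma enorm_mehlerKernel_mul {t : ℝ} (ht : 0 < t) (x y : EuclideanSpace ℝ (Fin d)) (c : ℝ) :
    ‖mehlerKernel t x y * c‖ₑ = ENNReal.ofReal (mehlerKernel t x y) * ‖c‖ₑ := by
  rw [enorm_mul, Real.enorm_of_nonneg (mehlerKernel_pos ht x y).le]

lemma enorm_ouSemigroup_le {t : ℝ} (ht : 0 < t) (f : EuclideanSpace ℝ (Fin d) → ℝ)
    (x : EuclideanSpace ℝ (Fin d)) :
    ‖ouSemigroup t f x‖ₑ ≤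
      ∫⁻ y, ENNReal.ofReal (mehlerKernel t x y) * ‖f y‖ₑ ∂(gaussianMeasure d) := by
  rw [ouSemigroup_eq_integral_mehlerKernel]
  refine (enorm_integral_le_lintegral_enorm _).trans (le_of_eq ?_)
  simp_rw [enorm_mehlerKernel_mul ht]

/-- The factor `(1 - e^{-2a})^{-d/2}` of the Mehler kernel. -/
noncomputable def mehlerFactor (d : ℕ) (a : ℝ) : ℝ :=
  1 / (1 - Real.exp (-2 * a)) ^ ((d : ℝ) / 2)

lemma mehlerFactor_pos {a : ℝ} (ha : 0 < a) : 0 < mehlerFactor d a := by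
  have := one_sub_exp_pos ha
  unfold mehlerFactor
  positivity

lemma mehlerFactor_anti {a b : ℝ} (ha : 0 < a) (hab : a ≤ b) :
    mehlerFactor d b ≤ mehlerFactor d a := by
  have := one_sub_exp_pos ha
  have h : Real.exp (-2 * b) ≤ Real.exp (-2 * a) := Real.exp_le_exp.2 (by linarith)
  exact one_div_le_one_div_of_le (by positivity)
    (Real.rpow_le_rpow this.le (by linarith) (by positivity))

/-- The singularity of the Mehler kernel at time zero is absorbed by the stable density, at the cost
of halving the time. -/
lemma exists_mehlerFactor_mul_stableDensity_le (d : ℕ) {τ : ℝ} (hτ : 0 < τ) :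
    ∃ C : ℝ, 0 < C ∧ ∀ a : ℝ, 0 < a →
      mehlerFactor d a * stableDensity τ a ≤ C * stableDensity (τ / 2) a := by
  -- `δ / (2 a) = τ² / (4 a) - (τ / 2)² / (4 a)`
  obtain ⟨δ, hδ⟩ : ∃ δ : ℝ, δ = 3 / 8 * τ ^ 2 := ⟨_, rfl⟩
  have hδ0 : 0 < δ := by rw [hδ]; positivity
  have hpi := Real.sqrt_pos.2 Real.pi_pos
  refine ⟨2 * (d.factorial * (δ ^ d)⁻¹ * Real.exp δ), by positivity, fun a ha => ?_⟩
  have hε := one_sub_exp_pos ha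
  have hv : 0 < 1 / (2 * a) := by positivity
  have h1 : 1 / (1 - Real.exp (-2 * a)) ≤ 1 + 1 / (2 * a) := by
    have h := Real.add_one_le_exp (2 * a)
    have h' : Real.exp (-2 * a) = (Real.exp (2 * a))⁻¹ := by rw [← Real.exp_neg]; congr 1; ring
    have h'' : Real.exp (-2 * a) ≤ 1 / (2 * a + 1) := by
      rw [h', one_div]; gcongr
    rw [div_le_iff₀ hε]
    calc (1 : ℝ) = (1 + 1 / (2 * a)) * (1 - 1 / (2 * a + 1)) := by field_simp; ring
      _ ≤ _ := by gcongr
  have h2 : mehlerFactor d a ≤ (1 + 1 / (2 * a)) ^ d := by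
    have e : mehlerFactor d a = (1 / (1 - Real.exp (-2 * a))) ^ ((d : ℝ) / 2) := by
      rw [mehlerFactor, Real.div_rpow zero_le_one hε.le, Real.one_rpow]
    rw [e, ← Real.rpow_natCast]
    calc _ ≤ (1 + 1 / (2 * a)) ^ ((d : ℝ) / 2) := by gcongr
      _ ≤ _ := by
        apply Real.rpow_le_rpow_of_exponent_le (by linarith)
        linarith [Nat.cast_nonneg (α := ℝ) d]
  have h3 : (1 + 1 / (2 * a)) ^ d ≤
      d.factorial * (δ ^ d)⁻¹ * Real.exp δ * Real.exp (δ * (1 / (2 * a))) := by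
    have := Real.pow_div_factorial_le_exp (δ * (1 + 1 / (2 * a))) (by positivity) d
    rw [div_le_iff₀ (by positivity), mul_pow, mul_add, Real.exp_add, mul_one] at this
    calc (1 + 1 / (2 * a)) ^ d = (δ ^ d)⁻¹ * (δ ^ d * (1 + 1 / (2 * a)) ^ d) := by
          field_simp
      _ ≤ (δ ^ d)⁻¹ * (Real.exp δ * Real.exp (δ * (1 / (2 * a))) * d.factorial) := by gcongr
      _ = _ := by ring
  have e1 : Real.exp (-(τ ^ 2) / (4 * a)) * Real.exp (δ * (1 / (2 * a))) =
      Real.exp (-((τ / 2) ^ 2) / (4 * a)) := by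
    rw [← Real.exp_add, hδ]; congr 1; field_simp; ring
  have hnn := (stableDensity_pos hτ ha).le
  calc mehlerFactor d a * stableDensity τ a ≤
        d.factorial * (δ ^ d)⁻¹ * Real.exp δ * Real.exp (δ * (1 / (2 * a))) *
          stableDensity τ a := by gcongr; exact h2.trans h3
    _ = _ := by
        rw [stableDensity_eq ha, stableDensity_eq ha, ← e1]
        ring

lemma lintegral_mehlerKernel_mul_le {a b : ℝ} (ha : 0 < a) (hab : a ≤ b)
    (f : EuclideanSpace ℝ (Fin d) → ℝ) (x : EuclideanSpace ℝ (Fin d)) :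
    ∫⁻ y, ENNReal.ofReal (mehlerKernel b x y) * ‖f y‖ₑ ∂(gaussianMeasure d) ≤
      ENNReal.ofReal (mehlerFactor d a * Real.exp (‖x‖ ^ 2)) *
        ∫⁻ y, ‖f y‖ₑ ∂(gaussianMeasure d) := by
  rw [← lintegral_const_mul' _ _ ENNReal.ofReal_ne_top]
  refine lintegral_mono fun y => ?_
  gcongr
  refine (mehlerKernel_le (ha.trans_le hab) x y).trans ?_
  gcongr
  exact mehlerFactor_anti ha hab

lemma lintegral_mehlerKernel_mul_lt_top (hf : Integrable f (gaussianMeasure d)) {a : ℝ}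
    (ha : 0 < a) (x : EuclideanSpace ℝ (Fin d)) :
    ∫⁻ y, ENNReal.ofReal (mehlerKernel a x y) * ‖f y‖ₑ ∂(gaussianMeasure d) < ∞ :=
  (lintegral_mehlerKernel_mul_le ha le_rfl f x).trans_lt
    (ENNReal.mul_lt_top ENNReal.ofReal_lt_top hf.2)

lemma abs_ouSemigroup_le (hf : Integrable f (gaussianMeasure d)) {a b : ℝ} (ha : 0 < a)
    (hab : a ≤ b) (x : EuclideanSpace ℝ (Fin d)) :
    |ouSemigroup b f x| ≤
      mehlerFactor d a * (Real.exp (‖x‖ ^ 2) * (∫⁻ y, ‖f y‖ₑ ∂(gaussianMeasure d)).toReal) := by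
  have h := (enorm_ouSemigroup_le (ha.trans_le hab) f x).trans
    (lintegral_mehlerKernel_mul_le ha hab f x)
  have hpos := mehlerFactor_pos (d := d) ha
  have := ENNReal.toReal_mono (ENNReal.mul_ne_top ENNReal.ofReal_ne_top hf.2.ne) h
  rw [toReal_enorm, ENNReal.toReal_mul, ENNReal.toReal_ofReal (by positivity)] at this
  rw [← Real.norm_eq_abs, ← mul_assoc]
  exact this

/-- The iterated integral over two Mehler kernels. -/
lemma lintegral_lintegral_mehlerKernel {a b : ℝ} (ha : 0 < a) (hb : 0 < b)
    {F : EuclideanSpace ℝ (Fin d) → ℝ≥0∞} (hF : Measurable F) (x : EuclideanSpace ℝ (Fin d)) :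
    ∫⁻ z, ENNReal.ofReal (mehlerKernel b x z) *
      (∫⁻ y, ENNReal.ofReal (mehlerKernel a z y) * F y ∂(gaussianMeasure d))
        ∂(gaussianMeasure d) =
      ∫⁻ y, ENNReal.ofReal (mehlerKernel (a + b) x y) * F y ∂(gaussianMeasure d) := by
  have hm1 : Measurable fun z : EuclideanSpace ℝ (Fin d) × EuclideanSpace ℝ (Fin d) =>
      ENNReal.ofReal (mehlerKernel a z.1 z.2) := by
    have := (measurable_mehlerKernel (d := d)).comp
      (show Measurable fun z : EuclideanSpace ℝ (Fin d) × EuclideanSpace ℝ (Fin d) =>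
        (a, z.1, z.2) by fun_prop)
    exact this.ennreal_ofReal
  have hm2 : Measurable fun z : EuclideanSpace ℝ (Fin d) => ENNReal.ofReal (mehlerKernel b x z) :=
    (measurable_mehlerKernel_right b x).ennreal_ofReal
  have hm3 : Measurable (Function.uncurry fun z y : EuclideanSpace ℝ (Fin d) =>
      ENNReal.ofReal (mehlerKernel b x z) * (ENNReal.ofReal (mehlerKernel a z y) * F y)) := by
    have := (hm2.comp measurable_fst).mul (hm1.mul (hF.comp measurable_snd))
    exact this
  have e1 : ∀ z, ENNReal.ofReal (mehlerKernel b x z) *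
      (∫⁻ y, ENNReal.ofReal (mehlerKernel a z y) * F y ∂(gaussianMeasure d)) =
      ∫⁻ y, ENNReal.ofReal (mehlerKernel b x z) * (ENNReal.ofReal (mehlerKernel a z y) * F y)
        ∂(gaussianMeasure d) := fun z => (lintegral_const_mul' _ _ ENNReal.ofReal_ne_top).symm
  simp_rw [e1]
  rw [lintegral_lintegral_swap hm3.aemeasurable]
  refine lintegral_congr fun y => ?_
  have hm4 : Measurable fun z : EuclideanSpace ℝ (Fin d) =>
      ENNReal.ofReal (mehlerKernel b x z) * ENNReal.ofReal (mehlerKernel a z y) := by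
    have := hm1.comp (show Measurable fun z : EuclideanSpace ℝ (Fin d) => (z, y) by fun_prop)
    exact hm2.mul this
  simp_rw [← mul_assoc]
  rw [lintegral_mul_const _ hm4, lintegral_mehlerKernel_mul_mehlerKernel ha hb]

/-- The semigroup property of the Ornstein-Uhlenbeck semigroup on integrable functions. -/
lemma integral_mehlerKernel_mul_ouSemigroup (hfm : Measurable f)
    (hf : Integrable f (gaussianMeasure d)) {a b : ℝ} (ha : 0 < a) (hb : 0 < b)
    (x : EuclideanSpace ℝ (Fin d)) :
    ∫ z, mehlerKernel b x z * ouSemigroup a f z ∂(gaussianMeasure d) =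
      ouSemigroup (a + b) f x := by
  have hm1 : Measurable fun z : EuclideanSpace ℝ (Fin d) × EuclideanSpace ℝ (Fin d) =>
      mehlerKernel a z.1 z.2 := by
    have := (measurable_mehlerKernel (d := d)).comp
      (show Measurable fun z : EuclideanSpace ℝ (Fin d) × EuclideanSpace ℝ (Fin d) =>
        (a, z.1, z.2) by fun_prop)
    exact this
  have hm2 := measurable_mehlerKernel_right b x
  have hm3 : Measurable (Function.uncurry fun z y : EuclideanSpace ℝ (Fin d) =>
      mehlerKernel b x z * (mehlerKernel a z y * f y)) := by
    have := (hm2.comp measurable_fst).mul (hm1.mul (hfm.comp measurable_snd))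
    exact this
  have hint : Integrable (Function.uncurry fun z y : EuclideanSpace ℝ (Fin d) =>
      mehlerKernel b x z * (mehlerKernel a z y * f y))
      ((gaussianMeasure d).prod (gaussianMeasure d)) := by
    refine ⟨hm3.aestronglyMeasurable, ?_⟩
    rw [HasFiniteIntegral, lintegral_prod _ hm3.enorm.aemeasurable]
    have e : ∀ z, ∫⁻ y, ‖Function.uncurry (fun z y : EuclideanSpace ℝ (Fin d) =>
        mehlerKernel b x z * (mehlerKernel a z y * f y)) (z, y)‖ₑ ∂(gaussianMeasure d) =
        ENNReal.ofReal (mehlerKernel b x z) *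
        (∫⁻ y, ENNReal.ofReal (mehlerKernel a z y) * ‖f y‖ₑ ∂(gaussianMeasure d)) := by
      intro z
      rw [← lintegral_const_mul' _ _ ENNReal.ofReal_ne_top]
      refine lintegral_congr fun y => ?_
      rw [Function.uncurry_apply_pair, enorm_mehlerKernel_mul hb, enorm_mehlerKernel_mul ha]
    simp_rw [e]
    rw [lintegral_lintegral_mehlerKernel ha hb hfm.enorm]
    exact lintegral_mehlerKernel_mul_lt_top hf (add_pos ha hb) x
  simp_rw [ouSemigroup_eq_integral_mehlerKernel, ← integral_const_mul]
  rw [integral_integral_swap hint]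
  refine integral_congr_ae (ae_of_all _ fun y => ?_)
  simp only
  have e2 : ∀ z, mehlerKernel b x z * (mehlerKernel a z y * f y) =
      mehlerKernel b x z * mehlerKernel a z y * f y := fun z => by ring
  simp_rw [e2]
  rw [integral_mul_const]
  congr 1
  have hpos : ∀ z, 0 ≤ mehlerKernel b x z * mehlerKernel a z y := fun z =>
    (mul_pos (mehlerKernel_pos hb x z) (mehlerKernel_pos ha z y)).le
  have hm4 : Measurable fun z => mehlerKernel b x z * mehlerKernel a z y := by
    have := hm1.comp (show Measurable fun z : EuclideanSpace ℝ (Fin d) => (z, y) by fun_prop)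
    exact hm2.mul this
  rw [integral_eq_lintegral_of_nonneg_ae (ae_of_all _ hpos) hm4.aestronglyMeasurable]
  have e3 : ∀ z, ENNReal.ofReal (mehlerKernel b x z * mehlerKernel a z y) =
      ENNReal.ofReal (mehlerKernel b x z) * ENNReal.ofReal (mehlerKernel a z y) := fun z =>
    ENNReal.ofReal_mul (mehlerKernel_pos hb x z).le
  simp_rw [e3]
  rw [lintegral_mehlerKernel_mul_mehlerKernel ha hb,
    ENNReal.toReal_ofReal (mehlerKernel_pos (add_pos ha hb) x y).le]

/-- The `k`-th time derivative of the Poisson-Hermite semigroup, as an integral against the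
derivative of the stable density. -/
noncomputable def poissonDeriv (k : ℕ) (f : EuclideanSpace ℝ (Fin d) → ℝ) (t : ℝ)
    (x : EuclideanSpace ℝ (Fin d)) : ℝ :=
  ∫ a in Ioi (0 : ℝ), ouSemigroup a f x * stableDensityDeriv k t a

lemma measurable_ouSemigroup_left (hfm : Measurable f) (x : EuclideanSpace ℝ (Fin d)) :
    Measurable fun a => ouSemigroup a f x := by
  have := (measurable_ouSemigroup hfm).comp (show Measurable fun a : ℝ => (a, x) by fun_prop)
  exact this

lemma integrableOn_ouSemigroup_mul_stableDensity (hfm : Measurable f)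
    (hf : Integrable f (gaussianMeasure d)) (x : EuclideanSpace ℝ (Fin d)) {τ : ℝ} (hτ : 0 < τ) :
    IntegrableOn (fun a => ouSemigroup a f x * stableDensity τ a) (Ioi 0) := by
  obtain ⟨C, hC, h⟩ := exists_mehlerFactor_mul_stableDensity_le d hτ
  set N := Real.exp (‖x‖ ^ 2) * (∫⁻ y, ‖f y‖ₑ ∂(gaussianMeasure d)).toReal with hN
  have hN0 : 0 ≤ N := by positivity
  refine ((integrableOn_stableDensity (show 0 < τ / 2 by positivity)).const_mul (N * C)).mono'
    ((measurable_ouSemigroup_left hfm x).mul (measurable_stableDensity τ)).aestronglyMeasurable ?_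
  filter_upwards [ae_restrict_mem measurableSet_Ioi] with a ha
  have hs := (stableDensity_pos hτ ha).le
  rw [norm_mul, Real.norm_eq_abs, Real.norm_of_nonneg hs]
  calc _ ≤ mehlerFactor d a * N * stableDensity τ a := by
        gcongr; exact abs_ouSemigroup_le hf ha le_rfl x
    _ = N * (mehlerFactor d a * stableDensity τ a) := by ring
    _ ≤ N * (C * stableDensity (τ / 2) a) := mul_le_mul_of_nonneg_left (h a ha) hN0
    _ = _ := by ring

lemma iteratedDeriv_poissonHermite (hfm : Measurable f) (hf : Integrable f (gaussianMeasure d))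
    (k : ℕ) {t : ℝ} (ht : 0 < t) (x : EuclideanSpace ℝ (Fin d)) :
    iteratedDeriv k (fun s => poissonHermite s f x) t = poissonDeriv k f t x :=
  iteratedDeriv_integral_stableDensity (measurable_ouSemigroup_left hfm x) measurable_id
    (ae_restrict_mem measurableSet_Ioi)
    (fun _ hτ => integrableOn_ouSemigroup_mul_stableDensity hfm hf x hτ) k ht

lemma hasDerivAt_poissonDeriv (hfm : Measurable f) (hf : Integrable f (gaussianMeasure d))
    (k : ℕ) {t : ℝ} (ht : 0 < t) (x : EuclideanSpace ℝ (Fin d)) :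
    HasDerivAt (fun t => poissonDeriv k f t x) (poissonDeriv (k + 1) f t x) t :=
  (hasDerivAt_integral_stableDensityDeriv (measurable_ouSemigroup_left hfm x) measurable_id
    (ae_restrict_mem measurableSet_Ioi)
    (fun _ hτ => integrableOn_ouSemigroup_mul_stableDensity hfm hf x hτ) k ht).2

lemma measurable_poissonDeriv (hfm : Measurable f) (k : ℕ) :
    Measurable fun z : ℝ × EuclideanSpace ℝ (Fin d) => poissonDeriv k f z.1 z.2 := by
  have h1 := (measurable_ouSemigroup hfm).comp
    (show Measurable fun z : (ℝ × EuclideanSpace ℝ (Fin d)) × ℝ => (z.2, z.1.2) by fun_prop)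
  have h2 := (measurable_stableDensityDeriv k).comp
    (show Measurable fun z : (ℝ × EuclideanSpace ℝ (Fin d)) × ℝ => (z.1.1, z.2) by fun_prop)
  have h3 : StronglyMeasurable fun z : (ℝ × EuclideanSpace ℝ (Fin d)) × ℝ =>
      ouSemigroup z.2 f z.1.2 * stableDensityDeriv k z.1.1 z.2 := (h1.mul h2).stronglyMeasurable
  exact (h3.integral_prod_right' (ν := volume.restrict (Ioi (0 : ℝ)))).measurable

/-- The derivatives of the Poisson-Hermite semigroup are dominated by averages of the
Ornstein-Uhlenbeck semigroup. -/
lemma exists_enorm_poissonDeriv_le (d k : ℕ) :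
    ∃ C : ℝ, 0 < C ∧ ∀ (f : EuclideanSpace ℝ (Fin d) → ℝ) (t : ℝ), 0 < t → ∀ x,
      ‖poissonDeriv k f t x‖ₑ ≤ ENNReal.ofReal (C * (t ^ k)⁻¹) *
        ouAverage (stableMeasure (t / 2)) (fun y => ‖f y‖ₑ) x := by
  obtain ⟨C, hC, h⟩ := exists_abs_stableDensityDeriv_le k
  refine ⟨C, hC, fun f t ht x => ?_⟩
  rw [ouAverage, lintegral_stableMeasure, ← lintegral_const_mul' _ _ ENNReal.ofReal_ne_top]
  refine (enorm_integral_le_lintegral_enorm _).trans ?_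
  refine setLIntegral_mono' measurableSet_Ioi fun a ha => ?_
  rw [enorm_mul, mul_comm, ← mul_assoc]
  gcongr
  · rw [← ENNReal.ofReal_mul (by positivity), ← ofReal_norm, Real.norm_eq_abs]
    exact ENNReal.ofReal_le_ofReal (h t a ht ha)
  · exact enorm_ouSemigroup_le ha f x

/-- Semigroup property at the level of time derivatives, as an upper bound. -/
lemma enorm_poissonDeriv_add_le (hfm : Measurable f) (hf : Integrable f (gaussianMeasure d))
    (k : ℕ) {t s : ℝ} (ht : 0 < t) (hs : 0 < s) (x : EuclideanSpace ℝ (Fin d)) :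
    ‖poissonDeriv k f (t + s) x‖ₑ ≤
      ouAverage (stableMeasure s) (fun z => ‖poissonDeriv k f t z‖ₑ) x := by
  have hprob := isProbabilityMeasure_stableMeasure hs
  set N := Real.exp (‖x‖ ^ 2) * (∫⁻ y, ‖f y‖ₑ ∂(gaussianMeasure d)).toReal with hN
  have hN0 : 0 ≤ N := by positivity
  set ν : Measure (ℝ × ℝ) := (volume.restrict (Ioi (0 : ℝ))).prod (stableMeasure s) with hν
  have hpos1 : ∀ᵐ z ∂ν, 0 < z.1 :=
    Measure.quasiMeasurePreserving_fst.ae (ae_restrict_mem measurableSet_Ioi)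
  have hpos2 : ∀ᵐ z ∂ν, 0 < z.2 := Measure.quasiMeasurePreserving_snd.ae (ae_stableMeasure_pos s)
  have hW : Measurable fun z : ℝ × ℝ => ouSemigroup (z.1 + z.2) f x :=
    (measurable_ouSemigroup_left hfm x).comp (measurable_fst.add measurable_snd)
  have hint : ∀ τ : ℝ, 0 < τ → Integrable
      (fun z : ℝ × ℝ => ouSemigroup (z.1 + z.2) f x * stableDensity τ z.1) ν := by
    intro τ hτ
    obtain ⟨C, hC, h⟩ := exists_mehlerFactor_mul_stableDensity_le d hτ
    have h0 : Integrable (fun z : ℝ × ℝ => stableDensity (τ / 2) z.1) ν :=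
      (integrableOn_stableDensity (show 0 < τ / 2 by positivity)).comp_fst (stableMeasure s)
    refine (h0.const_mul (N * C)).mono'
      (hW.mul ((measurable_stableDensity τ).comp measurable_fst)).aestronglyMeasurable ?_
    filter_upwards [hpos1, hpos2] with z hz1 hz2
    have hs := (stableDensity_pos hτ hz1).le
    rw [norm_mul, Real.norm_eq_abs, Real.norm_of_nonneg hs]
    calc _ ≤ mehlerFactor d z.1 * N * stableDensity τ z.1 := by
          gcongr; exact abs_ouSemigroup_le hf hz1 (by linarith) x
      _ = N * (mehlerFactor d z.1 * stableDensity τ z.1) := by ring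
      _ ≤ N * (C * stableDensity (τ / 2) z.1) := mul_le_mul_of_nonneg_left (h _ hz1) hN0
      _ = _ := by ring
  -- the subordination formula for `P_{τ + s} f`, with the two stable laws separated
  have hsub : ∀ τ : ℝ, 0 < τ → poissonHermite (τ + s) f x =
      ∫ z, ouSemigroup (z.1 + z.2) f x * stableDensity τ z.1 ∂ν := by
    intro τ hτ
    have hprob' := isProbabilityMeasure_stableMeasure hτ
    have hτm : Measurable fun z : ℝ × ℝ => ENNReal.ofReal (stableDensity τ z.1) :=
      ((measurable_stableDensity τ).comp measurable_fst).ennreal_ofReal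
    rw [poissonHermite, ← integral_stableMeasure (by positivity), ← conv_stableMeasure hτ hs,
      Measure.conv, integral_map (by fun_prop)
        (measurable_ouSemigroup_left hfm x).aestronglyMeasurable, stableMeasure_eq τ,
      prod_withDensity_left (measurable_stableDensity τ).ennreal_ofReal,
      integral_withDensity_eq_integral_toReal_smul hτm (by simp)]
    refine integral_congr_ae ?_
    filter_upwards [hpos1] with z hz
    rw [ENNReal.toReal_ofReal (stableDensity_pos hτ hz).le, smul_eq_mul, mul_comm]
  have hder : poissonDeriv k f (t + s) x =
      ∫ z, ouSemigroup (z.1 + z.2) f x * stableDensityDeriv k t z.1 ∂ν := by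
    rw [← iteratedDeriv_poissonHermite hfm hf k (add_pos ht hs),
      ← iteratedDeriv_integral_stableDensity hW measurable_fst hpos1 hint k ht]
    have h1 := congrFun (iteratedDeriv_comp_add_const k (fun τ => poissonHermite τ f x) s) t
    rw [← h1]
    refine Filter.EventuallyEq.iteratedDeriv_eq k ?_
    filter_upwards [Ioi_mem_nhds ht] with τ hτ using hsub τ hτ
  have hI := (hasDerivAt_integral_stableDensityDeriv hW measurable_fst hpos1 hint k ht).1
  rw [hder, integral_prod_symm _ hI, ouAverage]
  refine (enorm_integral_le_lintegral_enorm _).trans (lintegral_mono_ae ?_)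
  filter_upwards [ae_stableMeasure_pos s] with b hb
  obtain ⟨C, hC, hCk⟩ := exists_abs_stableDensityDeriv_le k
  -- Fubini: the kernel `mehlerKernel b` is moved inside the integral defining `poissonDeriv`
  have hfub : ∫ a in Ioi (0 : ℝ), ouSemigroup (a + b) f x * stableDensityDeriv k t a =
      ∫ z, mehlerKernel b x z * poissonDeriv k f t z ∂(gaussianMeasure d) := by
    have hmeas : Measurable (Function.uncurry fun (a : ℝ) (z : EuclideanSpace ℝ (Fin d)) =>
        mehlerKernel b x z * (ouSemigroup a f z * stableDensityDeriv k t a)) := by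
      have h1 := (measurable_mehlerKernel_right b x).comp
        (show Measurable fun z : ℝ × EuclideanSpace ℝ (Fin d) => z.2 from measurable_snd)
      have h2 := (measurable_stableDensityDeriv k).comp
        (show Measurable fun z : ℝ × EuclideanSpace ℝ (Fin d) => (t, z.1) by fun_prop)
      exact h1.mul ((measurable_ouSemigroup hfm).mul h2)
    have hintz : Integrable (Function.uncurry fun (a : ℝ) (z : EuclideanSpace ℝ (Fin d)) =>
        mehlerKernel b x z * (ouSemigroup a f z * stableDensityDeriv k t a))
        ((volume.restrict (Ioi (0 : ℝ))).prod (gaussianMeasure d)) := by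
      refine ⟨hmeas.aestronglyMeasurable, ?_⟩
      rw [HasFiniteIntegral, lintegral_prod _ hmeas.enorm.aemeasurable]
      obtain ⟨C', hC', hC'w⟩ := exists_mehlerFactor_mul_stableDensity_le d
        (show 0 < t / 2 by positivity)
      have hle : ∀ a ∈ Ioi (0 : ℝ), ∫⁻ z, ‖Function.uncurry (fun (a : ℝ)
          (z : EuclideanSpace ℝ (Fin d)) => mehlerKernel b x z *
            (ouSemigroup a f z * stableDensityDeriv k t a)) (a, z)‖ₑ ∂(gaussianMeasure d) ≤
          ENNReal.ofReal (C * (t ^ k)⁻¹ * Real.exp (‖x‖ ^ 2) * C') *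
            (∫⁻ y, ‖f y‖ₑ ∂(gaussianMeasure d)) *
            ENNReal.ofReal (stableDensity (t / 2 / 2) a) := by
        intro a ha
        have ha0 : 0 < a := ha
        have hw := (mehlerFactor_pos (d := d) ha0).le
        calc _ ≤ ∫⁻ z, ENNReal.ofReal (C * (t ^ k)⁻¹ * stableDensity (t / 2) a) *
              (ENNReal.ofReal (mehlerKernel b x z) * (∫⁻ y, ENNReal.ofReal (mehlerKernel a z y) *
                ‖f y‖ₑ ∂(gaussianMeasure d))) ∂(gaussianMeasure d) := by
              refine lintegral_mono fun z => ?_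
              rw [Function.uncurry_apply_pair, enorm_mehlerKernel_mul hb, enorm_mul, mul_comm,
                mul_comm (‖ouSemigroup a f z‖ₑ), mul_assoc, mul_comm (‖ouSemigroup a f z‖ₑ)]
              gcongr
              · rw [← ofReal_norm, Real.norm_eq_abs]
                exact ENNReal.ofReal_le_ofReal (hCk t a ht ha)
              · exact enorm_ouSemigroup_le ha f z
          _ = ENNReal.ofReal (C * (t ^ k)⁻¹ * stableDensity (t / 2) a) *
              ∫⁻ y, ENNReal.ofReal (mehlerKernel (a + b) x y) * ‖f y‖ₑ ∂(gaussianMeasure d) := by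
              rw [lintegral_const_mul' _ _ ENNReal.ofReal_ne_top,
                lintegral_lintegral_mehlerKernel ha hb hfm.enorm]
          _ ≤ ENNReal.ofReal (C * (t ^ k)⁻¹ * stableDensity (t / 2) a) *
              (ENNReal.ofReal (mehlerFactor d a * Real.exp (‖x‖ ^ 2)) *
                ∫⁻ y, ‖f y‖ₑ ∂(gaussianMeasure d)) := by
              gcongr
              exact lintegral_mehlerKernel_mul_le ha0 (by linarith) f x
          _ ≤ _ := by
              have hσ := (stableDensity_pos (show 0 < t / 2 by positivity) ha0).le
              rw [← mul_assoc, ← ENNReal.ofReal_mul (by positivity),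
                mul_right_comm (ENNReal.ofReal _),
                ← ENNReal.ofReal_mul (by positivity)]
              refine mul_le_mul' (ENNReal.ofReal_le_ofReal ?_) le_rfl
              calc _ = C * (t ^ k)⁻¹ * Real.exp (‖x‖ ^ 2) *
                    (mehlerFactor d a * stableDensity (t / 2) a) := by ring
                _ ≤ C * (t ^ k)⁻¹ * Real.exp (‖x‖ ^ 2) * (C' * stableDensity (t / 2 / 2) a) := by
                    exact mul_le_mul_of_nonneg_left (hC'w a ha0) (by positivity)
                _ = _ := by ring
      refine (setLIntegral_mono' measurableSet_Ioi hle).trans_lt ?_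
      have hft : ∫⁻ y, ‖f y‖ₑ ∂(gaussianMeasure d) ≠ ∞ := hf.2.ne
      rw [lintegral_const_mul' _ _ (ENNReal.mul_ne_top ENNReal.ofReal_ne_top hft),
        setLIntegral_stableDensity (by positivity), mul_one]
      exact ENNReal.mul_lt_top ENNReal.ofReal_lt_top hf.2
    have hswap := integral_integral_swap hintz
    simp_rw [integral_const_mul] at hswap
    simp only [poissonDeriv]
    rw [← hswap]
    refine setIntegral_congr_fun measurableSet_Ioi fun a ha => ?_
    simp_rw [← mul_assoc]
    rw [integral_mul_const, integral_mehlerKernel_mul_ouSemigroup hfm hf ha hb]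
  rw [hfub]
  refine (enorm_integral_le_lintegral_enorm _).trans (le_of_eq ?_)
  simp_rw [enorm_mehlerKernel_mul hb]

end Poisson

/-! ### Norm estimates for the time derivatives -/

section Estimates

variable {d : ℕ} {p : EuclideanSpace ℝ (Fin d) → ℝ} {f : EuclideanSpace ℝ (Fin d) → ℝ}

lemma luxNorm_const_mul_le {X : Type*} [MeasurableSpace X] (m : Measure X) (r : X → ℝ)
    (g : X → ℝ≥0∞) {c : ℝ≥0∞} (hc : c ≠ 0) (hct : c ≠ ∞) :
    luxNorm m r (fun x => c * g x) ≤ c * luxNorm m r g := by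
  rw [mul_comm c (luxNorm m r g), ← ENNReal.div_le_iff_le_mul (Or.inl hc) (Or.inl hct)]
  refine le_sInf ?_
  rintro b ⟨hb0, hbt, hb⟩
  rw [ENNReal.div_le_iff_le_mul (Or.inl hc) (Or.inl hct), mul_comm]
  refine sInf_le ⟨ENNReal.mul_pos hc hb0.ne', ENNReal.mul_lt_top hct.lt_top hbt, ?_⟩
  simpa only [ENNReal.mul_div_mul_left _ _ hc hct] using hb

/-- A continuous form of the triangle inequality: the norm of an integral is at most the integral
of an upper bound `B` of the norms. -/
lemma luxNorm_lintegral_le {X : Type*} [MeasurableSpace X] {μ : Measure X} [SFinite μ] {r : X → ℝ}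
    (hr : ∀ x, 1 ≤ r x) (hrm : AEMeasurable r μ) {m : Measure ℝ} [SFinite m]
    {g : ℝ → X → ℝ≥0∞} (hg : Measurable (Function.uncurry g)) {B : ℝ → ℝ≥0∞} (hB : Measurable B)
    (hB0 : ∀ᵐ s ∂m, B s ≠ 0 ∧ B s ≠ ∞) (hgB : ∀ᵐ s ∂m, luxNorm μ r (g s) < B s)
    {M : ℝ≥0∞} (hM0 : M ≠ 0) (hMt : M ≠ ∞) (hM : ∫⁻ s, B s ∂m = M) :
    luxNorm μ r (fun x => ∫⁻ s, g s x ∂m) ≤ M := by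
  refine sInf_le ⟨pos_iff_ne_zero.2 hM0, hMt.lt_top, ?_⟩
  set m' : Measure ℝ := m.withDensity fun s => B s / M with hm'
  have hBM : Measurable fun s => B s / M := hB.div_const M
  have hprob : IsProbabilityMeasure m' := by
    constructor
    rw [hm', withDensity_apply _ MeasurableSet.univ, Measure.restrict_univ]
    simp_rw [div_eq_mul_inv]
    rw [lintegral_mul_const' _ _ (by simpa using hM0), hM, ENNReal.mul_inv_cancel hM0 hMt]
  have hBt : ∀ᵐ s ∂m, B s / M < ∞ := by
    filter_upwards [hB0] with s hs using ENNReal.div_lt_top hs.2 hM0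
  have hgm : ∀ x, Measurable fun s => g s x / B s := fun x =>
    (hg.comp (measurable_id.prodMk measurable_const)).div hB
  have hpt : ∀ x, ((∫⁻ s, g s x ∂m) / M) ^ r x ≤ ∫⁻ s, (g s x / B s) ^ r x ∂m' := by
    intro x
    have e : (∫⁻ s, g s x ∂m) / M = ∫⁻ s, g s x / B s ∂m' := by
      rw [hm', lintegral_withDensity_eq_lintegral_mul₀' hBM.aemeasurable
        (hgm x).aemeasurable, div_eq_mul_inv, ← lintegral_mul_const' _ _ (by simpa using hM0)]
      refine lintegral_congr_ae ?_
      filter_upwards [hB0] with s hs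
      simp only [Pi.mul_apply]
      rw [ENNReal.div_eq_inv_mul, ENNReal.div_eq_inv_mul (a := g s x)]
      calc g s x * M⁻¹ = M⁻¹ * (B s * (B s)⁻¹) * g s x := by
            rw [ENNReal.mul_inv_cancel hs.1 hs.2, mul_one, mul_comm]
        _ = _ := by ring
    rw [e]
    exact lintegral_rpow_le_of_isProbabilityMeasure (hgm x).aemeasurable (hr x)
  have hjoint : AEMeasurable (Function.uncurry fun (x : X) (s : ℝ) => (g s x / B s) ^ r x)
      (μ.prod m') := by
    have h1 : Measurable fun z : X × ℝ => g z.2 z.1 / B z.2 :=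
      (hg.comp measurable_swap).div (hB.comp measurable_snd)
    have h2 : AEMeasurable (fun z : X × ℝ => r z.1) (μ.prod m') :=
      hrm.comp_quasiMeasurePreserving Measure.quasiMeasurePreserving_fst
    exact h1.aemeasurable.pow h2
  calc modular μ r (fun x => (∫⁻ s, g s x ∂m) / M)
      ≤ ∫⁻ x, ∫⁻ s, (g s x / B s) ^ r x ∂m' ∂μ := lintegral_mono hpt
    _ = ∫⁻ s, ∫⁻ x, (g s x / B s) ^ r x ∂μ ∂m' := lintegral_lintegral_swap hjoint
    _ ≤ ∫⁻ _, 1 ∂m' := by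
        refine lintegral_mono_ae ?_
        filter_upwards [(withDensity_absolutelyContinuous m _).ae_le hgB] with s hs
        exact modular_div_le_one_of_luxNorm_lt (ae_of_all _ hr) hs
    _ = 1 := by simp

lemma measurable_enorm_poissonDeriv (hfm : Measurable f) (k : ℕ) (t : ℝ) :
    Measurable fun x => ‖poissonDeriv k f t x‖ₑ := by
  have := (measurable_poissonDeriv hfm k).comp
    (show Measurable fun x : EuclideanSpace ℝ (Fin d) => (t, x) by fun_prop)
  exact this.enorm

/-- The norms of the time derivatives are almost decreasing in time. -/
lemma exists_luxNorm_poissonDeriv_le_mul (hp : GaussianExponent p) (hp0 : LogHolderLocal p) :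
    ∃ C : ℝ≥0∞, 1 ≤ C ∧ C < ∞ ∧ ∀ f : EuclideanSpace ℝ (Fin d) → ℝ, Measurable f →
      Integrable f (gaussianMeasure d) → ∀ (k : ℕ) (s t : ℝ), 0 < s → s < t →
      luxNorm (gaussianMeasure d) p (fun x => ‖poissonDeriv k f t x‖ₑ) ≤
        C * luxNorm (gaussianMeasure d) p (fun x => ‖poissonDeriv k f s x‖ₑ) := by
  obtain ⟨C, hC1, hCt, h⟩ := exists_luxNorm_ouAverage_le hp hp0
  refine ⟨C, hC1, hCt, fun f hfm hf k s t hs hst => ?_⟩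
  refine (luxNorm_mono (ae_of_all _ hp.one_le) (ae_of_all _ fun x => ?_)).trans
    (h (stableMeasure (t - s)) (isProbabilityMeasure_stableMeasure (sub_pos.2 hst))
      (ae_stableMeasure_pos _) _ (measurable_enorm_poissonDeriv hfm k s))
  have := enorm_poissonDeriv_add_le hfm hf k hs (sub_pos.2 hst) x
  rwa [add_sub_cancel] at this

/-- The size of the time derivatives, for an arbitrary function of the space. -/
lemma exists_luxNorm_poissonDeriv_le_rpow (hp : GaussianExponent p) (hp0 : LogHolderLocal p)
    (k : ℕ) : ∃ C : ℝ, 0 < C ∧ ∀ f : EuclideanSpace ℝ (Fin d) → ℝ, Measurable f →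
      ∀ t : ℝ, 0 < t →
      luxNorm (gaussianMeasure d) p (fun x => ‖poissonDeriv k f t x‖ₑ) ≤
        ENNReal.ofReal (C * (t ^ k)⁻¹) *
          luxNorm (gaussianMeasure d) p (fun x => ‖f x‖ₑ) := by
  obtain ⟨C, hC1, hCt, h⟩ := exists_luxNorm_ouAverage_le hp hp0
  obtain ⟨D, hD, hk⟩ := exists_enorm_poissonDeriv_le d k
  have hC0 : 0 < C.toReal := ENNReal.toReal_pos (fun h => by simp [h] at hC1) hCt.ne
  refine ⟨D * C.toReal, by positivity, fun f hfm t ht => ?_⟩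
  have hpos : 0 < D * (t ^ k)⁻¹ := by positivity
  calc _ ≤ luxNorm (gaussianMeasure d) p (fun x => ENNReal.ofReal (D * (t ^ k)⁻¹) *
        ouAverage (stableMeasure (t / 2)) (fun y => ‖f y‖ₑ) x) :=
        luxNorm_mono (ae_of_all _ hp.one_le) (ae_of_all _ fun x => hk f t ht x)
    _ ≤ ENNReal.ofReal (D * (t ^ k)⁻¹) * luxNorm (gaussianMeasure d) p
        (ouAverage (stableMeasure (t / 2)) (fun y => ‖f y‖ₑ)) :=
        luxNorm_const_mul_le _ _ _ (by simpa using hpos) ENNReal.ofReal_ne_top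
    _ ≤ ENNReal.ofReal (D * (t ^ k)⁻¹) * (C * luxNorm (gaussianMeasure d) p
        (fun y => ‖f y‖ₑ)) := by
        gcongr
        exact h _ (isProbabilityMeasure_stableMeasure (by positivity)) (ae_stableMeasure_pos _) _
          hfm.enorm
    _ = _ := by
        have e : D * C.toReal * (t ^ k)⁻¹ = D * (t ^ k)⁻¹ * C.toReal := by ring
        rw [e, ENNReal.ofReal_mul hpos.le, ENNReal.ofReal_toReal hCt.ne, mul_assoc]

/-- The fundamental theorem of calculus in time. -/
lemma enorm_poissonDeriv_le_add (hfm : Measurable f) (hf : Integrable f (gaussianMeasure d))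
    (j : ℕ) {t : ℝ} (ht : 0 < t) (ht1 : t ≤ 1) (x : EuclideanSpace ℝ (Fin d)) :
    ‖poissonDeriv j f t x‖ₑ ≤ ‖poissonDeriv j f 1 x‖ₑ +
      ∫⁻ s in Ioc t 1, ‖poissonDeriv (j + 1) f s x‖ₑ := by
  have hder : ∀ (i : ℕ), ∀ s ∈ uIcc t 1,
      HasDerivAt (fun s => poissonDeriv i f s x) (poissonDeriv (i + 1) f s x) s := by
    intro i s hs
    rw [uIcc_of_le ht1] at hs
    exact hasDerivAt_poissonDeriv hfm hf i (ht.trans_le hs.1) x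
  have hcont : ContinuousOn (fun s => poissonDeriv (j + 1) f s x) (uIcc t 1) := fun s hs =>
    (hder (j + 1) s hs).continuousAt.continuousWithinAt
  have h := intervalIntegral.integral_eq_sub_of_hasDerivAt (hder j) hcont.intervalIntegrable
  have e : poissonDeriv j f t x = poissonDeriv j f 1 x -
      ∫ s in Ioc t 1, poissonDeriv (j + 1) f s x := by
    rw [← intervalIntegral.integral_of_le ht1, h]; ring
  rw [e]
  exact (enorm_sub_le).trans (by gcongr; exact enorm_integral_le_lintegral_enorm _)

/-- An estimate of the form `‖∂_t^{j+1} P_t f‖ = O(t^{β - j - 1})` on `(0, 1]` can be integrated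
when `β < j`. -/
lemma exists_luxNorm_poissonDeriv_le_of_succ (hp : GaussianExponent p) (hp0 : LogHolderLocal p)
    (hfm : Measurable f) (hf : Integrable f (gaussianMeasure d))
    (hft : luxNorm (gaussianMeasure d) p (fun x => ‖f x‖ₑ) < ∞) {β : ℝ} {j : ℕ} (hβ : β < j)
    (h : ∃ A : ℝ, 0 ≤ A ∧ ∀ t, 0 < t → t ≤ 1 →
      luxNorm (gaussianMeasure d) p (fun x => ‖poissonDeriv (j + 1) f t x‖ₑ) ≤
        ENNReal.ofReal (A * t ^ (β - (j + 1)))) :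
    ∃ A : ℝ, 0 ≤ A ∧ ∀ t, 0 < t → t ≤ 1 →
      luxNorm (gaussianMeasure d) p (fun x => ‖poissonDeriv j f t x‖ₑ) ≤
        ENNReal.ofReal (A * t ^ (β - j)) := by
  obtain ⟨A, hA, h⟩ := h
  obtain ⟨C, hC, hCj⟩ := exists_luxNorm_poissonDeriv_le_rpow hp hp0 j
  have hp1 : ∀ᵐ x ∂(gaussianMeasure d), 1 ≤ p x := ae_of_all _ hp.one_le
  set n₁ := luxNorm (gaussianMeasure d) p (fun x => ‖poissonDeriv j f 1 x‖ₑ) with hn₁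
  have hn₁t : n₁ < ∞ :=
    (hCj f hfm 1 one_pos).trans_lt (ENNReal.mul_lt_top ENNReal.ofReal_lt_top hft)
  have hjβ : 0 < j - β := by linarith
  have hA1 : 0 < (A + 1) / (j - β) := by positivity
  refine ⟨2 * (n₁.toReal + (A + 1) / (j - β) + 1), by positivity, fun t ht ht1 => ?_⟩
  have ht1' : 1 ≤ t ^ (β - j) := Real.one_le_rpow_of_pos_of_le_one_of_nonpos ht ht1 (by linarith)
  rcases ht1.eq_or_lt with rfl | htlt
  · rw [← hn₁, Real.one_rpow, mul_one]
    refine (ENNReal.ofReal_toReal hn₁t.ne).symm.le.trans (ENNReal.ofReal_le_ofReal ?_)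
    linarith [ENNReal.toReal_nonneg (a := n₁)]
  set B : ℝ → ℝ≥0∞ := fun s => ENNReal.ofReal ((A + 1) * s ^ (β - (j + 1))) with hB
  have hBm : Measurable B := by rw [hB]; fun_prop
  have hBpos : ∀ s, 0 < s → 0 < (A + 1) * s ^ (β - (j + 1)) := fun s hs => by positivity
  -- the total mass of the bound
  have hBint : ∫⁻ s in Ioc t 1, B s = ENNReal.ofReal ((A + 1) / (j - β) * (t ^ (β - j) - 1)) := by
    have hii : IntervalIntegrable (fun s : ℝ => (A + 1) * s ^ (β - (j + 1))) volume t 1 := by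
      refine (intervalIntegral.intervalIntegrable_rpow (Or.inr ?_)).const_mul _
      rw [uIcc_of_le ht1]; exact fun h0 => absurd h0.1 (not_le.2 ht)
    rw [hB, ← ofReal_integral_eq_lintegral_ofReal
      ((intervalIntegrable_iff_integrableOn_Ioc_of_le ht1).1 hii)]
    · congr 1
      rw [← intervalIntegral.integral_of_le ht1, intervalIntegral.integral_const_mul,
        integral_rpow (Or.inr ⟨by intro h0; linarith, by
          rw [uIcc_of_le ht1]; exact fun h0 => absurd h0.1 (not_le.2 ht)⟩)]
      rw [Real.one_rpow, show β - (j + 1) + 1 = -(j - β) by ring,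
        show β - j = -(j - β) by ring]
      field_simp
      ring
    · filter_upwards [ae_restrict_mem measurableSet_Ioc] with s hs
      exact (hBpos s (ht.trans hs.1)).le
  have htlt' : 1 < t ^ (β - j) := Real.one_lt_rpow_of_pos_of_lt_one_of_neg ht htlt (by linarith)
  have hmass : 0 < (A + 1) / (j - β) * (t ^ (β - j) - 1) := mul_pos hA1 (by linarith)
  have hmink : luxNorm (gaussianMeasure d) p
      (fun x => ∫⁻ s in Ioc t 1, ‖poissonDeriv (j + 1) f s x‖ₑ) ≤
      ENNReal.ofReal ((A + 1) / (j - β) * (t ^ (β - j) - 1)) := by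
    refine luxNorm_lintegral_le (g := fun s x => ‖poissonDeriv (j + 1) f s x‖ₑ) hp.one_le
      hp.aemeasurable (measurable_poissonDeriv hfm (j + 1)).enorm hBm ?_ ?_
      (by simpa using hmass) ENNReal.ofReal_ne_top hBint
    · filter_upwards [ae_restrict_mem measurableSet_Ioc] with s hs
      exact ⟨by simpa [hB] using hBpos s (ht.trans hs.1), ENNReal.ofReal_ne_top⟩
    · filter_upwards [ae_restrict_mem measurableSet_Ioc] with s hs
      have hs0 : 0 < s := ht.trans hs.1
      have hsp : 0 < s ^ (β - (j + 1)) := Real.rpow_pos_of_pos hs0 _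
      refine (h s hs0 hs.2).trans_lt ((ENNReal.ofReal_lt_ofReal_iff (hBpos s hs0)).2 ?_)
      gcongr
      linarith
  set c : ℝ := (n₁.toReal + (A + 1) / (j - β) + 1) * t ^ (β - j) with hc
  have hn₁0 : 0 ≤ n₁.toReal := ENNReal.toReal_nonneg
  have h1 : n₁ < ENNReal.ofReal c := by
    rw [← ENNReal.ofReal_toReal hn₁t.ne, ENNReal.ofReal_lt_ofReal_iff (by positivity), hc]
    calc n₁.toReal < n₁.toReal + (A + 1) / (j - β) + 1 := by linarith
      _ ≤ _ := le_mul_of_one_le_right (by positivity) ht1'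
  have h2 : luxNorm (gaussianMeasure d) p
      (fun x => ∫⁻ s in Ioc t 1, ‖poissonDeriv (j + 1) f s x‖ₑ) < ENNReal.ofReal c := by
    refine hmink.trans_lt ?_
    rw [ENNReal.ofReal_lt_ofReal_iff (by positivity), hc]
    calc (A + 1) / (j - β) * (t ^ (β - j) - 1) < (A + 1) / (j - β) * t ^ (β - j) := by
          gcongr; linarith
      _ ≤ _ := by gcongr; linarith
  calc _ ≤ luxNorm (gaussianMeasure d) p (fun x => ‖poissonDeriv j f 1 x‖ₑ +
        ∫⁻ s in Ioc t 1, ‖poissonDeriv (j + 1) f s x‖ₑ) :=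
        luxNorm_mono hp1 (ae_of_all _ fun x => enorm_poissonDeriv_le_add hfm hf j ht ht1 x)
    _ ≤ 2 * ENNReal.ofReal c :=
        luxNorm_add_le_two_mul hp1 hp.aemeasurable
          (measurable_enorm_poissonDeriv hfm j 1).aemeasurable
          ENNReal.ofReal_lt_top h1 h2
    _ = _ := by
        rw [hc, ← ENNReal.ofReal_ofNat, ← ENNReal.ofReal_mul (by positivity), mul_assoc]

end Estimates

/-! ### Inclusions between the Besov-Lipschitz spaces -/

section HalfLine

lemma ae_haarPos_pos : ∀ᵐ t ∂haarPos, 0 < t :=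
  (withDensity_absolutelyContinuous _ _).ae_le (ae_restrict_mem measurableSet_Ioi)

lemma lintegral_haarPos (G : ℝ → ℝ≥0∞) :
    ∫⁻ t, G t ∂haarPos = ∫⁻ t in Ioi (0 : ℝ), ENNReal.ofReal (1 / t) * G t := by
  rw [haarPos, lintegral_withDensity_eq_lintegral_mul_non_measurable _ (by fun_prop) (by simp)]
  rfl

lemma half_le_haarPos_Ioo {t : ℝ} (ht : 0 < t) : 2⁻¹ ≤ haarPos (Ioo (t / 2) t) := by
  rw [haarPos, withDensity_apply _ measurableSet_Ioo, Measure.restrict_restrict measurableSet_Ioo,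
    inter_eq_left.2 (show Ioo (t / 2) t ⊆ Ioi 0 from
      fun s hs => lt_trans (by positivity) hs.1)]
  calc (2⁻¹ : ℝ≥0∞) = ∫⁻ _ in Ioo (t / 2) t, ENNReal.ofReal (1 / t) := by
        rw [setLIntegral_const, Real.volume_Ioo, ← ENNReal.ofReal_mul (by positivity),
          show 1 / t * (t - t / 2) = 2⁻¹ by field_simp; norm_num,
          ENNReal.ofReal_inv_of_pos two_pos, ENNReal.ofReal_ofNat]
    _ ≤ _ := by
        refine setLIntegral_mono' measurableSet_Ioo fun s hs => ENNReal.ofReal_le_ofReal ?_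
        exact one_div_le_one_div_of_le (lt_trans (by positivity) hs.1) hs.2.le

/-- For an almost decreasing function `N`, finiteness of the variable norm of `t^κ N(t)` with
respect to `dt / t` forces `t^κ N(t)` to be bounded: the integral over `(t/2, t)` already controls
the value at `t`. -/
lemma exists_rpow_mul_le_of_luxNorm_lt_top {q : ℝ → ℝ} (hq : ∀ᵐ t ∂haarPos, 1 ≤ q t)
    {N : ℝ → ℝ≥0∞} {C : ℝ≥0∞} (hC : 1 ≤ C) (hCt : C < ∞)
    (hN : ∀ s t, 0 < s → s < t → N t ≤ C * N s) {κ : ℝ} (hκ : 0 ≤ κ)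
    (h : luxNorm haarPos q (fun t => ENNReal.ofReal (t ^ κ) * N t) < ∞) :
    ∃ D : ℝ≥0∞, 0 < D ∧ D < ∞ ∧ ∀ t, 0 < t → ENNReal.ofReal (t ^ κ) * N t ≤ D := by
  obtain ⟨c, hc, hct⟩ := exists_between h
  have hc0 : c ≠ 0 := (pos_of_gt hc).ne'
  have hmod := modular_div_le_one_of_luxNorm_lt hq hc
  have hC0 : C ≠ 0 := fun h => by simp [h] at hC
  obtain ⟨D, hD⟩ : ∃ D : ℝ≥0∞, D = C * ENNReal.ofReal (2 ^ κ) := ⟨_, rfl⟩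
  have h2κ : ENNReal.ofReal ((2 : ℝ) ^ κ) ≠ 0 := by
    have : (0 : ℝ) < 2 ^ κ := by positivity
    simpa using this
  have hD0 : D ≠ 0 := by rw [hD]; exact mul_ne_zero hC0 h2κ
  have hDt : D ≠ ∞ := by rw [hD]; exact ENNReal.mul_ne_top hCt.ne ENNReal.ofReal_ne_top
  refine ⟨2 * (D * c), ?_, ?_, fun t ht => ?_⟩
  · exact pos_iff_ne_zero.2 (mul_ne_zero two_ne_zero (mul_ne_zero hD0 hc0))
  · exact ENNReal.mul_lt_top (by simp) (ENNReal.mul_lt_top hDt.lt_top hct)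
  obtain ⟨v, hv⟩ : ∃ v : ℝ≥0∞, v = ENNReal.ofReal (t ^ κ) * N t / (D * c) := ⟨_, rfl⟩
  suffices hv2 : v ≤ 2 by
    rw [hv, ENNReal.div_le_iff_le_mul (Or.inl (mul_ne_zero hD0 hc0))
      (Or.inl (ENNReal.mul_ne_top hDt hct.ne))] at hv2
    exact hv2
  have hvs : ∀ s ∈ Ioo (t / 2) t, v ≤ ENNReal.ofReal (s ^ κ) * N s / c := by
    intro s hs
    have hs0 : 0 < s := lt_trans (by positivity) hs.1
    have h1 : ENNReal.ofReal (t ^ κ) ≤ ENNReal.ofReal (2 ^ κ) * ENNReal.ofReal (s ^ κ) := by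
      rw [← ENNReal.ofReal_mul (by positivity), ← Real.mul_rpow two_pos.le hs0.le]
      apply ENNReal.ofReal_le_ofReal
      exact Real.rpow_le_rpow ht.le (by linarith [hs.1]) hκ
    rw [hv, ENNReal.div_le_iff_le_mul (Or.inl (mul_ne_zero hD0 hc0))
      (Or.inl (ENNReal.mul_ne_top hDt hct.ne))]
    calc ENNReal.ofReal (t ^ κ) * N t
        ≤ ENNReal.ofReal (2 ^ κ) * ENNReal.ofReal (s ^ κ) * (C * N s) := by
          gcongr; exact hN s t hs0 hs.2
      _ = D * (ENNReal.ofReal (s ^ κ) * N s) := by rw [hD]; ring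
      _ = D * (ENNReal.ofReal (s ^ κ) * N s / c * c) := by
          rw [ENNReal.div_mul_cancel hc0 hct.ne]
      _ = _ := by ring
  rcases le_or_gt v 1 with hv1 | hv1
  · exact hv1.trans (by norm_num)
  have hint : v * 2⁻¹ ≤ 1 := by
    calc v * 2⁻¹ ≤ v * haarPos (Ioo (t / 2) t) := by gcongr; exact half_le_haarPos_Ioo ht
      _ = ∫⁻ _ in Ioo (t / 2) t, v ∂haarPos := (setLIntegral_const _ _).symm
      _ ≤ ∫⁻ s in Ioo (t / 2) t, (ENNReal.ofReal (s ^ κ) * N s / c) ^ q s ∂haarPos := by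
          refine lintegral_mono_ae ?_
          filter_upwards [ae_restrict_mem measurableSet_Ioo, ae_restrict_of_ae hq] with s hs hqs
          calc v = v ^ (1 : ℝ) := by simp
            _ ≤ v ^ q s := ENNReal.rpow_le_rpow_of_exponent_le hv1.le hqs
            _ ≤ _ := ENNReal.rpow_le_rpow (hvs s hs) (by linarith)
      _ ≤ modular haarPos q (fun t => ENNReal.ofReal (t ^ κ) * N t / c) :=
          setLIntegral_le_lintegral _ _
      _ ≤ 1 := hmod
  rwa [← div_eq_mul_inv, ENNReal.div_le_iff_le_mul (by simp) (by simp), one_mul] at hint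

/-- A bounded function in the space with the smaller exponent is in the space with the larger
one. -/
lemma luxNorm_lt_top_of_exponent_le {q₁ q₂ : ℝ → ℝ} (hq₁ : ∀ᵐ t ∂haarPos, 1 ≤ q₁ t)
    (hq : ∀ᵐ t ∂haarPos, q₁ t ≤ q₂ t) {φ : ℝ → ℝ≥0∞} {D : ℝ≥0∞} (hD : D < ∞)
    (hφ : ∀ t, 0 < t → φ t ≤ D) (h : luxNorm haarPos q₁ φ < ∞) : luxNorm haarPos q₂ φ < ∞ := by
  obtain ⟨c, hc, hct⟩ := exists_between h
  have hmod := modular_div_le_one_of_luxNorm_lt hq₁ hc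
  have hc0 : 0 < c := pos_of_gt hc
  refine lt_of_le_of_lt (sInf_le (a := max D c) ⟨hc0.trans_le (le_max_right _ _), max_lt hD hct,
    le_trans ?_ hmod⟩) (max_lt hD hct)
  refine lintegral_mono_ae ?_
  filter_upwards [hq₁, hq, ae_haarPos_pos] with t h1 h12 ht
  have hle : φ t / max D c ≤ 1 := by
    refine ENNReal.div_le_of_le_mul ?_
    rw [one_mul]
    exact (hφ t ht).trans (le_max_left _ _)
  calc (φ t / max D c) ^ q₂ t ≤ (φ t / max D c) ^ q₁ t :=
        ENNReal.rpow_le_rpow_of_exponent_ge hle h12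
    _ ≤ _ := ENNReal.rpow_le_rpow (ENNReal.div_le_div_left (le_max_right _ _) _) (by linarith)

/-- A function with power decay at `0` and at `∞` has finite variable norm with respect to
`dt / t`, whatever the exponent. -/
lemma luxNorm_lt_top_of_power_bounds {q : ℝ → ℝ} (hq : ∀ᵐ t ∂haarPos, 1 ≤ q t)
    {φ : ℝ → ℝ≥0∞} {A a b : ℝ} (hA : 0 < A) (ha : 0 < a) (hb : 0 < b)
    (h0 : ∀ t, 0 < t → t ≤ 1 → φ t ≤ ENNReal.ofReal (A * t ^ a))
    (h1 : ∀ t, 1 < t → φ t ≤ ENNReal.ofReal (A * t ^ (-b))) : luxNorm haarPos q φ < ∞ := by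
  have hA0 : 0 < ENNReal.ofReal A := ENNReal.ofReal_pos.2 hA
  refine luxNorm_lt_top_of_modular_lt_top hq hA0 ENNReal.ofReal_lt_top ?_
  have key : ∀ t u : ℝ, 0 < t → 0 ≤ u → u ≤ 1 → 1 ≤ q t → φ t ≤ ENNReal.ofReal (A * u) →
      (φ t / ENNReal.ofReal A) ^ q t ≤ ENNReal.ofReal u := by
    intro t u _ hu hu1 hqt hle
    have hle' : φ t / ENNReal.ofReal A ≤ ENNReal.ofReal u := by
      rw [ENNReal.div_le_iff_le_mul (Or.inl hA0.ne') (Or.inl ENNReal.ofReal_ne_top),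
        ← ENNReal.ofReal_mul hu, mul_comm]
      exact hle
    calc _ ≤ ENNReal.ofReal u ^ q t := ENNReal.rpow_le_rpow hle' (by linarith)
      _ ≤ ENNReal.ofReal u ^ (1 : ℝ) :=
        ENNReal.rpow_le_rpow_of_exponent_ge (by simpa using hu1) hqt
      _ = _ := by simp
  have hi0 : IntegrableOn (fun t : ℝ => t ^ (a - 1)) (Ioc 0 1) := by
    rw [← intervalIntegrable_iff_integrableOn_Ioc_of_le zero_le_one]
    exact intervalIntegral.intervalIntegrable_rpow' (by linarith)
  have hi1 : IntegrableOn (fun t : ℝ => t ^ (-b - 1)) (Ioi 1) :=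
    integrableOn_Ioi_rpow_of_lt (by linarith) one_pos
  have hle : modular haarPos q (fun t => φ t / ENNReal.ofReal A) ≤
      ∫⁻ t, (Ioc (0 : ℝ) 1).indicator (fun t => ENNReal.ofReal (t ^ a)) t +
        (Ioi (1 : ℝ)).indicator (fun t => ENNReal.ofReal (t ^ (-b))) t ∂haarPos := by
    refine lintegral_mono_ae ?_
    filter_upwards [hq, ae_haarPos_pos] with t hqt ht
    rcases le_or_gt t 1 with ht1 | ht1
    · rw [indicator_of_mem (show t ∈ Ioc (0 : ℝ) 1 from ⟨ht, ht1⟩)]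
      exact (key t _ ht (by positivity) (Real.rpow_le_one ht.le ht1 ha.le) hqt
        (h0 t ht ht1)).trans le_self_add
    · rw [indicator_of_mem (show t ∈ Ioi (1 : ℝ) from ht1)]
      exact (key t _ ht (by positivity) (Real.rpow_le_one_of_one_le_of_nonpos ht1.le
        (by linarith)) hqt (h1 t ht1)).trans le_add_self
  refine hle.trans_lt ?_
  rw [lintegral_add_left (Measurable.indicator (by fun_prop) measurableSet_Ioc),
    lintegral_indicator measurableSet_Ioc, lintegral_indicator measurableSet_Ioi]
  have hset : ∀ (s : Set ℝ) (r : ℝ), MeasurableSet s → s ⊆ Ioi 0 →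
      IntegrableOn (fun t : ℝ => t ^ (r - 1)) s →
      ∫⁻ t in s, ENNReal.ofReal (t ^ r) ∂haarPos < ∞ := by
    intro s r hs hs0 hi
    have e : ∫⁻ t in s, ENNReal.ofReal (t ^ r) ∂haarPos =
        ∫⁻ t in s, ENNReal.ofReal (t ^ (r - 1)) := by
      rw [← lintegral_indicator hs, lintegral_haarPos, ← lintegral_indicator hs,
        ← lintegral_indicator measurableSet_Ioi]
      refine lintegral_congr fun t => ?_
      by_cases ht : t ∈ s
      · have ht0 : 0 < t := hs0 ht
        rw [indicator_of_mem (hs0 ht), indicator_of_mem ht, indicator_of_mem ht,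
          ← ENNReal.ofReal_mul (by positivity), Real.rpow_sub_one ht0.ne']
        congr 1
        ring
      · rw [indicator_of_notMem ht]
        by_cases ht0 : t ∈ Ioi (0 : ℝ)
        · rw [indicator_of_mem ht0, indicator_of_notMem ht, mul_zero]
        · rw [indicator_of_notMem ht0]
    rw [e]
    exact hi.lintegral_lt_top
  exact ENNReal.add_lt_top.2 ⟨hset _ a measurableSet_Ioc (fun t ht => ht.1) hi0,
    hset _ (-b) measurableSet_Ioi (Ioi_subset_Ioi zero_le_one) hi1⟩

end HalfLine

section Besov

variable {d : ℕ} {p : EuclideanSpace ℝ (Fin d) → ℝ} {f : EuclideanSpace ℝ (Fin d) → ℝ}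

/-- A member of the variable Lebesgue space has a measurable integrable representative, with the
same Poisson-Hermite semigroup at every point. -/
lemma exists_measurable_representative (hp : GaussianExponent p)
    (hf : f ∈ variableLp (gaussianMeasure d) p) :
    ∃ g : EuclideanSpace ℝ (Fin d) → ℝ, Measurable g ∧ Integrable g (gaussianMeasure d) ∧
      luxNorm (gaussianMeasure d) p (fun x => ‖g x‖ₑ) < ∞ ∧
      ∀ (k : ℕ) (t : ℝ), 0 < t → derivNorm p k f t =
        luxNorm (gaussianMeasure d) p (fun x => ‖poissonDeriv k g t x‖ₑ) := by
  obtain ⟨hfm, c, hc0, hct, hc⟩ := hf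
  have hg := hfm.measurable_mk
  have hfg := hfm.ae_eq_mk
  generalize hfm.mk f = g at hg hfg
  have hmod : modular (gaussianMeasure d) p (fun x => ‖g x‖ₑ / c) < ∞ := by
    refine lt_of_le_of_lt (modular_mono (ae_of_all _ hp.one_le) ?_) hc
    filter_upwards [hfg] with x hx
    rw [hx]
  have hint : Integrable g (gaussianMeasure d) := by
    refine ⟨hg.aestronglyMeasurable, ?_⟩
    have hpt : ∀ x, ‖g x‖ₑ ≤ c * (1 + (‖g x‖ₑ / c) ^ p x) := by
      intro x
      have h1 := le_add_rpow_mul_rpow (a := ‖g x‖ₑ / c) one_ne_zero ENNReal.one_ne_top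
        (hp.one_le x)
      rw [ENNReal.one_rpow, mul_one] at h1
      calc ‖g x‖ₑ = c * (‖g x‖ₑ / c) := (ENNReal.mul_div_cancel hc0.ne' hct.ne).symm
        _ ≤ _ := by gcongr
    refine (lintegral_mono hpt).trans_lt ?_
    rw [lintegral_const_mul' _ _ hct.ne, lintegral_add_left measurable_const]
    exact ENNReal.mul_lt_top hct (ENNReal.add_lt_top.2 ⟨by simp, hmod⟩)
  refine ⟨g, hg, hint, luxNorm_lt_top_of_modular_lt_top (ae_of_all _ hp.one_le) hc0 hct hmod,
    fun k t ht => ?_⟩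
  have hP : ∀ s x, poissonHermite s f x = poissonHermite s g x := by
    intro s x
    unfold poissonHermite
    congr 1
    funext a
    rw [ouSemigroup_eq_integral_mehlerKernel, ouSemigroup_eq_integral_mehlerKernel]
    congr 1
    refine integral_congr_ae ?_
    filter_upwards [hfg] with y hy
    rw [hy]
  simp only [derivNorm, hP, iteratedDeriv_poissonHermite hg hint k ht]

lemma lt_besovOrder (α : ℝ) : α < besovOrder α := by
  have := Nat.lt_floor_add_one α
  simpa [besovOrder] using this

/-- The weighted norms of the derivatives of a member of a Besov-Lipschitz space are bounded. -/
lemma exists_rpow_mul_derivNorm_le (hp : GaussianExponent p) (hp0 : LogHolderLocal p)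
    {q : ℝ → ℝ} (hq : HalfLineExponent q) {α : ℝ} (hf : f ∈ besov p q α) :
    ∃ D : ℝ≥0∞, 0 < D ∧ D < ∞ ∧ ∀ t, 0 < t →
      ENNReal.ofReal (t ^ ((besovOrder α : ℝ) - α)) * derivNorm p (besovOrder α) f t ≤ D := by
  obtain ⟨g, hgm, hg, _, hgN⟩ := exists_measurable_representative hp hf.1
  obtain ⟨C, hC1, hCt, hC⟩ := exists_luxNorm_poissonDeriv_le_mul hp hp0
  refine exists_rpow_mul_le_of_luxNorm_lt_top hq.one_le hC1 hCt (fun s t hs hst => ?_)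
    (by linarith [lt_besovOrder α]) hf.2
  rw [hgN _ t (hs.trans hst), hgN _ s hs]
  exact hC g hgm hg _ s t hs hst

lemma exists_derivNorm_le (hp : GaussianExponent p) (hp0 : LogHolderLocal p)
    {q : ℝ → ℝ} (hq : HalfLineExponent q) {α : ℝ} (hf : f ∈ besov p q α) :
    ∃ A : ℝ, 0 ≤ A ∧ ∀ t, 0 < t →
      derivNorm p (besovOrder α) f t ≤ ENNReal.ofReal (A * t ^ (-(besovOrder α : ℝ) + α)) := by
  obtain ⟨D, hD0, hDt, hD⟩ := exists_rpow_mul_derivNorm_le hp hp0 hq hf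
  refine ⟨D.toReal, ENNReal.toReal_nonneg, fun t ht => ?_⟩
  have h1 := hD t ht
  have hpos : 0 < t ^ ((besovOrder α : ℝ) - α) := by positivity
  have h0 : ENNReal.ofReal (t ^ ((besovOrder α : ℝ) - α)) ≠ 0 := by simpa using hpos
  rw [mul_comm, ← ENNReal.le_div_iff_mul_le (Or.inl h0) (Or.inl ENNReal.ofReal_ne_top)] at h1
  refine h1.trans (le_of_eq ?_)
  rw [ENNReal.ofReal_mul ENNReal.toReal_nonneg, ENNReal.ofReal_toReal hDt.ne,
    show -(besovOrder α : ℝ) + α = -((besovOrder α : ℝ) - α) by ring, Real.rpow_neg ht.le,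
    ENNReal.ofReal_inv_of_pos hpos, div_eq_mul_inv]

theorem besov_subset_besovInfty (hp : GaussianExponent p) (hp0 : LogHolderLocal p)
    {q : ℝ → ℝ} (hq : HalfLineExponent q) (α : ℝ) : besov p q α ⊆ besovInfty p α := by
  intro f hf
  obtain ⟨A, _, hA⟩ := exists_derivNorm_le hp hp0 hq hf
  exact ⟨hf.1, A, hA⟩

theorem besov_subset_besov_of_exponent_le (hp : GaussianExponent p) (hp0 : LogHolderLocal p)
    {q₁ q₂ : ℝ → ℝ} (hq₁ : HalfLineExponent q₁) (α : ℝ)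
    (hq : ∀ᵐ t ∂haarPos, q₁ t ≤ q₂ t) : besov p q₁ α ⊆ besov p q₂ α := by
  intro f hf
  obtain ⟨D, _, hDt, hD⟩ := exists_rpow_mul_derivNorm_le hp hp0 hq₁ hf
  exact ⟨hf.1, luxNorm_lt_top_of_exponent_le hq₁.one_le hq hDt hD hf.2⟩

theorem besov_subset_besov_of_lt (hp : GaussianExponent p) (hp0 : LogHolderLocal p)
    {q₁ q₂ : ℝ → ℝ} (hq₁ : HalfLineExponent q₁) (hq₂ : HalfLineExponent q₂) {α₁ α₂ : ℝ}
    (hα₂ : 0 < α₂) (hα : α₂ < α₁) : besov p q₁ α₁ ⊆ besov p q₂ α₂ := by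
  intro f hf
  refine ⟨hf.1, ?_⟩
  obtain ⟨g, hgm, hg, hgt, hgN⟩ := exists_measurable_representative hp hf.1
  obtain ⟨A, hA, hfA⟩ := exists_derivNorm_le hp hp0 hq₁ hf
  obtain ⟨n, hn⟩ : ∃ n, besovOrder α₁ = besovOrder α₂ + n :=
    Nat.exists_eq_add_of_le (Nat.succ_le_succ (Nat.floor_mono hα.le))
  have hk := lt_besovOrder α₂
  rw [hn] at hfA
  generalize besovOrder α₂ = k at *
  -- an intermediate smoothness `β`, below `α₁` and below the order `k`
  obtain ⟨β, hβ2, hβ1, hβk⟩ : ∃ β : ℝ, α₂ < β ∧ β ≤ α₁ ∧ β < k := by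
    obtain ⟨β, h1, h2⟩ := exists_between (lt_min hα hk)
    exact ⟨β, h1, (h2.trans_le (min_le_left _ _)).le, h2.trans_le (min_le_right _ _)⟩
  have htop : ∃ A : ℝ, 0 ≤ A ∧ ∀ t, 0 < t → t ≤ 1 →
      luxNorm (gaussianMeasure d) p (fun x => ‖poissonDeriv (k + n) g t x‖ₑ) ≤
        ENNReal.ofReal (A * t ^ (β - ((k + n : ℕ) : ℝ))) := by
    refine ⟨A, hA, fun t ht ht1 => ?_⟩
    rw [← hgN _ t ht]
    refine (hfA t ht).trans (ENNReal.ofReal_le_ofReal ?_)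
    gcongr ?_ * ?_
    exact Real.rpow_le_rpow_of_exponent_ge ht ht1 (by linarith)
  have hdesc : ∃ A : ℝ, 0 ≤ A ∧ ∀ t, 0 < t → t ≤ 1 →
      luxNorm (gaussianMeasure d) p (fun x => ‖poissonDeriv k g t x‖ₑ) ≤
        ENNReal.ofReal (A * t ^ (β - (k : ℝ))) := by
    clear hn hfA
    induction n with
    | zero => exact htop
    | succ n ih =>
      refine ih (exists_luxNorm_poissonDeriv_le_of_succ hp hp0 hgm hg hgt ?_ ?_)
      · push_cast
        linarith [Nat.cast_nonneg (α := ℝ) n]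
      · simpa [add_assoc] using htop
  obtain ⟨A', hA', h0⟩ := hdesc
  obtain ⟨C, hC, hCk⟩ := exists_luxNorm_poissonDeriv_le_rpow hp hp0 k
  set F := (luxNorm (gaussianMeasure d) p (fun x => ‖g x‖ₑ)).toReal with hF
  have hF0 : 0 ≤ F := ENNReal.toReal_nonneg
  refine luxNorm_lt_top_of_power_bounds hq₂.one_le (A := A' + C * F + 1) (a := β - α₂) (b := α₂)
    (by positivity) (by linarith) hα₂ (fun t ht ht1 => ?_) (fun t ht1 => ?_)
  · rw [hgN _ t ht]
    calc _ ≤ ENNReal.ofReal (t ^ ((k : ℝ) - α₂)) * ENNReal.ofReal (A' * t ^ (β - (k : ℝ))) := by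
          gcongr; exact h0 t ht ht1
      _ = ENNReal.ofReal (A' * t ^ (β - α₂)) := by
          rw [← ENNReal.ofReal_mul (by positivity), mul_left_comm, ← Real.rpow_add ht]
          congr 3
          ring
      _ ≤ _ := by
          have : 0 ≤ C * F := by positivity
          gcongr
          linarith
  · have ht : 0 < t := by linarith
    rw [hgN _ t ht]
    calc _ ≤ ENNReal.ofReal (t ^ ((k : ℝ) - α₂)) * (ENNReal.ofReal (C * (t ^ k)⁻¹) *
          luxNorm (gaussianMeasure d) p (fun x => ‖g x‖ₑ)) := by
          gcongr; exact hCk g hgm t ht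
      _ = ENNReal.ofReal (C * F * t ^ (-α₂)) := by
          rw [← ENNReal.ofReal_toReal hgt.ne, ← hF, ← ENNReal.ofReal_mul (by positivity),
            ← ENNReal.ofReal_mul (by positivity), ← Real.rpow_natCast, ← Real.rpow_neg ht.le]
          congr 1
          rw [show -α₂ = ((k : ℝ) - α₂) + -(k : ℝ) by ring, Real.rpow_add ht]
          ring
      _ ≤ _ := by
          gcongr
          linarith

end Besov

end GaussianBesov

theorem mainTheorem2 {d : ℕ} (p : EuclideanSpace ℝ (Fin d) → ℝ)
    (hp : GaussianBesov.GaussianExponent p) (hp0 : GaussianBesov.LogHolderLocal p) :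
    (∀ (q₁ q₂ : ℝ → ℝ) (α₁ α₂ : ℝ),
      GaussianBesov.HalfLineExponent q₁ → GaussianBesov.HalfLineExponent q₂ →
      0 < α₂ → α₂ < α₁ →
      GaussianBesov.besov p q₁ α₁ ⊆ GaussianBesov.besov p q₂ α₂) ∧
    (∀ (q₁ q₂ : ℝ → ℝ) (α : ℝ),
      GaussianBesov.HalfLineExponent q₁ → GaussianBesov.HalfLineExponent q₂ →
      0 ≤ α → (∀ᵐ t ∂GaussianBesov.haarPos, q₁ t ≤ q₂ t) →
      GaussianBesov.besov p q₁ α ⊆ GaussianBesov.besov p q₂ α) ∧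
    (∀ (q : ℝ → ℝ) (α : ℝ), GaussianBesov.HalfLineExponent q → 0 ≤ α →
      GaussianBesov.besov p q α ⊆ GaussianBesov.besovInfty p α) :=
  ⟨fun _ _ _ _ hq₁ hq₂ hα₂ hα => GaussianBesov.besov_subset_besov_of_lt hp hp0 hq₁ hq₂ hα₂ hα,
    fun _ _ α hq₁ _ _ hq => GaussianBesov.besov_subset_besov_of_exponent_le hp hp0 hq₁ α hq,
    fun _ α hq _ => GaussianBesov.besov_subset_besovInfty hp hp0 hq α⟩
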